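/- Let $X$ be a compact connected complex projective manifold of complex dimension $d$, and let $f: X\hookrightarrow \mathbb{CP}^N$ be any holomorphic embedding into a complex projective space. Then $X$ admits a branched flat holomorphic projective structure. More precisely, there is a finite surjective holomorphic map $\gamma: X\to\mathbb{CP}^d$ which is the composition of $f$ with a linear projection (that is, $\gamma(x)=[L(v)]$ whenever $f(x)=[v]$, for some linear map $L:\mathbb{C}^{N+1}\to\mathbb{C}^{d+1}$ whose kernel contains no line belonging to $f(X)$), such that the pullback along $\gamma$ of the standard projective structure on $\mathbb{CP}^d$ is a branched flat holomorphic projective structure on $X$. Here $G=\mathrm{PGL}(d+1,\mathbb{C})$, with Lie algebra $\mathfrak g$, and $Q\subset G$ is the stabilizer of the point $o=[1:0:\cdots:0]$ of $\mathbb{CP}^d$. A branched holomorphic projective structure on $X$ is a holomorphic principal $Q$-bundle $E_Q\to X$ together with a holomorphic $\mathfrak g$-valued $1$-form $\beta$ on $E_Q$ such that (1) $\beta: TE_Q\to E_Q\times\mathfrak g$ is an isomorphism over a nonempty open subset of $X$, (2) $\beta$ is $Q$-equivariant, $Q$ acting on $\mathfrak g$ by the adjoint action, and (3) $\beta$ restricts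 to the Maurer–Cartan form on each fibre of $E_Q\to X$. It is flat if $d\beta+\frac12[\beta,\beta]=0$. The standard projective structure on $\mathbb{CP}^d=G/Q$ is the principal $Q$-bundle $G\to\mathbb{CP}^d$, $g\mapsto g\cdot o$, with the left-invariant Maurer–Cartan form of $G$; its pullback along $\gamma$ is the pulled-back bundle $\gamma^*G$ with the pulled-back form. -/

import Mathlib

open scoped Manifold ContDiff LinearAlgebra.Projectivization MatrixGroups

noncomputable section

namespace CartanGeometry

/-! ### Complex projective space as a complex manifold -/

/-- Complex projective space `ℂPⁿ`: the lines through the origin of `ℂⁿ⁺¹`. -/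
abbrev CP (n : ℕ) : Type := ℙ ℂ (Fin (n + 1) → ℂ)

/-- The quotient topology. -/
instance (n : ℕ) : TopologicalSpace (CP n) :=
  inferInstanceAs (TopologicalSpace (Quotient (projectivizationSetoid ℂ (Fin (n + 1) → ℂ))))

/-- The `j`-th affine coordinate of the `i`-th standard chart as a function of homogeneous
coordinates: `v ↦ v_j / v_i`, with `j` running through the indices different from `i`. -/
def affineCoord {n : ℕ} (i : Fin (n + 1)) (v : Fin (n + 1) → ℂ) : EuclideanSpace ℂ (Fin n) :=
  WithLp.toLp 2 fun j => v (i.succAbove j) / v i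

/-- Homogeneous coordinates of a point of the `i`-th standard chart: insert `1` in position `i`. -/
def homCoord {n : ℕ} (i : Fin (n + 1)) (w : EuclideanSpace ℂ (Fin n)) : Fin (n + 1) → ℂ :=
  i.insertNth (1 : ℂ) (fun j => w j)

theorem homCoord_self {n : ℕ} (i : Fin (n + 1)) (w : EuclideanSpace ℂ (Fin n)) :
    homCoord i w i = 1 := by simp [homCoord]

theorem homCoord_ne_zero {n : ℕ} (i : Fin (n + 1)) (w : EuclideanSpace ℂ (Fin n)) :
    homCoord i w ≠ 0 := fun h => by
  have := homCoord_self i w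
  simp [h] at this

theorem affineCoord_smul {n : ℕ} (i : Fin (n + 1)) (v : Fin (n + 1) → ℂ) (a : ℂˣ) :
    affineCoord i (a • v) = affineCoord i v := by
  have ha : (a : ℂ) ≠ 0 := a.ne_zero
  ext j
  simp only [affineCoord, Pi.smul_apply, Units.smul_def, smul_eq_mul]
  exact mul_div_mul_left _ _ ha

theorem affineCoord_homCoord {n : ℕ} (i : Fin (n + 1)) (w : EuclideanSpace ℂ (Fin n)) :
    affineCoord i (homCoord i w) = w := by
  ext j; simp [affineCoord, homCoord]

theorem homCoord_affineCoord {n : ℕ} (i : Fin (n + 1)) (v : Fin (n + 1) → ℂ) (h : v i ≠ 0) :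
    homCoord i (affineCoord i v) = (v i)⁻¹ • v := by
  ext k
  rcases Fin.eq_self_or_eq_succAbove i k with rfl | ⟨j, rfl⟩
  · simp [homCoord, h]
  · simp [homCoord, affineCoord, div_eq_inv_mul]

theorem exists_smul_rep {n : ℕ} (v : Fin (n + 1) → ℂ) (hv : v ≠ 0) :
    ∃ a : ℂˣ, (Projectivization.mk ℂ v hv).rep = a • v := by
  obtain ⟨a, ha⟩ := Projectivization.exists_smul_eq_mk_rep ℂ v hv
  exact ⟨a, ha.symm⟩

theorem rep_apply_ne_zero_iff {n : ℕ} (v : Fin (n + 1) → ℂ) (hv : v ≠ 0) (i : Fin (n + 1)) :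
    (Projectivization.mk ℂ v hv).rep i ≠ 0 ↔ v i ≠ 0 := by
  obtain ⟨a, ha⟩ := exists_smul_rep v hv
  simp [ha, Units.smul_def]

theorem affineCoord_rep {n : ℕ} (v : Fin (n + 1) → ℂ) (hv : v ≠ 0) (i : Fin (n + 1)) :
    affineCoord i (Projectivization.mk ℂ v hv).rep = affineCoord i v := by
  obtain ⟨a, ha⟩ := exists_smul_rep v hv
  rw [ha, affineCoord_smul]

theorem isQuotientMap_mk' (n : ℕ) :
    Topology.IsQuotientMap (Projectivization.mk' ℂ : {v : Fin (n + 1) → ℂ // v ≠ 0} → CP n) :=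
  isQuotientMap_quotient_mk'

theorem continuous_homCoord {n : ℕ} (i : Fin (n + 1)) :
    Continuous (homCoord i : EuclideanSpace ℂ (Fin n) → Fin (n + 1) → ℂ) := by
  refine continuous_pi fun k => ?_
  rcases Fin.eq_self_or_eq_succAbove i k with rfl | ⟨j, rfl⟩
  · simp only [homCoord_self]; fun_prop
  · simp only [homCoord, Fin.insertNth_apply_succAbove]; fun_prop

theorem isOpen_chart_source {n : ℕ} (i : Fin (n + 1)) : IsOpen {p : CP n | p.rep i ≠ 0} := by
  rw [← (isQuotientMap_mk' n).isOpen_preimage]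
  have : (Projectivization.mk' ℂ : {v : Fin (n + 1) → ℂ // v ≠ 0} → CP n) ⁻¹'
      {p : CP n | p.rep i ≠ 0} = {v | v.1 i ≠ 0} := by
    ext v
    exact rep_apply_ne_zero_iff v.1 v.2 i
  rw [this]
  exact isOpen_ne_fun ((continuous_apply i).comp continuous_subtype_val) continuous_const

/-- The `i`-th standard affine chart of `ℂPⁿ`. -/
def affineChart {n : ℕ} (i : Fin (n + 1)) :
    OpenPartialHomeomorph (CP n) (EuclideanSpace ℂ (Fin n)) where
  toFun p := affineCoord i p.rep
  invFun w := Projectivization.mk ℂ (homCoord i w) (homCoord_ne_zero i w)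
  source := {p | p.rep i ≠ 0}
  target := Set.univ
  map_source' _ _ := Set.mem_univ _
  map_target' w _ := by
    rw [Set.mem_ofPred_eq, rep_apply_ne_zero_iff, homCoord_self]
    exact one_ne_zero
  left_inv' p hp := by
    conv_rhs => rw [← p.mk_rep]
    rw [Projectivization.mk_eq_mk_iff']
    exact ⟨(p.rep i)⁻¹, (homCoord_affineCoord i p.rep hp).symm⟩
  right_inv' w _ := by rw [affineCoord_rep, affineCoord_homCoord]
  open_source := isOpen_chart_source i
  open_target := isOpen_univ
  continuousOn_toFun := by
    rw [(isQuotientMap_mk' n).continuousOn_isOpen_iff (isOpen_chart_source i)]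
    have h : ContinuousOn (fun v : {v : Fin (n + 1) → ℂ // v ≠ 0} => affineCoord i v.1)
        {v | v.1 i ≠ 0} := by
      refine (PiLp.continuous_toLp 2 _).comp_continuousOn (continuousOn_pi.2 fun j => ?_)
      exact ContinuousOn.div ((continuous_apply _).comp continuous_subtype_val).continuousOn
        ((continuous_apply i).comp continuous_subtype_val).continuousOn fun v hv => hv
    refine ContinuousOn.congr (h.mono fun v hv => ?_) fun v _ => affineCoord_rep v.1 v.2 i
    exact (rep_apply_ne_zero_iff v.1 v.2 i).1 hv
  continuousOn_invFun := by
    refine Continuous.continuousOn ?_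
    exact (isQuotientMap_mk' n).continuous.comp
      (Continuous.subtype_mk (continuous_homCoord i) (homCoord_ne_zero i))

theorem exists_rep_ne_zero {n : ℕ} (p : CP n) : ∃ i, p.rep i ≠ 0 := by
  by_contra! h
  exact p.rep_nonzero (funext h)

/-- The standard atlas of `ℂPⁿ`. -/
instance (n : ℕ) : ChartedSpace (EuclideanSpace ℂ (Fin n)) (CP n) where
  atlas := Set.range affineChart
  chartAt p := affineChart (exists_rep_ne_zero p).choose
  mem_chart_source p := (exists_rep_ne_zero p).choose_spec
  chart_mem_atlas _ := Set.mem_range_self _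

theorem contDiff_homCoord {n : ℕ} (i k : Fin (n + 1)) :
    ContDiff ℂ ω fun w : EuclideanSpace ℂ (Fin n) => homCoord i w k := by
  rcases Fin.eq_self_or_eq_succAbove i k with rfl | ⟨j, rfl⟩
  · simp only [homCoord_self]; exact contDiff_const
  · simp only [homCoord, Fin.insertNth_apply_succAbove]; fun_prop

instance (n : ℕ) : IsManifold 𝓘(ℂ, EuclideanSpace ℂ (Fin n)) ω (CP n) := by
  refine isManifold_of_contDiffOn _ _ _ ?_
  rintro _ _ ⟨i, rfl⟩ ⟨j, rfl⟩
  have h : ContDiffOn ℂ ω (fun w : EuclideanSpace ℂ (Fin n) => affineCoord j (homCoord i w))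
      {w | homCoord i w j ≠ 0} := by
    rw [contDiffOn_euclidean]
    intro k
    exact ContDiffOn.div (contDiff_homCoord _ _).contDiffOn (contDiff_homCoord _ _).contDiffOn
      fun w hw => hw
  refine (h.mono fun w hw => ?_).congr fun w _ => affineCoord_rep _ (homCoord_ne_zero i w) j
  have hw' : (Projectivization.mk ℂ (homCoord i w) (homCoord_ne_zero i w)).rep j ≠ 0 := by
    simpa [affineChart] using hw
  exact (rep_apply_ne_zero_iff _ _ _).1 hw'

/-! ### `PGL(d + 1, ℂ)` as a complex Lie group -/

/-- The group of automorphisms of `ℂPᵈ`. -/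
abbrev PG (d : ℕ) : Type := Matrix.ProjGenLinGroup (Fin (d + 1)) ℂ

/-- The `(d + 1) × (d + 1)` complex matrices, as a normed algebra. All norms on this space being
equivalent, the choice is irrelevant. -/
def Mat (d : ℕ) : Type := Matrix (Fin (d + 1)) (Fin (d + 1)) ℂ

instance Mat.normedRing (d : ℕ) : NormedRing (Mat d) :=
  (Matrix.linftyOpNormedRing : NormedRing (Matrix (Fin (d + 1)) (Fin (d + 1)) ℂ))

instance Mat.normedAlgebra (d : ℕ) : NormedAlgebra ℂ (Mat d) :=
  @Matrix.linftyOpNormedAlgebra ℂ (Fin (d + 1)) ℂ _ _ _ _ _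

/-- Matrices as elements of the normed algebra of matrices. -/
def Mat.of (d : ℕ) : Matrix (Fin (d + 1)) (Fin (d + 1)) ℂ ≃ₐ[ℂ] Mat d where
  toFun M := M
  invFun M := M
  left_inv _ := rfl
  right_inv _ := rfl
  map_mul' _ _ := rfl
  map_add' _ _ := rfl
  commutes' _ := rfl

attribute [irreducible] Mat.normedRing Mat.normedAlgebra

instance (d : ℕ) : FiniteDimensional ℂ (Mat d) :=
  Module.Finite.of_surjective (Mat.of d).toLinearMap (Mat.of d).surjective

instance (d : ℕ) : CompleteSpace (Mat d) := FiniteDimensional.complete ℂ (Mat d)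

/-- The quotient topology. -/
instance (d : ℕ) : TopologicalSpace (PG d) :=
  inferInstanceAs (TopologicalSpace (GL (Fin (d + 1)) ℂ ⧸ Subgroup.center (GL (Fin (d + 1)) ℂ)))

instance (d : ℕ) : IsTopologicalGroup (PG d) :=
  inferInstanceAs
    (IsTopologicalGroup (GL (Fin (d + 1)) ℂ ⧸ Subgroup.center (GL (Fin (d + 1)) ℂ)))

/-- The trace. -/
def Mat.trace (d : ℕ) : Mat d →ₗ[ℂ] ℂ :=
  (Matrix.traceLinearMap (Fin (d + 1)) ℂ ℂ).comp (Mat.of d).symm.toLinearMap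

/-- The normalized trace, with value `1` at the identity matrix. -/
def ntrace (d : ℕ) : Mat d →L[ℂ] ℂ :=
  LinearMap.toContinuousLinearMap ((d + 1 : ℂ)⁻¹ • Mat.trace d)

theorem ntrace_apply {d : ℕ} (M : Mat d) : ntrace d M = (d + 1 : ℂ)⁻¹ * Mat.trace d M := rfl

theorem ntrace_one (d : ℕ) : ntrace d 1 = 1 := by
  have h : (d + 1 : ℂ) ≠ 0 := by exact_mod_cast d.succ_ne_zero
  have h1 : Mat.trace d 1 = (d + 1 : ℂ) := by
    simp [Mat.trace]
  rw [ntrace_apply, h1, inv_mul_cancel₀ h]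

/-- The trace-free matrices. -/
def slSubmodule (d : ℕ) : Submodule ℂ (Mat d) := LinearMap.ker (Mat.trace d)

/-- The Lie algebra `𝔰𝔩(d + 1, ℂ)` of trace-free matrices, as a normed space. -/
def Sl (d : ℕ) : Type := slSubmodule d

instance (d : ℕ) : NormedAddCommGroup (Sl d) := inferInstanceAs (NormedAddCommGroup (slSubmodule d))

instance (d : ℕ) : NormedSpace ℂ (Sl d) := inferInstanceAs (NormedSpace ℂ (slSubmodule d))

instance (d : ℕ) : FiniteDimensional ℂ (Sl d) :=
  inferInstanceAs (FiniteDimensional ℂ (slSubmodule d))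

/-- The inclusion of the trace-free matrices in all matrices. -/
def Sl.incl (d : ℕ) : Sl d →L[ℂ] Mat d := (slSubmodule d).subtypeL

theorem Sl.incl_injective (d : ℕ) : Function.Injective (Sl.incl d) := Subtype.val_injective

theorem Sl.ntrace_incl {d : ℕ} (Y : Sl d) : ntrace d (Sl.incl d Y) = 0 := by
  have h : Mat.trace d (Sl.incl d Y) = 0 := Y.2
  rw [ntrace_apply, h, mul_zero]

/-- The projection of a matrix to its trace-free part. -/
def traceFree (d : ℕ) : Mat d →L[ℂ] Sl d :=
  (ContinuousLinearMap.id ℂ (Mat d) - (ntrace d).smulRight (1 : Mat d)).codRestrict (slSubmodule d)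
    fun M => by
      have h0 : (d + 1 : ℂ) ≠ 0 := by exact_mod_cast d.succ_ne_zero
      have h : ntrace d ((ContinuousLinearMap.id ℂ (Mat d) -
          (ntrace d).smulRight (1 : Mat d)) M) = 0 := by
        simp [ntrace_one]
      rw [ntrace_apply] at h
      exact (mul_eq_zero.1 h).resolve_left (inv_ne_zero h0)

theorem traceFree_coe {d : ℕ} (M : Mat d) :
    Sl.incl d (traceFree d M) = M - ntrace d M • 1 := rfl

/-- The trace-free matrix `Y` for which `1 + Y` is proportional to `M`, if the trace of `M` is not
zero. -/
def slCoord {d : ℕ} (M : Mat d) : Sl d := traceFree d ((ntrace d M)⁻¹ • M)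

theorem slCoord_smul {d : ℕ} {a : ℂ} (ha : a ≠ 0) (M : Mat d) : slCoord (a • M) = slCoord M := by
  simp only [slCoord, map_smul, smul_smul, smul_eq_mul]
  congr 1
  rw [mul_inv, mul_right_comm, inv_mul_cancel₀ ha, one_mul]

theorem slCoord_one_add {d : ℕ} (Y : Sl d) : slCoord (1 + Sl.incl d Y) = Y := by
  have h := Y.ntrace_incl
  refine Sl.incl_injective d ?_
  rw [slCoord, traceFree_coe, map_add, h, ntrace_one, add_zero, inv_one, one_smul, map_add, h,
    ntrace_one, add_zero, one_smul, add_sub_cancel_left]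

theorem one_add_slCoord {d : ℕ} (M : Mat d) (h : ntrace d M ≠ 0) :
    1 + Sl.incl d (slCoord M) = (ntrace d M)⁻¹ • M := by
  rw [slCoord, traceFree_coe, map_smul, smul_eq_mul, inv_mul_cancel₀ h, one_smul,
    add_sub_cancel]

/-- Invertible matrices as units of the normed algebra of matrices. -/
def glEquiv (d : ℕ) : GL (Fin (d + 1)) ℂ ≃* (Mat d)ˣ :=
  Units.mapEquiv (Mat.of d).toMulEquiv

/-- The class in `PGL(d + 1, ℂ)` of an invertible matrix. -/
def PG.mk (d : ℕ) : (Mat d)ˣ →* PG d :=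
  Matrix.ProjGenLinGroup.mk.comp (glEquiv d).symm.toMonoidHom

theorem PG.mk_surjective (d : ℕ) : Function.Surjective (PG.mk d) :=
  Matrix.ProjGenLinGroup.mk_surjective.comp (glEquiv d).symm.surjective

theorem glEquiv_scalar {d : ℕ} (u : ℂˣ) :
    ((glEquiv d (Matrix.GeneralLinearGroup.scalar (Fin (d + 1)) u) : (Mat d)ˣ) : Mat d) =
      (u : ℂ) • (1 : Mat d) := by
  have h : (Matrix.GeneralLinearGroup.scalar (Fin (d + 1)) u :
      Matrix (Fin (d + 1)) (Fin (d + 1)) ℂ) = (u : ℂ) • 1 := by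
    ext i j
    simp [Matrix.one_apply, Matrix.diagonal_apply]
  change Mat.of d _ = _
  rw [h, map_smul, map_one]

theorem PG.mk_eq_mk_iff {d : ℕ} {M N : (Mat d)ˣ} :
    PG.mk d M = PG.mk d N ↔ ∃ a : ℂˣ, (N : Mat d) = (a : ℂ) • (M : Mat d) := by
  change Matrix.ProjGenLinGroup.mk ((glEquiv d).symm M) =
    Matrix.ProjGenLinGroup.mk ((glEquiv d).symm N) ↔ _
  rw [Matrix.ProjGenLinGroup.mk_eq_mk_iff]
  refine exists_congr fun u => ?_
  rw [← (glEquiv d).injective.eq_iff, map_mul, MulEquiv.apply_symm_apply,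
    MulEquiv.apply_symm_apply, Units.ext_iff, Units.val_mul, glEquiv_scalar, mul_smul_comm, mul_one]
  exact eq_comm

theorem PG.isQuotientMap_mk (d : ℕ) : Topology.IsQuotientMap (PG.mk d) := by
  have h0 : Continuous (Mat.of d) :=
    LinearMap.continuous_of_finiteDimensional (Mat.of d).toLinearMap
  have h0' : Continuous (Mat.of d).symm :=
    LinearMap.continuous_of_finiteDimensional (Mat.of d).symm.toLinearMap
  have h1 : Continuous (glEquiv d) := Continuous.units_map (Mat.of d).toMulEquiv.toMonoidHom h0
  have h2 : Continuous (glEquiv d).symm :=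
    Continuous.units_map (Mat.of d).symm.toMulEquiv.toMonoidHom h0'
  let e : (Mat d)ˣ ≃ₜ GL (Fin (d + 1)) ℂ :=
    { (glEquiv d).symm.toEquiv with
      continuous_toFun := h2
      continuous_invFun := h1 }
  have h3 : Topology.IsQuotientMap (Matrix.ProjGenLinGroup.mk : GL (Fin (d + 1)) ℂ → PG d) :=
    isQuotientMap_quotient_mk'
  exact h3.comp e.isQuotientMap

/-- A matrix representing an element of `PGL(d + 1, ℂ)`. -/
def PG.rep {d : ℕ} (g : PG d) : (Mat d)ˣ := (PG.mk_surjective d g).choose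

theorem PG.mk_rep {d : ℕ} (g : PG d) : PG.mk d (PG.rep g) = g := (PG.mk_surjective d g).choose_spec

theorem PG.exists_rep_mk {d : ℕ} (M : (Mat d)ˣ) :
    ∃ a : ℂ, a ≠ 0 ∧ (PG.rep (PG.mk d M) : Mat d) = a • (M : Mat d) := by
  obtain ⟨u, hu⟩ := PG.mk_eq_mk_iff.1 (PG.mk_rep (PG.mk d M)).symm
  exact ⟨u, u.ne_zero, hu⟩

theorem slCoord_rep_mk {d : ℕ} (M : (Mat d)ˣ) :
    slCoord (PG.rep (PG.mk d M) : Mat d) = slCoord (M : Mat d) := by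
  obtain ⟨a, ha, h⟩ := PG.exists_rep_mk M
  rw [h, slCoord_smul ha]

theorem ntrace_rep_mk_ne_zero_iff {d : ℕ} (M : (Mat d)ˣ) :
    ntrace d (PG.rep (PG.mk d M) : Mat d) ≠ 0 ↔ ntrace d (M : Mat d) ≠ 0 := by
  obtain ⟨a, ha, h⟩ := PG.exists_rep_mk M
  simp [h, ha]

open Classical in
/-- The class in `PGL(d + 1, ℂ)` of an invertible matrix. -/
def PG.ofMat {d : ℕ} (M : Mat d) : PG d :=
  if h : IsUnit M then PG.mk d h.unit else 1

theorem PG.ofMat_coe {d : ℕ} (M : (Mat d)ˣ) :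
    PG.ofMat (M : Mat d) = PG.mk d M := by
  rw [PG.ofMat, dif_pos M.isUnit]
  congr 1
  ext1
  rfl

theorem PG.ofMat_one (d : ℕ) : PG.ofMat (1 : Mat d) = 1 := by
  rw [← Units.val_one, PG.ofMat_coe, map_one]

theorem PG.ofMat_rep {d : ℕ} (g : PG d) : PG.ofMat ((PG.rep g) : Mat d) = g := by
  rw [PG.ofMat_coe, PG.mk_rep]

theorem PG.ofMat_mul {d : ℕ} {M N : Mat d} (hM : IsUnit M) (hN : IsUnit N) :
    PG.ofMat (M * N) = PG.ofMat M * PG.ofMat N := by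
  obtain ⟨M, rfl⟩ := hM
  obtain ⟨N, rfl⟩ := hN
  rw [← Units.val_mul]
  simp only [PG.ofMat_coe, map_mul]

theorem PG.ofMat_smul {d : ℕ} {a : ℂ} (ha : a ≠ 0) {M : Mat d} (hM : IsUnit M) :
    PG.ofMat (a • M) = PG.ofMat M := by
  obtain ⟨M, rfl⟩ := hM
  obtain ⟨N, hN⟩ : IsUnit (a • (M : Mat d)) := M.isUnit.smul (Units.mk0 a ha)
  rw [← hN, PG.ofMat_coe, PG.ofMat_coe, eq_comm, PG.mk_eq_mk_iff]
  exact ⟨Units.mk0 a ha, hN⟩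

theorem slCoord_rep_ofMat {d : ℕ} {M : Mat d} (hM : IsUnit M) :
    slCoord (PG.rep (PG.ofMat M) : Mat d) = slCoord M := by
  obtain ⟨M, rfl⟩ := hM
  rw [PG.ofMat_coe, slCoord_rep_mk]

theorem ntrace_rep_ofMat_ne_zero_iff {d : ℕ} {M : Mat d} (hM : IsUnit M) :
    ntrace d (PG.rep (PG.ofMat M) : Mat d) ≠ 0 ↔ ntrace d M ≠ 0 := by
  obtain ⟨M, rfl⟩ := hM
  rw [PG.ofMat_coe, ntrace_rep_mk_ne_zero_iff]

theorem PG.continuousAt_ofMat {d : ℕ} {M : Mat d} (hM : IsUnit M) : ContinuousAt PG.ofMat M := by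
  obtain ⟨M, rfl⟩ := hM
  have h : Topology.IsOpenEmbedding (Units.val : (Mat d)ˣ → Mat d) := Units.isOpenEmbedding_val
  rw [← h.continuousAt_iff]
  have : (PG.ofMat ∘ Units.val : (Mat d)ˣ → PG d) = PG.mk d :=
    funext PG.ofMat_coe
  rw [this]
  exact (PG.isQuotientMap_mk d).continuous.continuousAt

theorem contDiffAt_slCoord {d : ℕ} {M : Mat d} (hM : ntrace d M ≠ 0) :
    ContDiffAt ℂ ω (slCoord : Mat d → Sl d) M :=
  ContDiffAt.comp (g := traceFree d) (f := fun M : Mat d => (ntrace d M)⁻¹ • M) M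
    (traceFree d).contDiff.contDiffAt (((ntrace d).contDiff.contDiffAt.inv hM).smul contDiffAt_id)

theorem contDiff_one_add (d : ℕ) : ContDiff ℂ ω fun Y : Sl d => 1 + Sl.incl d Y := by
  exact contDiff_const.add (Sl.incl d).contDiff

theorem PG.isOpen_source (d : ℕ) : IsOpen {g : PG d | ntrace d ((PG.rep g) : Mat d) ≠ 0} := by
  rw [← (PG.isQuotientMap_mk d).isOpen_preimage]
  have : PG.mk d ⁻¹'
      {g : PG d | ntrace d ((PG.rep g) : Mat d) ≠ 0} = {M : (Mat d)ˣ | ntrace d (M : Mat d) ≠ 0} := by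
    ext M
    exact ntrace_rep_mk_ne_zero_iff M
  rw [this]
  exact isOpen_ne_fun ((ntrace d).continuous.comp Units.continuous_val) continuous_const

theorem isOpen_unit_one_add (d : ℕ) : IsOpen {Y : Sl d | IsUnit (1 + Sl.incl d Y)} := by
  have h : IsOpen {M : Mat d | IsUnit M} := Units.isOpen
  exact h.preimage (continuous_const.add (Sl.incl d).continuous)

/-- The chart of `PGL(d + 1, ℂ)` around the identity with values in the trace-free matrices, in
which a trace-free matrix `Y` with `1 + Y` invertible stands for the class of `1 + Y`. -/
def PG.chartOne (d : ℕ) : OpenPartialHomeomorph (PG d) (Sl d) where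
  toFun g := slCoord ((PG.rep g) : Mat d)
  invFun Y := PG.ofMat (1 + Sl.incl d Y)
  source := {g | ntrace d ((PG.rep g) : Mat d) ≠ 0}
  target := {Y | IsUnit (1 + Sl.incl d Y)}
  map_source' g hg := by
    rw [Set.mem_ofPred_eq, one_add_slCoord _ hg]
    exact (PG.rep g).isUnit.smul (Units.mk0 _ (inv_ne_zero hg))
  map_target' Y hY := by
    rw [Set.mem_ofPred_eq, ntrace_rep_ofMat_ne_zero_iff hY, map_add, ntrace_one,
      Y.ntrace_incl]
    simp
  left_inv' g hg := by
    rw [one_add_slCoord _ hg, PG.ofMat_smul (inv_ne_zero hg) (PG.rep g).isUnit, PG.ofMat_rep]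
  right_inv' Y hY := by rw [slCoord_rep_ofMat hY, slCoord_one_add]
  open_source := PG.isOpen_source d
  open_target := isOpen_unit_one_add d
  continuousOn_toFun := by
    rw [(PG.isQuotientMap_mk d).continuousOn_isOpen_iff (PG.isOpen_source d)]
    have h : ContinuousOn (fun M : (Mat d)ˣ => slCoord (M : Mat d))
        {M | ntrace d (M : Mat d) ≠ 0} := fun M hM =>
      ((contDiffAt_slCoord hM).continuousAt.comp
        Units.continuous_val.continuousAt).continuousWithinAt
    exact ContinuousOn.congr (h.mono fun M hM => (ntrace_rep_mk_ne_zero_iff M).1 hM)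
      fun M _ => slCoord_rep_mk M
  continuousOn_invFun Y hY := by
    refine ContinuousAt.continuousWithinAt ?_
    exact ContinuousAt.comp (f := fun Y : Sl d => 1 + Sl.incl d Y) (PG.continuousAt_ofMat hY)
      (continuous_const.add (Sl.incl d).continuous).continuousAt

/-- The left translate to `a` of the chart around the identity. -/
def PG.chart {d : ℕ} (a : PG d) : OpenPartialHomeomorph (PG d) (Sl d) :=
  (Homeomorph.mulLeft a⁻¹).toOpenPartialHomeomorph.trans (PG.chartOne d)

theorem PG.mem_chart_self {d : ℕ} (a : PG d) : a ∈ (PG.chart a).source := by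
  have h : ntrace d (PG.rep (PG.ofMat (1 : Mat d)) : Mat d) ≠ 0 := by
    rw [ntrace_rep_ofMat_ne_zero_iff isUnit_one, ntrace_one]
    exact one_ne_zero
  have h1 : PG.ofMat (1 : Mat d) = 1 := PG.ofMat_one d
  rw [h1] at h
  simpa [PG.chart, PG.chartOne] using h

/-- The atlas of left translates of the chart around the identity. -/
instance (d : ℕ) : ChartedSpace (Sl d) (PG d) where
  atlas := Set.range PG.chart
  chartAt := PG.chart
  mem_chart_source := PG.mem_chart_self
  chart_mem_atlas a := Set.mem_range_self a

theorem PG.chart_apply {d : ℕ} (a g : PG d) :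
    PG.chart a g = slCoord (PG.rep (a⁻¹ * g) : Mat d) := rfl

theorem PG.mem_chart_source {d : ℕ} (a g : PG d) :
    g ∈ (PG.chart a).source ↔ ntrace d (PG.rep (a⁻¹ * g) : Mat d) ≠ 0 := by
  simp [PG.chart, PG.chartOne]

theorem PG.chart_symm_apply {d : ℕ} (a : PG d) (Y : Sl d) :
    (PG.chart a).symm Y = a * PG.ofMat (1 + Sl.incl d Y) := by
  change (Homeomorph.mulLeft a⁻¹).symm (PG.ofMat (1 + Sl.incl d Y)) = _
  rw [Homeomorph.mulLeft_symm, inv_inv]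
  rfl

theorem PG.mem_chart_target {d : ℕ} (a : PG d) (Y : Sl d) :
    Y ∈ (PG.chart a).target ↔ IsUnit (1 + Sl.incl d Y) := by
  simp [PG.chart, PG.chartOne]

theorem PG.chart_ofMat {d : ℕ} (a : PG d) {M : Mat d} (hM : IsUnit M) :
    PG.chart a (PG.ofMat M) = slCoord (((PG.rep a⁻¹) : Mat d) * M) := by
  rw [PG.chart_apply, ← slCoord_rep_ofMat ((PG.rep a⁻¹).isUnit.mul hM),
    PG.ofMat_mul (PG.rep a⁻¹).isUnit hM, PG.ofMat_rep]

theorem PG.ofMat_mem_chart_source {d : ℕ} (a : PG d) {M : Mat d} (hM : IsUnit M) :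
    PG.ofMat M ∈ (PG.chart a).source ↔ ntrace d (((PG.rep a⁻¹) : Mat d) * M) ≠ 0 := by
  rw [PG.mem_chart_source, ← ntrace_rep_ofMat_ne_zero_iff ((PG.rep a⁻¹).isUnit.mul hM),
    PG.ofMat_mul (PG.rep a⁻¹).isUnit hM, PG.ofMat_rep]

theorem PG.contDiffOn_transition {d : ℕ} (a b : PG d) :
    ContDiffOn ℂ ω (fun Y => PG.chart b ((PG.chart a).symm Y))
      {Y | Y ∈ (PG.chart a).target ∧ (PG.chart a).symm Y ∈ (PG.chart b).source} := by
  rintro Y ⟨hY1, hY2⟩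
  rw [PG.mem_chart_target] at hY1
  have key : ∀ Z : Sl d, IsUnit (1 + Sl.incl d Z) →
      (PG.chart a).symm Z = PG.ofMat ((PG.rep a : Mat d) * (1 + Sl.incl d Z)) := fun Z hZ => by
    rw [PG.chart_symm_apply, PG.ofMat_mul (PG.rep a).isUnit hZ, PG.ofMat_rep]
  rw [key Y hY1, PG.ofMat_mem_chart_source _ ((PG.rep a).isUnit.mul hY1)] at hY2
  have h : ContDiffAt ℂ ω (fun Z : Sl d =>
      slCoord ((PG.rep b⁻¹ : Mat d) * ((PG.rep a : Mat d) * (1 + Sl.incl d Z)))) Y := by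
    refine ContDiffAt.comp (g := slCoord)
      (f := fun Z : Sl d => (PG.rep b⁻¹ : Mat d) * ((PG.rep a : Mat d) * (1 + Sl.incl d Z))) Y
      (contDiffAt_slCoord hY2) ?_
    exact (contDiff_const.mul (contDiff_const.mul (contDiff_one_add d))).contDiffAt
  refine h.contDiffWithinAt.congr (fun Z hZ => ?_) ?_
  · have hZ1 := (PG.mem_chart_target a Z).1 hZ.1
    rw [key Z hZ1, PG.chart_ofMat _ ((PG.rep a).isUnit.mul hZ1)]
  · rw [key Y hY1, PG.chart_ofMat _ ((PG.rep a).isUnit.mul hY1)]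

instance (d : ℕ) : IsManifold 𝓘(ℂ, Sl d) ω (PG d) := by
  refine isManifold_of_contDiffOn _ _ _ ?_
  rintro _ _ ⟨a, rfl⟩ ⟨b, rfl⟩
  refine (PG.contDiffOn_transition a b).mono fun Y hY => ?_
  simpa using hY

theorem PG.contMDiffAt_ofMat {d : ℕ} {M : Mat d} (hM : IsUnit M) :
    ContMDiffAt 𝓘(ℂ, Mat d) 𝓘(ℂ, Sl d) ω PG.ofMat M := by
  rw [contMDiffAt_iff_target]
  refine ⟨PG.continuousAt_ofMat hM, ?_⟩
  have h0 : PG.ofMat M ∈ (PG.chart (PG.ofMat M)).source :=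
    PG.mem_chart_self _
  rw [PG.ofMat_mem_chart_source _ hM] at h0
  have h1 : ContDiffAt ℂ ω (fun N : Mat d => (PG.rep (PG.ofMat M)⁻¹ : Mat d) * N) M :=
    contDiffAt_const.mul contDiffAt_id
  have h2 : ContDiffAt ℂ ω (slCoord : Mat d → Sl d) ((PG.rep (PG.ofMat M)⁻¹ : Mat d) * M) :=
    contDiffAt_slCoord h0
  have h : ContDiffAt ℂ ω (fun N : Mat d => slCoord ((PG.rep (PG.ofMat M)⁻¹ : Mat d) * N)) M :=
    ContDiffAt.comp (g := slCoord) (f := fun N : Mat d => (PG.rep (PG.ofMat M)⁻¹ : Mat d) * N) M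
      h2 h1
  refine h.contMDiffAt.congr_of_eventuallyEq ?_
  have hu : IsOpen {M : Mat d | IsUnit M} := Units.isOpen
  filter_upwards [hu.mem_nhds hM] with N hN
  exact PG.chart_ofMat (PG.ofMat M) hN

/-- A holomorphic choice of representing matrices near `a`. -/
def PG.localRep {d : ℕ} (a g : PG d) : Mat d :=
  ((PG.rep a) : Mat d) * (1 + Sl.incl d (PG.chart a g))

theorem PG.isUnit_localRep {d : ℕ} {a g : PG d} (hg : g ∈ (PG.chart a).source) :
    IsUnit (PG.localRep a g) :=
  (PG.rep a).isUnit.mul ((PG.mem_chart_target a _).1 ((PG.chart a).map_source hg))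

theorem PG.ofMat_localRep {d : ℕ} {a g : PG d} (hg : g ∈ (PG.chart a).source) :
    PG.ofMat (PG.localRep a g) = g := by
  rw [PG.localRep, PG.ofMat_mul (PG.rep a).isUnit
    ((PG.mem_chart_target a _).1 ((PG.chart a).map_source hg)), PG.ofMat_rep,
    ← PG.chart_symm_apply, (PG.chart a).left_inv hg]

theorem PG.contMDiffAt_localRep {d : ℕ} (a : PG d) :
    ContMDiffAt 𝓘(ℂ, Sl d) 𝓘(ℂ, Mat d) ω (PG.localRep a) a := by
  have h : ContMDiffAt 𝓘(ℂ, Sl d) 𝓘(ℂ, Sl d) ω (PG.chart a) a :=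
    contMDiffAt_of_mem_maximalAtlas (IsManifold.chart_mem_maximalAtlas a)
      (PG.mem_chart_self a)
  have h2 : ContDiff ℂ ω fun Y : Sl d => ((PG.rep a) : Mat d) * (1 + Sl.incl d Y) :=
    contDiff_const.mul (contDiff_one_add d)
  exact h2.contMDiff.contMDiffAt.comp a h

instance (d : ℕ) : LieGroup 𝓘(ℂ, Sl d) ω (PG d) where
  contMDiff_mul := by
    rintro ⟨a, b⟩
    have ha : ∀ᶠ z : PG d × PG d in nhds (a, b), z.1 ∈ (PG.chart a).source :=
      continuousAt_fst.eventually ((PG.chart a).open_source.mem_nhds (PG.mem_chart_self a))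
    have hb : ∀ᶠ z : PG d × PG d in nhds (a, b), z.2 ∈ (PG.chart b).source :=
      continuousAt_snd.eventually ((PG.chart b).open_source.mem_nhds (PG.mem_chart_self b))
    have h1 : ContMDiffAt (𝓘(ℂ, Sl d).prod 𝓘(ℂ, Sl d)) 𝓘(ℂ, Mat d) ω
        (fun z : PG d × PG d => PG.localRep a z.1) (a, b) :=
      ContMDiffAt.comp (g := PG.localRep a) (f := Prod.fst) (a, b) (PG.contMDiffAt_localRep a)
        contMDiffAt_fst
    have h2 : ContMDiffAt (𝓘(ℂ, Sl d).prod 𝓘(ℂ, Sl d)) 𝓘(ℂ, Mat d) ω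
        (fun z : PG d × PG d => PG.localRep b z.2) (a, b) :=
      ContMDiffAt.comp (g := PG.localRep b) (f := Prod.snd) (a, b) (PG.contMDiffAt_localRep b)
        contMDiffAt_snd
    have hm : ContMDiff 𝓘(ℂ, Mat d × Mat d) 𝓘(ℂ, Mat d) ω fun z : Mat d × Mat d => z.1 * z.2 :=
      contDiff_mul.contMDiff
    have h3 : ContMDiffAt (𝓘(ℂ, Sl d).prod 𝓘(ℂ, Sl d)) 𝓘(ℂ, Mat d) ω
        (fun z : PG d × PG d => PG.localRep a z.1 * PG.localRep b z.2) (a, b) :=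
      hm.contMDiffAt.comp (a, b) (h1.prodMk_space h2)
    have hu : IsUnit (PG.localRep a a * PG.localRep b b) :=
      (PG.isUnit_localRep ha.self_of_nhds).mul (PG.isUnit_localRep hb.self_of_nhds)
    refine (ContMDiffAt.comp (a, b) (PG.contMDiffAt_ofMat hu) h3).congr_of_eventuallyEq ?_
    filter_upwards [ha, hb] with z hz1 hz2
    simp only [Function.comp]
    rw [PG.ofMat_mul (PG.isUnit_localRep hz1) (PG.isUnit_localRep hz2), PG.ofMat_localRep hz1,
      PG.ofMat_localRep hz2]
  contMDiff_inv := by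
    intro a
    have ha : ∀ᶠ g : PG d in nhds a, g ∈ (PG.chart a).source :=
      (PG.chart a).open_source.mem_nhds (PG.mem_chart_self a)
    have hinv : ContMDiffAt 𝓘(ℂ, Mat d) 𝓘(ℂ, Mat d) ω Ring.inverse (PG.localRep a a) := by
      obtain ⟨u, hu⟩ := PG.isUnit_localRep ha.self_of_nhds
      rw [← hu]
      exact (contDiffAt_ringInverse ℂ u).contMDiffAt
    have hunit : ∀ {M : Mat d}, IsUnit M → IsUnit (Ring.inverse M) := by
      rintro _ ⟨u, rfl⟩
      rw [Ring.inverse_unit]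
      exact u⁻¹.isUnit
    refine (ContMDiffAt.comp a (PG.contMDiffAt_ofMat (hunit (PG.isUnit_localRep ha.self_of_nhds)))
      (ContMDiffAt.comp a hinv (PG.contMDiffAt_localRep a))).congr_of_eventuallyEq ?_
    filter_upwards [ha] with g hg
    simp only [Function.comp]
    refine inv_eq_of_mul_eq_one_right ?_
    have h1 : PG.ofMat (PG.localRep a g * Ring.inverse (PG.localRep a g)) = 1 := by
      rw [Ring.mul_inverse_cancel _ (PG.isUnit_localRep hg)]
      exact PG.ofMat_one d
    rwa [PG.ofMat_mul (PG.isUnit_localRep hg) (hunit (PG.isUnit_localRep hg)),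
      PG.ofMat_localRep hg] at h1

/-! ### The maximal parabolic subgroup of `PGL(d + 1, ℂ)` fixing a point -/

/-- The point `[1 : 0 : ⋯ : 0]`. -/
def basePoint (d : ℕ) : CP d :=
  Projectivization.mk ℂ (Pi.single 0 1) (Pi.single_ne_zero_iff.2 one_ne_zero)

/-- The stabilizer of `[1 : 0 : ⋯ : 0]` for the standard action on `ℂPᵈ`. -/
def Q (d : ℕ) : Subgroup (PG d) := MulAction.stabilizer (PG d) (basePoint d)

/-- The entries of a matrix. -/
def Mat.entry {d : ℕ} (M : Mat d) (i j : Fin (d + 1)) : ℂ := (Mat.of d).symm M i j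

theorem PG.ofMat_mem_Q_iff {d : ℕ} {M : Mat d} (hM : IsUnit M) :
    PG.ofMat M ∈ Q d ↔ ∀ i, i ≠ 0 → M.entry i 0 = 0 := by
  obtain ⟨M, rfl⟩ := hM
  have hcol : ((glEquiv d).symm M • (Pi.single 0 1 : Fin (d + 1) → ℂ)) =
      fun i => (M : Mat d).entry i 0 := by
    ext i
    change (((glEquiv d).symm M : Matrix (Fin (d + 1)) (Fin (d + 1)) ℂ).mulVec (Pi.single 0 1)) i = _
    simp
    rfl
  have h0 : (fun i => (M : Mat d).entry i 0) ≠ 0 := by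
    rw [← hcol]
    exact (smul_ne_zero_iff_ne _).2 (Pi.single_ne_zero_iff.2 one_ne_zero)
  have h : PG.mk d M • basePoint d = Projectivization.mk ℂ (fun i => (M : Mat d).entry i 0) h0 := by
    change Projectivization.mk ℂ ((glEquiv d).symm M • (Pi.single 0 1 : Fin (d + 1) → ℂ)) _ = _
    simp only [hcol]
  rw [PG.ofMat_coe, Q, MulAction.mem_stabilizer_iff, h, basePoint, Projectivization.mk_eq_mk_iff']
  constructor
  · rintro ⟨a, ha⟩ i hi
    have := congrFun ha i
    simpa [hi] using this.symm
  · intro hi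
    refine ⟨(M : Mat d).entry 0 0, funext fun i => ?_⟩
    by_cases h : i = 0
    · subst h; simp
    · simp [h, hi i h]

/-- The trace-free matrices whose first column is a multiple of the first basis vector. -/
def parSubmodule (d : ℕ) : Submodule ℂ (Sl d) where
  carrier := {Y | ∀ i, i ≠ 0 → (Sl.incl d Y).entry i 0 = 0}
  add_mem' {Y Z} hY hZ i hi := by
    have h1 := hY i hi
    have h2 := hZ i hi
    simp only [Mat.entry, map_add, Matrix.add_apply] at h1 h2 ⊢
    rw [h1, h2, add_zero]
  zero_mem' i _ := by simp [Mat.entry]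
  smul_mem' c Y hY i hi := by
    have h1 := hY i hi
    simp only [Mat.entry, map_smul, Matrix.smul_apply] at h1 ⊢
    rw [h1, smul_zero]

/-- The Lie algebra of the parabolic subgroup, as a normed space. -/
def Par (d : ℕ) : Type := parSubmodule d

instance (d : ℕ) : NormedAddCommGroup (Par d) :=
  inferInstanceAs (NormedAddCommGroup (parSubmodule d))

instance (d : ℕ) : NormedSpace ℂ (Par d) := inferInstanceAs (NormedSpace ℂ (parSubmodule d))

instance (d : ℕ) : FiniteDimensional ℂ (Par d) :=
  inferInstanceAs (FiniteDimensional ℂ (parSubmodule d))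

/-- The inclusion in the trace-free matrices. -/
def Par.incl (d : ℕ) : Par d →L[ℂ] Sl d := (parSubmodule d).subtypeL

theorem Par.incl_injective (d : ℕ) : Function.Injective (Par.incl d) := Subtype.val_injective

/-- A linear retraction of the inclusion in the trace-free matrices. -/
def Par.proj (d : ℕ) : Sl d →L[ℂ] Par d :=
  LinearMap.toContinuousLinearMap (LinearMap.exists_leftInverse_of_injective
    (Par.incl d).toLinearMap (LinearMap.ker_eq_bot.2 (Par.incl_injective d))).choose

theorem Par.proj_incl {d : ℕ} (Y : Par d) : Par.proj d (Par.incl d Y) = Y :=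
  LinearMap.congr_fun (LinearMap.exists_leftInverse_of_injective
    (Par.incl d).toLinearMap (LinearMap.ker_eq_bot.2 (Par.incl_injective d))).choose_spec Y

theorem Par.incl_proj {d : ℕ} {Y : Sl d} (hY : Y ∈ parSubmodule d) :
    Par.incl d (Par.proj d Y) = Y := by
  obtain ⟨Z, rfl⟩ : ∃ Z : Par d, Par.incl d Z = Y := ⟨(⟨Y, hY⟩ : parSubmodule d), rfl⟩
  rw [Par.proj_incl]

theorem entry_one_add {d : ℕ} (M : Mat d) {i : Fin (d + 1)} (hi : i ≠ 0) :
    (1 + M).entry i 0 = M.entry i 0 := by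
  simp [Mat.entry, hi]

theorem Q.chart_symm_mem {d : ℕ} (a : Q d) (Y : Par d) :
    (PG.chart (a : PG d)).symm (Par.incl d Y) ∈ Q d := by
  rw [PG.chart_symm_apply]
  refine mul_mem a.2 ?_
  by_cases hu : IsUnit (1 + Sl.incl d (Par.incl d Y))
  · rw [PG.ofMat_mem_Q_iff hu]
    intro i hi
    rw [entry_one_add _ hi]
    exact Y.2 i hi
  · rw [PG.ofMat, dif_neg hu]
    exact one_mem _

theorem Q.chart_mem {d : ℕ} (a g : Q d) (hg : (g : PG d) ∈ (PG.chart (a : PG d)).source) :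
    PG.chart (a : PG d) (g : PG d) ∈ parSubmodule d := by
  intro i hi
  have hu := (PG.mem_chart_target _ _).1 ((PG.chart (a : PG d)).map_source hg)
  have h := (PG.chart (a : PG d)).left_inv hg
  rw [PG.chart_symm_apply] at h
  have hm : PG.ofMat (1 + Sl.incl d (PG.chart (a : PG d) (g : PG d))) ∈ Q d := by
    rw [← eq_inv_mul_iff_mul_eq] at h
    rw [h]
    exact mul_mem (inv_mem a.2) g.2
  have := (PG.ofMat_mem_Q_iff hu).1 hm i hi
  rwa [entry_one_add _ hi] at this

/-- The restriction to the parabolic subgroup of a chart of `PGL(d + 1, ℂ)`. -/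
def Q.chart {d : ℕ} (a : Q d) : OpenPartialHomeomorph (Q d) (Par d) where
  toFun g := Par.proj d (PG.chart (a : PG d) (g : PG d))
  invFun Y := ⟨(PG.chart (a : PG d)).symm (Par.incl d Y), Q.chart_symm_mem a Y⟩
  source := {g | (g : PG d) ∈ (PG.chart (a : PG d)).source}
  target := {Y | Par.incl d Y ∈ (PG.chart (a : PG d)).target}
  map_source' g hg := by
    rw [Set.mem_ofPred_eq, Par.incl_proj (Q.chart_mem a g hg)]
    exact (PG.chart (a : PG d)).map_source hg
  map_target' Y hY := (PG.chart (a : PG d)).map_target hY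
  left_inv' g hg := by
    ext1
    simp only [Par.incl_proj (Q.chart_mem a g hg)]
    exact (PG.chart (a : PG d)).left_inv hg
  right_inv' Y hY := by
    simp only [(PG.chart (a : PG d)).right_inv hY, Par.proj_incl]
  open_source := (PG.chart (a : PG d)).open_source.preimage continuous_subtype_val
  open_target := (PG.chart (a : PG d)).open_target.preimage (Par.incl d).continuous
  continuousOn_toFun := (Par.proj d).continuous.comp_continuousOn
    ((PG.chart (a : PG d)).continuousOn.comp continuous_subtype_val.continuousOn fun _ h => h)
  continuousOn_invFun := by
    rw [Topology.IsInducing.subtypeVal.continuousOn_iff]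
    exact (PG.chart (a : PG d)).continuousOn_symm.comp (Par.incl d).continuous.continuousOn
      fun _ h => h

instance (d : ℕ) : ChartedSpace (Par d) (Q d) where
  atlas := Set.range Q.chart
  chartAt := Q.chart
  mem_chart_source a := PG.mem_chart_self (a : PG d)
  chart_mem_atlas a := Set.mem_range_self a

instance (d : ℕ) : IsManifold 𝓘(ℂ, Par d) ω (Q d) := by
  refine isManifold_of_contDiffOn _ _ _ ?_
  rintro _ _ ⟨a, rfl⟩ ⟨b, rfl⟩
  have h := (Par.proj d).contDiff.comp_contDiffOn
    ((PG.contDiffOn_transition (a : PG d) (b : PG d)).comp (Par.incl d).contDiff.contDiffOn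
      (s := {Y | Par.incl d Y ∈ (PG.chart (a : PG d)).target ∧
        (PG.chart (a : PG d)).symm (Par.incl d Y) ∈ (PG.chart (b : PG d)).source}) fun Y hY => hY)
  refine h.mono fun Y hY => ?_
  simpa [Q.chart] using hY

theorem Q.contMDiffAt_of_val {d : ℕ} {E : Type*} [NormedAddCommGroup E] [NormedSpace ℂ E]
    {H : Type*} [TopologicalSpace H] {I : ModelWithCorners ℂ E H} {M : Type*} [TopologicalSpace M]
    [ChartedSpace H M] {f : M → Q d} {x : M}
    (hf : ContMDiffAt I 𝓘(ℂ, Sl d) ω (fun y => (f y : PG d)) x) :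
    ContMDiffAt I 𝓘(ℂ, Par d) ω f x := by
  rw [contMDiffAt_iff_target] at hf ⊢
  refine ⟨Topology.IsInducing.subtypeVal.continuousAt_iff.2 hf.1, ?_⟩
  exact (Par.proj d).contDiff.contMDiff.contMDiffAt.comp x hf.2

theorem Q.contMDiff_val (d : ℕ) :
    ContMDiff 𝓘(ℂ, Par d) 𝓘(ℂ, Sl d) ω (Subtype.val : Q d → PG d) := by
  intro a
  have h1 : ContMDiffAt 𝓘(ℂ, Par d) 𝓘(ℂ, Par d) ω (Q.chart a) a :=
    contMDiffAt_of_mem_maximalAtlas (IsManifold.chart_mem_maximalAtlas a)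
      (PG.mem_chart_self (a : PG d))
  have h2 : ContMDiffAt 𝓘(ℂ, Par d) 𝓘(ℂ, Sl d) ω (fun g : Q d => Par.incl d (Q.chart a g)) a :=
    (Par.incl d).contDiff.contMDiff.contMDiffAt.comp a h1
  have hs : ∀ g : Q d, (g : PG d) ∈ (PG.chart (a : PG d)).source →
      Par.incl d (Q.chart a g) = PG.chart (a : PG d) (g : PG d) := fun g hg =>
    Par.incl_proj (Q.chart_mem a g hg)
  have h3 : ContMDiffAt 𝓘(ℂ, Sl d) 𝓘(ℂ, Sl d) ω (PG.chart (a : PG d)).symm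
      (Par.incl d (Q.chart a a)) := by
    refine contMDiffAt_symm_of_mem_maximalAtlas (IsManifold.chart_mem_maximalAtlas (a : PG d)) ?_
    rw [hs a (PG.mem_chart_self _)]
    exact (PG.chart (a : PG d)).map_source (PG.mem_chart_self _)
  refine (ContMDiffAt.comp (g := (PG.chart (a : PG d)).symm)
    (f := fun g : Q d => Par.incl d (Q.chart a g)) a h3 h2).congr_of_eventuallyEq ?_
  filter_upwards [(Q.chart a).open_source.mem_nhds (PG.mem_chart_self (a : PG d))] with g hg
  simp only [Function.comp]
  rw [hs g hg]
  exact ((PG.chart (a : PG d)).left_inv hg).symm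

instance (d : ℕ) : LieGroup 𝓘(ℂ, Par d) ω (Q d) where
  contMDiff_mul x := by
    refine Q.contMDiffAt_of_val ?_
    exact ((Q.contMDiff_val d).contMDiffAt.comp x contMDiffAt_fst).mul
      ((Q.contMDiff_val d).contMDiffAt.comp x contMDiffAt_snd)
  contMDiff_inv x := by
    refine Q.contMDiffAt_of_val ?_
    exact ((Q.contMDiff_val d) x).inv

/-! ### Branched holomorphic Cartan geometries -/

/-- The inclusion of a subgroup `H` in a complex Lie group `G`, where `H` carries a complex Lie
group structure of its own, makes `H` a complex Lie subgroup: it is a holomorphic immersion. (By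
homogeneity it is enough to ask for an immersion at the identity.) -/
class IsComplexLieSubgroup {𝔤 𝔥 G : Type*} [NormedAddCommGroup 𝔤] [NormedSpace ℂ 𝔤]
    [NormedAddCommGroup 𝔥] [NormedSpace ℂ 𝔥] [Group G] [TopologicalSpace G] [ChartedSpace 𝔤 G]
    (H : Subgroup G) [ChartedSpace 𝔥 H] : Prop where
  contMDiff_val : ContMDiff 𝓘(ℂ, 𝔥) 𝓘(ℂ, 𝔤) ω (Subtype.val : H → G)
  injective_mfderiv_val :
    Function.Injective (mfderiv 𝓘(ℂ, 𝔥) 𝓘(ℂ, 𝔤) (Subtype.val : H → G) 1)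

instance (d : ℕ) : IsComplexLieSubgroup (𝔤 := Sl d) (𝔥 := Par d) (Q d) where
  contMDiff_val := Q.contMDiff_val d
  injective_mfderiv_val := by
    have h1 : ContMDiffAt 𝓘(ℂ, Sl d) 𝓘(ℂ, Sl d) ω (PG.chart (1 : PG d)) ((1 : Q d) : PG d) :=
      contMDiffAt_of_mem_maximalAtlas (IsManifold.chart_mem_maximalAtlas (1 : PG d))
        (PG.mem_chart_self (1 : PG d))
    have h2 : ContMDiffAt 𝓘(ℂ, Sl d) 𝓘(ℂ, Par d) ω
        (fun g : PG d => Par.proj d (PG.chart (1 : PG d) g)) ((1 : Q d) : PG d) :=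
      (Par.proj d).contDiff.contMDiff.contMDiffAt.comp _ h1
    have hw : (ω : WithTop ℕ∞) ≠ 0 := by simp
    have h3 : Function.Injective (mfderiv 𝓘(ℂ, Par d) 𝓘(ℂ, Par d)
        ((fun g : PG d => Par.proj d (PG.chart (1 : PG d) g)) ∘ (Subtype.val : Q d → PG d)) 1) :=
      (isInvertible_mfderiv_extChartAt (I := 𝓘(ℂ, Par d)) (mem_extChartAt_source (1 : Q d))).injective
    rw [mfderiv_comp (1 : Q d) (h2.mdifferentiableAt hw)
      ((Q.contMDiff_val d).contMDiffAt.mdifferentiableAt hw)] at h3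
    exact Function.Injective.of_comp h3

section Bundle

universe u

variable {𝔤 𝔥 G : Type*} [NormedAddCommGroup 𝔤] [NormedSpace ℂ 𝔤] [NormedAddCommGroup 𝔥]
  [NormedSpace ℂ 𝔥] [Group G] [TopologicalSpace G] [ChartedSpace 𝔤 G] [LieGroup 𝓘(ℂ, 𝔤) ω G]
  (H : Subgroup G) [ChartedSpace 𝔥 H] [LieGroup 𝓘(ℂ, 𝔥) ω H]
  {V : Type*} [NormedAddCommGroup V] [NormedSpace ℂ V]
  (X : Type u) [TopologicalSpace X] [ChartedSpace V X]

/-- A holomorphic principal `H`-bundle on a complex manifold `X`: a complex manifold with a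
holomorphic right action of `H` and a holomorphic projection to `X` which, locally on `X`, is
equivariantly biholomorphic to the product of the base with `H`. -/
structure HolomorphicPrincipalBundle where
  /-- The total space. -/
  Total : Type u
  [topologicalSpace : TopologicalSpace Total]
  [chartedSpace : ChartedSpace (ModelProd V 𝔥) Total]
  [isManifold : IsManifold (𝓘(ℂ, V).prod 𝓘(ℂ, 𝔥)) ω Total]
  /-- The projection to the base. -/
  proj : Total → X
  /-- The right action of the structure group. -/
  act : Total → H → Total
  act_one : ∀ p, act p 1 = p
  act_mul : ∀ p h k, act p (h * k) = act (act p h) k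
  proj_act : ∀ p h, proj (act p h) = proj p
  contMDiff_proj : ContMDiff (𝓘(ℂ, V).prod 𝓘(ℂ, 𝔥)) 𝓘(ℂ, V) ω proj
  contMDiff_act : ContMDiff ((𝓘(ℂ, V).prod 𝓘(ℂ, 𝔥)).prod 𝓘(ℂ, 𝔥)) (𝓘(ℂ, V).prod 𝓘(ℂ, 𝔥)) ω
    fun z : Total × H => act z.1 z.2
  locally_trivial : ∀ x : X, ∃ e : Bundle.Trivialization H proj, x ∈ e.baseSet ∧
    ContMDiffOn (𝓘(ℂ, V).prod 𝓘(ℂ, 𝔥)) (𝓘(ℂ, V).prod 𝓘(ℂ, 𝔥)) ω e e.source ∧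
    ContMDiffOn (𝓘(ℂ, V).prod 𝓘(ℂ, 𝔥)) (𝓘(ℂ, V).prod 𝓘(ℂ, 𝔥)) ω e.toOpenPartialHomeomorph.symm
      e.target ∧
    ∀ p ∈ e.source, ∀ h : H, (e (act p h)).2 = (e p).2 * h

attribute [instance] HolomorphicPrincipalBundle.topologicalSpace
  HolomorphicPrincipalBundle.chartedSpace HolomorphicPrincipalBundle.isManifold

variable (𝔤) in
/-- The adjoint action of a Lie group on its Lie algebra. -/
def adjointAction (g : G) : GroupLieAlgebra 𝓘(ℂ, 𝔤) G →L[ℂ] GroupLieAlgebra 𝓘(ℂ, 𝔤) G :=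
  (mfderiv 𝓘(ℂ, 𝔤) 𝓘(ℂ, 𝔤) (fun x : G => g * x * g⁻¹) 1 : 𝔤 →L[ℂ] 𝔤)

variable (𝔤) in
/-- The left-invariant Maurer-Cartan form `g⁻¹ dg` of a Lie group. -/
def maurerCartan (g : G) : TangentSpace 𝓘(ℂ, 𝔤) g →L[ℂ] GroupLieAlgebra 𝓘(ℂ, 𝔤) G :=
  (mfderiv 𝓘(ℂ, 𝔤) 𝓘(ℂ, 𝔤) (fun x : G => g⁻¹ * x) g : 𝔤 →L[ℂ] 𝔤)

/-- A branched holomorphic Cartan geometry of type `G/H` on `X`: a holomorphic principal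
`H`-bundle `E_H` with a `𝔤`-valued holomorphic `1`-form `β` on its total space. Being equivariant,
`β` is the same as a holomorphic homomorphism from the Atiyah bundle `(TE_H)/H` to
`ad(E_G) = E_H ×^H 𝔤`; the condition on the fibres says that it restricts to the inclusion
`ad(E_H) → ad(E_G)`. -/
structure BranchedCartanGeometry [IsComplexLieSubgroup (𝔤 := 𝔤) (𝔥 := 𝔥) H] extends
    HolomorphicPrincipalBundle (𝔥 := 𝔥) H (V := V) X where
  /-- The `1`-form `β`. -/
  form : ∀ p : Total, TangentSpace (𝓘(ℂ, V).prod 𝓘(ℂ, 𝔥)) p →L[ℂ] GroupLieAlgebra 𝓘(ℂ, 𝔤) G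
  /-- `β` is holomorphic, as a function on the tangent bundle. -/
  contMDiff_form : ContMDiff (𝓘(ℂ, V).prod 𝓘(ℂ, 𝔥)).tangent 𝓘(ℂ, 𝔤) (M' := 𝔤) ω
    fun v : TangentBundle (𝓘(ℂ, V).prod 𝓘(ℂ, 𝔥)) Total => (form v.proj v.2 : 𝔤)
  /-- `β` is an isomorphism over a nonempty open subset of `X`. -/
  bijective_form : ∃ U : Set X, IsOpen U ∧ U.Nonempty ∧
    ∀ p, proj p ∈ U → Function.Bijective (form p)
  /-- `β` is equivariant, where `H` acts on `𝔤` through the adjoint action. -/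
  form_act : ∀ (p : Total) (h : H) (v : TangentSpace (𝓘(ℂ, V).prod 𝓘(ℂ, 𝔥)) p),
    form (act p h) (mfderiv (𝓘(ℂ, V).prod 𝓘(ℂ, 𝔥)) (𝓘(ℂ, V).prod 𝓘(ℂ, 𝔥))
      (fun q => act q h) p v) = adjointAction 𝔤 (h⁻¹ : G) (form p v)
  /-- On the fibres, `β` is the Maurer-Cartan form: it sends the value at `p` of the fundamental
  vector field of `a ∈ 𝔥` to `a`. -/
  form_fiber : ∀ (p : Total) (a : GroupLieAlgebra 𝓘(ℂ, 𝔥) H),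
    form (act p 1) (mfderiv 𝓘(ℂ, 𝔥) (𝓘(ℂ, V).prod 𝓘(ℂ, 𝔥)) (fun h : H => act p h) 1 a) =
      (mfderiv 𝓘(ℂ, 𝔥) 𝓘(ℂ, 𝔤) (Subtype.val : H → G) 1 a : 𝔤)

namespace BranchedCartanGeometry

variable {H X} [IsComplexLieSubgroup (𝔤 := 𝔤) (𝔥 := 𝔥) H]
  (P : BranchedCartanGeometry (𝔤 := 𝔤) (𝔥 := 𝔥) H (V := V) X)

/-- The form `β` in the preferred chart around `p`, as a `𝔤`-valued `1`-form on an open subset of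
the model vector space. -/
def formInChart (p : P.Total) (y : V × 𝔥) : V × 𝔥 →L[ℂ] 𝔤 :=
  (P.form ((extChartAt (𝓘(ℂ, V).prod 𝓘(ℂ, 𝔥)) p).symm y) : V × 𝔥 →L[ℂ] 𝔤).comp
    (mfderiv 𝓘(ℂ, V × 𝔥) (𝓘(ℂ, V).prod 𝓘(ℂ, 𝔥))
      (extChartAt (𝓘(ℂ, V).prod 𝓘(ℂ, 𝔥)) p).symm y : V × 𝔥 →L[ℂ] V × 𝔥)

/-- The exterior derivative `dβ` at a point `p` of the total space, computed in the preferred chart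
around `p`, through which the tangent space at `p` is identified with the model vector space. -/
def dForm (p : P.Total) (u v : TangentSpace (𝓘(ℂ, V).prod 𝓘(ℂ, 𝔥)) p) :
    GroupLieAlgebra 𝓘(ℂ, 𝔤) G :=
  (fderiv ℂ (P.formInChart p) (extChartAt (𝓘(ℂ, V).prod 𝓘(ℂ, 𝔥)) p p) u v -
    fderiv ℂ (P.formInChart p) (extChartAt (𝓘(ℂ, V).prod 𝓘(ℂ, 𝔥)) p p) v u : 𝔤)

/-- The curvature `dβ + ½[β, β]`, that is `(u, v) ↦ dβ(u, v) + [β(u), β(v)]`. It is the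
restriction to `E_H` of the curvature of the connection on `E_G = E_H ×^H G` which extends `β`;
since that curvature is equivariant and horizontal, one vanishes if and only if the other does. -/
def curvature (p : P.Total) (u v : TangentSpace (𝓘(ℂ, V).prod 𝓘(ℂ, 𝔥)) p) :
    GroupLieAlgebra 𝓘(ℂ, 𝔤) G :=
  P.dForm p u v + ⁅P.form p u, P.form p v⁆

/-- A branched Cartan geometry is flat if its curvature vanishes. -/
def IsFlat : Prop := ∀ p u v, P.curvature p u v = 0

end BranchedCartanGeometry

end Bundle

/-! ### Branched projective structures -/

/-- A branched holomorphic projective structure on a complex manifold of dimension `d`: a branched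
holomorphic Cartan geometry of type `PGL(d + 1, ℂ)/Q`. -/
abbrev BranchedProjectiveStructure (d : ℕ) (X : Type*) [TopologicalSpace X]
    [ChartedSpace (EuclideanSpace ℂ (Fin d)) X] :=
  BranchedCartanGeometry (𝔤 := Sl d) (𝔥 := Par d) (Q d) (V := EuclideanSpace ℂ (Fin d)) X

/-- The branched projective structure `P` is the pullback, along `γ : X → ℂPᵈ`, of the standard
projective structure on `ℂPᵈ`, whose principal `Q`-bundle is `PGL(d + 1, ℂ) → ℂPᵈ`,
`g ↦ g • [1 : 0 : ⋯ : 0]`, and whose form is the Maurer-Cartan form: there is a holomorphic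
`Q`-equivariant map of total spaces over `γ` which pulls the Maurer-Cartan form back to the form of
`P`. Such a map identifies the principal bundle of `P` with the pullback bundle. -/
def BranchedProjectiveStructure.IsPullbackOfStandard {d : ℕ} {X : Type*} [TopologicalSpace X]
    [ChartedSpace (EuclideanSpace ℂ (Fin d)) X] (P : BranchedProjectiveStructure d X)
    (γ : X → CP d) : Prop :=
  ∃ η : P.Total → PG d,
    ContMDiff (𝓘(ℂ, EuclideanSpace ℂ (Fin d)).prod 𝓘(ℂ, Par d)) 𝓘(ℂ, Sl d) ω η ∧
    (∀ p (h : Q d), η (P.act p h) = η p * h) ∧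
    (∀ p, η p • basePoint d = γ (P.proj p)) ∧
    ∀ p v, P.form p v = maurerCartan (Sl d) (η p)
      (mfderiv (𝓘(ℂ, EuclideanSpace ℂ (Fin d)).prod 𝓘(ℂ, Par d)) 𝓘(ℂ, Sl d) η p v)

/-- A map is finite if it is proper with finite fibres. -/
def IsFiniteMap {X Y : Type*} [TopologicalSpace X] [TopologicalSpace Y] (γ : X → Y) : Prop :=
  IsProperMap γ ∧ ∀ y, (γ ⁻¹' {y}).Finite

/-- `γ : X → ℂPᵈ` is the composition of `f : X → ℂPᴺ` with a linear projection, given in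
homogeneous coordinates by a linear map `L` which vanishes at no point of `f(X)`. -/
def IsLinearProjectionOf {X : Type*} {N d : ℕ} (γ : X → CP d) (f : X → CP N) : Prop :=
  ∃ L : (Fin (N + 1) → ℂ) →ₗ[ℂ] (Fin (d + 1) → ℂ),
    ∀ x, ∃ h : L (f x).rep ≠ 0, γ x = Projectivization.mk ℂ (L (f x).rep) h

end CartanGeometry

end

open CartanGeometry

/-! A compact complex manifold `X` of dimension `d` which is embedded in `ℂPᴺ` has a finite
surjective linear projection `γ` to `ℂPᵈ`, which is a local biholomorphism at some point. The
pullback along `γ` of the bundle `PGL(d + 1, ℂ) → ℂPᵈ` with its Maurer-Cartan form is then a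
branched flat projective structure.

*The projection.* The existence of `γ` is Noether normalization, but without any use of Chow's
theorem: as long as the image `g(X) ⊆ ℂPᴹ` of a projection has `M > d`, it lies on a hypersurface by
Siegel's argument (`exists_homogeneous_vanishing`), and the projection from a point off this
hypersurface meets each line through that point in finitely many points
(`exists_linearProjection_finite_fibres`). Siegel's argument chooses, by counting dimensions, a
nonzero homogeneous polynomial `P` for which `P ∘ g` vanishes to high order at the centres of finitely
many coordinate balls; the Schwarz lemma, applied on the balls of half the radius, which still cover
`X`, shows that `P ∘ g` is smaller than itself unless it vanishes (`exists_homogeneous_of_cover`).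

*Surjectivity and generic immersivity.* Both follow from one maximum principle
(`exists_injective_mfderiv_linearProjection`): if a linear map `L` vanishes nowhere on the cone over
`X`, then at a maximum of `‖f‖² / ‖L f‖²` the normalized map `L f` is an immersion. With
`d + 1` target coordinates this gives a point at which `γ` is a local biholomorphism. If `γ` missed a
point, projection from it would produce an `L` with `d` target coordinates, and the image of the
differential of the normalized `L f` would be `d`-dimensional and orthogonal to a nonzero vector of
`ℂᵈ`, which is absurd.

*The structure.* The charts of `PGL(d + 1, ℂ)` being left translates of one another, left
translations and the Maurer-Cartan form become the identity in the preferred charts, and the pullback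
of the latter by a map with a local matrix representative `A` is the trace-free part of `A⁻¹ dA`
(`modelDeriv_apply_of_eventuallyEq_ofMat`); flatness is then the computation
`d(A⁻¹ dA) = -A⁻¹ dA ∧ A⁻¹ dA` (`fderiv_inverse_mul_fderiv`) with the identification of the bracket of
the Lie group as the commutator (`groupLieAlgebra_bracket`). The pullback bundle is trivialized by the
translates of the unipotent section of the orbit map `g ↦ g • [1 : 0 : ⋯ : 0]`. The form is an
isomorphism over the open set where `γ` is a local biholomorphism
(`PullbackTotal.bijective_form_of_injective`). -/

noncomputable section

open Set Filter Topology

namespace CartanGeometry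

/-! ### Holomorphic maps to projective space -/

/-- A holomorphic immersion has a local holomorphic left inverse, hence an injective differential. -/
theorem injective_mfderiv_of_isImmersion {E E' M M' : Type*} [NormedAddCommGroup E]
    [NormedSpace ℂ E] [NormedAddCommGroup E'] [NormedSpace ℂ E'] [TopologicalSpace M]
    [ChartedSpace E M] [TopologicalSpace M'] [ChartedSpace E' M'] [IsManifold 𝓘(ℂ, E) ω M]
    [IsManifold 𝓘(ℂ, E') ω M'] {f : M → M'}
    (hf : Manifold.IsImmersion 𝓘(ℂ, E) 𝓘(ℂ, E') ω f) (x : M) :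
    Function.Injective (mfderiv 𝓘(ℂ, E) 𝓘(ℂ, E') f x) := by
  have h := hf.isImmersionAt x
  have hw : (ω : WithTop ℕ∞) ≠ 0 := by simp
  set e := h.domChart
  set e' := h.codChart
  let r : M' → M := fun z => e.symm (h.equiv.symm (e' z)).1
  have hrf : ∀ y ∈ e.source, r (f y) = y := fun y hy => by
    have h1 : (h.codChart.extend 𝓘(ℂ, E') ∘ f ∘ (h.domChart.extend 𝓘(ℂ, E)).symm)
        (h.domChart.extend 𝓘(ℂ, E) y) = (h.equiv ∘ (·, 0)) (h.domChart.extend 𝓘(ℂ, E) y) :=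
      h.writtenInCharts (by simpa using e.map_source hy)
    have h2 : e' (f y) = h.equiv (e y, 0) := by
      simpa [e.left_inv hy, e, e', h.domChart.left_inv hy] using h1
    simp only [r, h2, ContinuousLinearEquiv.symm_apply_apply]
    exact e.left_inv hy
  have he' : ContMDiffAt 𝓘(ℂ, E') 𝓘(ℂ, E') ω e' (f x) :=
    contMDiffAt_of_mem_maximalAtlas h.codChart_mem_maximalAtlas h.mem_codChart_source
  have hl : ContMDiffAt 𝓘(ℂ, E') 𝓘(ℂ, E) ω (fun z => (h.equiv.symm (e' z)).1) (f x) :=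
    ((ContinuousLinearMap.fst ℂ E h.complement).comp
      (h.equiv.symm : E' →L[ℂ] E × h.complement)).contMDiff.contMDiffAt.comp _ he'
  have hv : (h.equiv.symm (e' (f x))).1 ∈ e.target := by
    have h1 : (h.codChart.extend 𝓘(ℂ, E') ∘ f ∘ (h.domChart.extend 𝓘(ℂ, E)).symm)
        (h.domChart.extend 𝓘(ℂ, E) x) = (h.equiv ∘ (·, 0)) (h.domChart.extend 𝓘(ℂ, E) x) :=
      h.writtenInCharts (by simpa using e.map_source h.mem_domChart_source)
    have h2 : e' (f x) = h.equiv (e x, 0) := by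
      simpa [e, e', h.domChart.left_inv h.mem_domChart_source] using h1
    rw [h2, ContinuousLinearEquiv.symm_apply_apply]
    exact e.map_source h.mem_domChart_source
  have hr : ContMDiffAt 𝓘(ℂ, E') 𝓘(ℂ, E) ω r (f x) :=
    (contMDiffAt_symm_of_mem_maximalAtlas (n := ω) h.domChart_mem_maximalAtlas hv).comp (f x) hl
  have hid : r ∘ f =ᶠ[𝓝 x] id := by
    filter_upwards [e.open_source.mem_nhds h.mem_domChart_source] with y hy using hrf y hy
  have hc := mfderiv_comp x (hr.mdifferentiableAt hw) (h.contMDiffAt.mdifferentiableAt hw)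
  rw [hid.mfderiv_eq, mfderiv_id] at hc
  intro u v huv
  have hu := congrArg (fun T => T u) hc
  have hv := congrArg (fun T => T v) hc
  simp only [ContinuousLinearMap.comp_apply, huv] at hu hv
  exact hu.trans hv.symm

namespace CP

theorem exists_rep_eq_smul {n : ℕ} (v : Fin (n + 1) → ℂ) (hv : v ≠ 0) :
    ∃ a : ℂ, a ≠ 0 ∧ (Projectivization.mk ℂ v hv).rep = a • v := by
  obtain ⟨a, ha⟩ := exists_smul_rep v hv
  exact ⟨a, a.ne_zero, ha⟩

theorem mk_eq_mk_of_smul {n : ℕ} {v w : Fin (n + 1) → ℂ} (hv : v ≠ 0) (hw : w ≠ 0) (a : ℂ)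
    (h : w = a • v) : Projectivization.mk ℂ v hv = Projectivization.mk ℂ w hw := by
  rw [eq_comm, Projectivization.mk_eq_mk_iff']
  exact ⟨a, h.symm⟩

instance (n : ℕ) : T2Space (CP n) := by
  have hq : IsOpenQuotientMap
      (Projectivization.mk' ℂ : {v : Fin (n + 1) → ℂ // v ≠ 0} → CP n) := by
    refine ⟨(isQuotientMap_mk' n).surjective, (isQuotientMap_mk' n).continuous, fun U hU => ?_⟩
    rw [← (isQuotientMap_mk' n).isOpen_preimage]
    -- The saturation of `U` is the union of its multiples.
    have : (Projectivization.mk' ℂ : {v : Fin (n + 1) → ℂ // v ≠ 0} → CP n) ⁻¹'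
        (Projectivization.mk' ℂ '' U) = ⋃ a : ℂˣ,
          (fun v : {v : Fin (n + 1) → ℂ // v ≠ 0} =>
            (⟨a • v.1, (smul_ne_zero_iff_ne a).2 v.2⟩ : {v : Fin (n + 1) → ℂ // v ≠ 0})) ⁻¹' U := by
      ext v
      simp only [mem_preimage, mem_image, mem_iUnion]
      constructor
      · rintro ⟨u, hu, huv⟩
        obtain ⟨a, ha⟩ := (Projectivization.mk_eq_mk_iff ℂ _ _ u.2 v.2).1 huv
        refine ⟨a, ?_⟩
        convert hu
      · rintro ⟨a, ha⟩
        refine ⟨_, ha, (Projectivization.mk_eq_mk_iff ℂ _ _ _ v.2).2 ⟨a, rfl⟩⟩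
    rw [this]
    refine isOpen_iUnion fun a => hU.preimage ?_
    exact Continuous.subtype_mk (continuous_const.smul continuous_subtype_val) _
  rw [t2Space_iff_of_isOpenQuotientMap hq]
  have : {q : {v : Fin (n + 1) → ℂ // v ≠ 0} × {v : Fin (n + 1) → ℂ // v ≠ 0} |
      Projectivization.mk' ℂ q.1 = Projectivization.mk' ℂ q.2} =
      ⋂ i, ⋂ j, {q | q.1.1 i * q.2.1 j = q.1.1 j * q.2.1 i} := by
    ext ⟨⟨v, hv⟩, ⟨w, hw⟩⟩
    simp only [mem_ofPred_eq, mem_iInter, Projectivization.mk'_eq_mk]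
    rw [Projectivization.mk_eq_mk_iff']
    constructor
    · rintro ⟨a, rfl⟩ i j
      simp only [Pi.smul_apply, smul_eq_mul]
      ring
    · intro h
      obtain ⟨i, hi⟩ := Function.ne_iff.1 hw
      have hi' : w i ≠ 0 := hi
      refine ⟨v i / w i, funext fun j => ?_⟩
      have := h i j
      simp only [Pi.smul_apply, smul_eq_mul]
      field_simp
      linear_combination this
  rw [this]
  refine isClosed_iInter fun i => isClosed_iInter fun j => isClosed_eq ?_ ?_
  · exact ((continuous_apply i).comp (continuous_subtype_val.comp continuous_fst)).mul
      ((continuous_apply j).comp (continuous_subtype_val.comp continuous_snd))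
  · exact ((continuous_apply j).comp (continuous_subtype_val.comp continuous_fst)).mul
      ((continuous_apply i).comp (continuous_subtype_val.comp continuous_snd))

theorem contMDiffAt_affineChart {n : ℕ} {i : Fin (n + 1)} {p : CP n} (hp : p.rep i ≠ 0) :
    ContMDiffAt 𝓘(ℂ, EuclideanSpace ℂ (Fin n)) 𝓘(ℂ, EuclideanSpace ℂ (Fin n)) ω
      (affineChart i) p :=
  contMDiffAt_of_mem_maximalAtlas
    (IsManifold.subset_maximalAtlas (mem_range_self i : affineChart i ∈ atlas _ (CP n))) hp

theorem contMDiff_affineChart_symm {n : ℕ} (i : Fin (n + 1)) :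
    ContMDiff 𝓘(ℂ, EuclideanSpace ℂ (Fin n)) 𝓘(ℂ, EuclideanSpace ℂ (Fin n)) ω
      (affineChart i).symm := fun w =>
  contMDiffAt_symm_of_mem_maximalAtlas
    (IsManifold.subset_maximalAtlas (mem_range_self i : affineChart i ∈ atlas _ (CP n)))
    (mem_univ w)

/-- The homogeneous coordinates of a point at which the linear form `ℓ` takes the value `1`. (The
zero vector if `ℓ` vanishes at the point.) -/
def lift {n : ℕ} (ℓ : (Fin (n + 1) → ℂ) →ₗ[ℂ] ℂ) (p : CP n) : Fin (n + 1) → ℂ :=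
  (ℓ p.rep)⁻¹ • p.rep

theorem lift_mk {n : ℕ} (ℓ : (Fin (n + 1) → ℂ) →ₗ[ℂ] ℂ) (v : Fin (n + 1) → ℂ) (hv : v ≠ 0) :
    lift ℓ (Projectivization.mk ℂ v hv) = (ℓ v)⁻¹ • v := by
  obtain ⟨a, ha, h⟩ := exists_rep_eq_smul v hv
  rw [lift, h, map_smul, smul_smul, smul_eq_mul, mul_inv, mul_right_comm, inv_mul_cancel₀ ha,
    one_mul]

theorem apply_lift {n : ℕ} {ℓ : (Fin (n + 1) → ℂ) →ₗ[ℂ] ℂ} {p : CP n} (hp : ℓ p.rep ≠ 0) :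
    ℓ (lift ℓ p) = 1 := by
  rw [lift, map_smul, smul_eq_mul, inv_mul_cancel₀ hp]

theorem lift_ne_zero {n : ℕ} {ℓ : (Fin (n + 1) → ℂ) →ₗ[ℂ] ℂ} {p : CP n} (hp : ℓ p.rep ≠ 0) :
    lift ℓ p ≠ 0 := fun h => by
  have := apply_lift hp
  simp [h] at this

theorem mk_lift {n : ℕ} {ℓ : (Fin (n + 1) → ℂ) →ₗ[ℂ] ℂ} {p : CP n} (hp : ℓ p.rep ≠ 0) :
    Projectivization.mk ℂ (lift ℓ p) (lift_ne_zero hp) = p := by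
  conv_rhs => rw [← p.mk_rep]
  rw [Projectivization.mk_eq_mk_iff']
  exact ⟨_, rfl⟩

theorem isOpen_setOf_apply_rep_ne_zero {n : ℕ} (ℓ : (Fin (n + 1) → ℂ) →ₗ[ℂ] ℂ) :
    IsOpen {p : CP n | ℓ p.rep ≠ 0} := by
  rw [← (isQuotientMap_mk' n).isOpen_preimage]
  have : (Projectivization.mk' ℂ : {v : Fin (n + 1) → ℂ // v ≠ 0} → CP n) ⁻¹'
      {p : CP n | ℓ p.rep ≠ 0} = {v | ℓ v.1 ≠ 0} := by
    ext v
    obtain ⟨a, ha, h⟩ := exists_rep_eq_smul v.1 v.2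
    simp [h, ha]
  rw [this]
  exact isOpen_ne_fun (ℓ.continuous_of_finiteDimensional.comp continuous_subtype_val)
    continuous_const

theorem contMDiffAt_lift {n : ℕ} {ℓ : (Fin (n + 1) → ℂ) →ₗ[ℂ] ℂ} {p : CP n} (hp : ℓ p.rep ≠ 0) :
    ContMDiffAt 𝓘(ℂ, EuclideanSpace ℂ (Fin n)) 𝓘(ℂ, Fin (n + 1) → ℂ) ω (lift ℓ) p := by
  obtain ⟨i, hi⟩ := exists_rep_ne_zero p
  have hh : ContDiff ℂ ω (homCoord i : EuclideanSpace ℂ (Fin n) → Fin (n + 1) → ℂ) :=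
    contDiff_pi.2 fun k => contDiff_homCoord i k
  have hlh : ∀ q : CP n, q.rep i ≠ 0 →
      homCoord i (affineChart i q) = (q.rep i)⁻¹ • q.rep := fun q hq =>
    homCoord_affineCoord i q.rep hq
  have h0 : (LinearMap.toContinuousLinearMap ℓ) (homCoord i (affineChart i p)) ≠ 0 := by
    rw [hlh p hi]
    simp [hi, hp]
  have h1 : ContDiffAt ℂ ω (fun w : EuclideanSpace ℂ (Fin n) =>
      ((LinearMap.toContinuousLinearMap ℓ) (homCoord i w))⁻¹ • homCoord i w)
      (affineChart i p) :=
    (((LinearMap.toContinuousLinearMap ℓ).contDiff.comp hh).contDiffAt.inv h0).smul hh.contDiffAt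
  refine (h1.contMDiffAt.comp p (contMDiffAt_affineChart hi)).congr_of_eventuallyEq ?_
  filter_upwards [(isOpen_chart_source i).mem_nhds hi] with q hq
  change lift ℓ q = (ℓ (homCoord i (affineChart i q)))⁻¹ • homCoord i (affineChart i q)
  rw [hlh q hq, map_smul, smul_smul, smul_eq_mul, mul_inv, inv_inv, mul_right_comm,
    mul_inv_cancel₀ hq, one_mul, lift]

section

variable {E H M : Type*} [NormedAddCommGroup E] [NormedSpace ℂ E] [TopologicalSpace H]
  {I : ModelWithCorners ℂ E H} [TopologicalSpace M] [ChartedSpace H M] {n : ℕ}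

/-- A map given by holomorphic homogeneous coordinates is holomorphic. -/
theorem contMDiffAt_mk {F : M → Fin (n + 1) → ℂ} {x : M}
    (hF : ContMDiffAt I 𝓘(ℂ, Fin (n + 1) → ℂ) ω F x) {g : M → CP n}
    (hx : F x ≠ 0) (hg : ∀ᶠ y in 𝓝 x, ∃ h : F y ≠ 0, g y = Projectivization.mk ℂ (F y) h) :
    ContMDiffAt I 𝓘(ℂ, EuclideanSpace ℂ (Fin n)) ω g x := by
  obtain ⟨i, hi⟩ : ∃ i, F x i ≠ 0 := Function.ne_iff.1 hx
  have h1 : ContDiffAt ℂ ω (fun v : Fin (n + 1) → ℂ => affineCoord i v) (F x) := by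
    rw [contDiffAt_euclidean]
    intro j
    exact (contDiff_apply ℂ ℂ _).contDiffAt.div (contDiff_apply ℂ ℂ _).contDiffAt hi
  have h2 := (contMDiff_affineChart_symm i).contMDiffAt.comp x
    (h1.contMDiffAt.comp x hF)
  refine h2.congr_of_eventuallyEq ?_
  have hi' : ∀ᶠ y in 𝓝 x, F y i ≠ 0 :=
    ((continuous_apply i).continuousAt.comp hF.continuousAt).eventually_ne hi
  filter_upwards [hg, hi'] with y hy hyi
  obtain ⟨h, hy⟩ := hy
  rw [hy]
  change _ = Projectivization.mk ℂ (homCoord i (affineCoord i (F y))) _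
  refine mk_eq_mk_of_smul _ _ _ (homCoord_affineCoord i (F y) hyi)

/-- A linear projection, from a centre that it does not meet, of a holomorphic map to a projective
space is holomorphic. -/
theorem contMDiff_linearProjection {m : ℕ} {f : M → CP n}
    (hf : ContMDiff I 𝓘(ℂ, EuclideanSpace ℂ (Fin n)) ω f)
    (L : (Fin (n + 1) → ℂ) →ₗ[ℂ] (Fin (m + 1) → ℂ)) (hL : ∀ x, L (f x).rep ≠ 0) :
    ContMDiff I 𝓘(ℂ, EuclideanSpace ℂ (Fin m)) ω
      fun x => Projectivization.mk ℂ (L (f x).rep) (hL x) := by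
  intro x
  obtain ⟨i, hi⟩ := exists_rep_ne_zero (f x)
  let ℓ : (Fin (n + 1) → ℂ) →ₗ[ℂ] ℂ := LinearMap.proj i
  have h1 : ContMDiffAt I 𝓘(ℂ, Fin (m + 1) → ℂ) ω (fun y => L (lift ℓ (f y))) x :=
    (LinearMap.toContinuousLinearMap L).contMDiff.contMDiffAt.comp x
      ((contMDiffAt_lift (ℓ := ℓ) hi).comp x (hf x))
  have hn : ∀ y, (f y).rep i ≠ 0 → L (lift ℓ (f y)) ≠ 0 := fun y hy => by
    rw [lift, map_smul]
    exact smul_ne_zero (inv_ne_zero hy) (hL y)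
  refine contMDiffAt_mk h1 (hn x hi) ?_
  filter_upwards [hf.continuous.continuousAt.preimage_mem_nhds
    ((isOpen_chart_source i).mem_nhds hi)] with y hy
  refine ⟨hn y hy, mk_eq_mk_of_smul _ _ ((ℓ (f y).rep)⁻¹) ?_⟩
  rw [lift, map_smul]

end

end CP

/-! ### Siegel's lemma and algebraic dependence -/

/-- The Taylor polynomial of degree less than `s`, as a combination of the monomials all of whose
exponents are less than `s`. -/
theorem exists_isBigO_sub_sum_monomial {d : ℕ} {h : EuclideanSpace ℂ (Fin d) → ℂ}
    (hh : AnalyticAt ℂ h 0) (s : ℕ) :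
    ∃ w : (Fin d → Fin s) → ℂ,
      (fun z => h z - ∑ β, w β * ∏ j, z j ^ (β j : ℕ)) =O[𝓝 0] fun z => ‖z‖ ^ s := by
  obtain ⟨p, hp⟩ := hh
  let mono : (Fin d → Fin s) → EuclideanSpace ℂ (Fin d) → ℂ := fun β z => ∏ j, z j ^ (β j : ℕ)
  have key : ∀ n < s, (fun z : EuclideanSpace ℂ (Fin d) => p n fun _ => z) ∈
      Submodule.span ℂ (range mono) := by
    intro n hn
    have h1 : (fun z : EuclideanSpace ℂ (Fin d) => p n fun _ => z) =
        ∑ r : Fin n → Fin d, (p n fun i => EuclideanSpace.single (r i) (1 : ℂ)) •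
          fun z : EuclideanSpace ℂ (Fin d) => ∏ i, z (r i) := by
      ext z
      have hz : z = ∑ j, z j • EuclideanSpace.single j (1 : ℂ) := by
        ext k
        simp [Finset.sum_apply, Pi.single_apply]
      conv_lhs => rw [hz]
      rw [ContinuousMultilinearMap.map_sum, Finset.sum_apply]
      refine Finset.sum_congr rfl fun r _ => ?_
      rw [ContinuousMultilinearMap.map_smul_univ, Pi.smul_apply, smul_eq_mul, smul_eq_mul, mul_comm]
    rw [h1]
    refine Submodule.sum_mem _ fun r _ => Submodule.smul_mem _ _ (Submodule.subset_span ?_)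
    -- The exponents are the cardinalities of the fibres of `r`.
    refine ⟨fun j => ⟨(Finset.univ.filter fun i => r i = j).card, lt_of_le_of_lt
      ((Finset.card_le_univ _).trans_eq (Fintype.card_fin n)) hn⟩, funext fun z => ?_⟩
    simp only [mono]
    rw [← Finset.prod_fiberwise_of_maps_to (s := Finset.univ) (t := Finset.univ) (g := r)
      (fun _ _ => Finset.mem_univ _)]
    refine Finset.prod_congr rfl fun j _ => ?_
    rw [Finset.prod_congr rfl fun i hi => by rw [(Finset.mem_filter.1 hi).2], Finset.prod_const]
  have h2 : (fun z : EuclideanSpace ℂ (Fin d) => p.partialSum s z) ∈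
      Submodule.span ℂ (range mono) := by
    have : (fun z : EuclideanSpace ℂ (Fin d) => p.partialSum s z) =
        ∑ n ∈ Finset.range s, fun z : EuclideanSpace ℂ (Fin d) => p n fun _ => z := by
      ext z
      simp [FormalMultilinearSeries.partialSum, Finset.sum_apply]
    rw [this]
    exact Submodule.sum_mem _ fun n hn => key n (Finset.mem_range.1 hn)
  obtain ⟨w, hw⟩ := (Submodule.mem_span_range_iff_exists_fun ℂ).1 h2
  refine ⟨w, ?_⟩
  have h3 := hp.isBigO_sub_partialSum_pow s
  simp only [zero_add] at h3
  refine h3.congr_left fun z => ?_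
  have h4 := congrFun hw z
  simp only [Finset.sum_apply, Pi.smul_apply, smul_eq_mul, mono] at h4
  rw [h4]

/-- The Schwarz lemma for a holomorphic function which vanishes to order `s` at the centre. -/
theorem norm_le_mul_pow_of_isBigO {E : Type*} [NormedAddCommGroup E] [NormedSpace ℂ E] {h : E → ℂ}
    (hd : DifferentiableOn ℂ h (Metric.ball 0 1)) {A : ℝ} (hA : ∀ z ∈ Metric.ball (0 : E) 1, ‖h z‖ ≤ A)
    {s : ℕ} (hs : h =O[𝓝 0] fun z => ‖z‖ ^ s) {z : E} (hz : z ∈ Metric.ball (0 : E) 1) :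
    ‖h z‖ ≤ A * ‖z‖ ^ s := by
  rcases s with _ | n
  · simpa using hA z hz
  have h0 : h 0 = 0 := by
    have hs' : h =O[𝓝 0] fun z => ‖z - 0‖ ^ (n + 1) := by simpa using hs
    exact hs'.eq_zero_of_norm_pow n.succ_ne_zero
  have := Complex.dist_le_mul_div_pow_of_mapsTo_ball_of_isLittleO (n := n) (R₂ := A) hd
    (fun w hw => by simpa [h0] using hA w hw) ?_ hz
  · simpa [h0] using this
  · simp only [h0, sub_zero]
    exact hs.trans_isLittleO (Asymptotics.isLittleO_norm_pow_norm_pow n.lt_succ_self)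

/-- The exponent vectors of the monomials of degree `M * q` in `M + 1` variables in which all
exponents but the first are given by `a`. -/
def homExponent {M q : ℕ} (a : Fin M → Fin q) : Fin (M + 1) →₀ ℕ :=
  Finsupp.equivFunOnFinite.symm (Fin.cons (M * q - ∑ i, (a i : ℕ)) fun i => (a i : ℕ))

theorem homExponent_injective {M q : ℕ} :
    Function.Injective (homExponent : (Fin M → Fin q) → Fin (M + 1) →₀ ℕ) := by
  intro a b h
  funext i
  have := DFunLike.congr_fun h i.succ
  simpa [homExponent, Fin.ext_iff] using this

theorem degree_homExponent {M q : ℕ} (a : Fin M → Fin q) : (homExponent a).degree = M * q := by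
  have h : ∑ i, (a i : ℕ) ≤ M * q := by
    refine (Finset.sum_le_sum fun i _ => (a i).2.le).trans_eq ?_
    simp
  rw [Finsupp.degree_eq_sum, Fin.sum_univ_succ]
  simp only [homExponent, Finsupp.equivFunOnFinite_symm_apply_apply, Fin.cons_zero, Fin.cons_succ]
  omega

theorem eval_smul_of_isHomogeneous {σ : Type*} {P : MvPolynomial σ ℂ} {k : ℕ}
    (hP : P.IsHomogeneous k) (c : ℂ) (v : σ → ℂ) :
    MvPolynomial.eval (c • v) P = c ^ k * MvPolynomial.eval v P := by
  rw [MvPolynomial.eval_eq, MvPolynomial.eval_eq, Finset.mul_sum]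
  refine Finset.sum_congr rfl fun m hm => ?_
  have h1 : m.sum (fun _ e => e) = k := by
    have := hP.degree_eq_sum_deg_support hm
    rw [this]
    rfl
  simp only [Pi.smul_apply, smul_eq_mul, mul_pow, Finset.prod_mul_distrib]
  rw [Finset.prod_pow_eq_pow_sum, show ∑ i ∈ m.support, m i = k from h1]
  ring

/-- Siegel's lemma: finitely many holomorphic maps `F_t` on the unit ball of `ℂᵈ`, such that every
line they hit is hit inside the ball of radius `1/2`, satisfy a homogeneous polynomial equation if
they take values in a space of dimension at least `d + 2`. -/
theorem exists_homogeneous_of_cover {d M : ℕ} (hdM : d < M) {T : Type*} [Finite T]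
    (F : T → EuclideanSpace ℂ (Fin d) → Fin (M + 1) → ℂ)
    (hF : ∀ t, ContDiffOn ℂ ω (F t) (Metric.ball 0 1)) {C : ℝ}
    (hC : ∀ t, ∀ z ∈ Metric.ball (0 : EuclideanSpace ℂ (Fin d)) 1, ‖F t z‖ ≤ C)
    (hcov : ∀ t, ∀ z ∈ Metric.ball (0 : EuclideanSpace ℂ (Fin d)) 1, ∃ t',
      ∃ z' ∈ Metric.ball (0 : EuclideanSpace ℂ (Fin d)) (1 / 2), ∃ c : ℂ, ‖c‖ ≤ C ∧
        F t z = c • F t' z') :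
    ∃ (k : ℕ) (P : MvPolynomial (Fin (M + 1)) ℂ), P.IsHomogeneous k ∧ P ≠ 0 ∧
      ∀ t, ∀ z ∈ Metric.ball (0 : EuclideanSpace ℂ (Fin d)) 1, MvPolynomial.eval (F t z) P = 0 := by
  have := Fintype.ofFinite T
  obtain ⟨c₀, hc₀⟩ : ∃ c₀ : ℕ, C < 2 ^ c₀ := pow_unbounded_of_one_lt C one_lt_two
  -- The vanishing order `s = c₀ M q` is proportional to the degree `M q`, so that there are
  -- `O(q ^ d)` conditions on `q ^ M` coefficients.
  set q := Fintype.card T * (c₀ * M) ^ d + 1 with hq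
  set s := c₀ * (M * q) with hs
  have hcount : Fintype.card T * s ^ d < q ^ M := by
    have h1 : s ^ d = (c₀ * M) ^ d * q ^ d := by rw [hs, ← mul_assoc, mul_pow]
    calc Fintype.card T * s ^ d = (Fintype.card T * (c₀ * M) ^ d) * q ^ d := by rw [h1, mul_assoc]
      _ < q * q ^ d := Nat.mul_lt_mul_of_pos_right (by omega) (by positivity)
      _ = q ^ (d + 1) := by ring
      _ ≤ q ^ M := Nat.pow_le_pow_right (by omega) hdM
  have h0 : (0 : EuclideanSpace ℂ (Fin d)) ∈ Metric.ball 0 1 := by simp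
  have hmon : ∀ (P : MvPolynomial (Fin (M + 1)) ℂ) (t : T),
      ContDiffOn ℂ ω (fun z => MvPolynomial.eval (F t z) P) (Metric.ball 0 1) := by
    intro P t
    simp only [MvPolynomial.eval_eq]
    exact ContDiffOn.sum fun m _ => contDiffOn_const.mul (contDiffOn_prod fun i _ =>
      ((contDiffOn_pi.1 (hF t)) i).pow _)
  have hT : ∀ (t : T) (a : Fin M → Fin q), ∃ w : (Fin d → Fin s) → ℂ,
      (fun z => MvPolynomial.eval (F t z) (MvPolynomial.monomial (homExponent a) 1) -
        ∑ β, w β * ∏ j, z j ^ (β j : ℕ)) =O[𝓝 0] fun z => ‖z‖ ^ s := fun t a =>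
    exists_isBigO_sub_sum_monomial
      ((hmon _ t).contDiffAt (Metric.ball_mem_nhds 0 one_pos)).analyticAt s
  choose w hw using hT
  let Λ : ((Fin M → Fin q) → ℂ) →ₗ[ℂ] T → (Fin d → Fin s) → ℂ :=
    LinearMap.pi fun t => Fintype.linearCombination ℂ (w t)
  obtain ⟨c, hcΛ, hc0⟩ : ∃ c, Λ c = 0 ∧ c ≠ 0 := by
    have hk : LinearMap.ker Λ ≠ ⊥ := by
      refine LinearMap.ker_ne_bot_of_finrank_lt ?_
      simpa [Module.finrank_pi_fintype, Module.finrank_pi] using hcount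
    obtain ⟨c, hc, hc0⟩ := (Submodule.ne_bot_iff _).1 hk
    exact ⟨c, hc, hc0⟩
  let P : MvPolynomial (Fin (M + 1)) ℂ := ∑ a, MvPolynomial.monomial (homExponent a) (c a)
  have hPh : P.IsHomogeneous (M * q) := MvPolynomial.IsHomogeneous.sum _ _ _ fun a _ =>
    MvPolynomial.isHomogeneous_monomial _ (degree_homExponent a)
  have hP0 : P ≠ 0 := by
    obtain ⟨a, ha⟩ := Function.ne_iff.1 hc0
    intro hP
    refine ha ?_
    have h1 : MvPolynomial.coeff (homExponent a) P = c a := by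
      simp only [P, MvPolynomial.coeff_sum, MvPolynomial.coeff_monomial]
      rw [Finset.sum_eq_single a]
      · simp
      · intro b _ hb
        rw [if_neg fun h => hb (homExponent_injective h)]
      · simp
    rw [← h1, hP, MvPolynomial.coeff_zero]
    rfl
  -- All the functions `P(F_t)` vanish to order `s` at the origin.
  have hPO : ∀ t, (fun z => MvPolynomial.eval (F t z) P) =O[𝓝 0] fun z => ‖z‖ ^ s := by
    intro t
    have h1 : (fun z => ∑ a : Fin M → Fin q, c a * (MvPolynomial.eval (F t z)
        (MvPolynomial.monomial (homExponent a) 1) - ∑ β, w t a β * ∏ j, z j ^ (β j : ℕ)))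
        =O[𝓝 0] fun z => ‖z‖ ^ s :=
      Asymptotics.IsBigO.fun_sum fun a _ => (hw t a).const_mul_left (c a)
    refine h1.congr_left fun z => ?_
    have h2 : ∀ β, ∑ a, c a * w t a β = 0 := fun β => by
      have := congrFun (congrFun hcΛ t) β
      simpa [Λ, Fintype.linearCombination_apply, Finset.sum_apply] using this
    have h3 : ∑ a, c a * ∑ β, w t a β * ∏ j, z j ^ (β j : ℕ) = 0 := by
      simp only [Finset.mul_sum]
      rw [Finset.sum_comm]
      refine Finset.sum_eq_zero fun β _ => ?_
      simp only [← mul_assoc]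
      rw [← Finset.sum_mul, h2, zero_mul]
    simp only [mul_sub, Finset.sum_sub_distrib, h3, sub_zero, P, map_sum,
      MvPolynomial.eval_monomial, one_mul]
  obtain ⟨B, hB⟩ : ∃ B : ℝ, ∀ t, ∀ z ∈ Metric.ball (0 : EuclideanSpace ℂ (Fin d)) 1,
      ‖MvPolynomial.eval (F t z) P‖ ≤ B := by
    obtain ⟨B, hB⟩ := (isCompact_closedBall (0 : Fin (M + 1) → ℂ) C).exists_bound_of_continuousOn
      (f := fun v => MvPolynomial.eval v P) (MvPolynomial.continuous_eval P).continuousOn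
    exact ⟨B, fun t z hz => hB _ (by simpa using hC t z hz)⟩
  rcases isEmpty_or_nonempty T with hTe | ⟨⟨t₀⟩⟩
  · exact ⟨_, P, hPh, hP0, fun t => hTe.elim t⟩
  have hC0 : 0 ≤ C := (norm_nonneg _).trans (hC t₀ 0 h0)
  -- By the Schwarz lemma and `hcov`, a common bound for the `P(F_t)` can be improved by the factor
  -- `θ < 1`; hence they vanish.
  set θ := (C / 2 ^ c₀) ^ (M * q) with hθ
  have hθ0 : 0 ≤ θ := by positivity
  have hMq : M * q ≠ 0 := Nat.mul_ne_zero (by omega) (by omega)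
  have hθ1 : θ < 1 := pow_lt_one₀ (by positivity) ((div_lt_one (by positivity)).2 hc₀) hMq
  have himp : ∀ B : ℝ, (∀ t, ∀ z ∈ Metric.ball (0 : EuclideanSpace ℂ (Fin d)) 1,
      ‖MvPolynomial.eval (F t z) P‖ ≤ B) → ∀ t, ∀ z ∈ Metric.ball (0 : EuclideanSpace ℂ (Fin d)) 1,
      ‖MvPolynomial.eval (F t z) P‖ ≤ θ * B := by
    intro B hB t z hz
    have hB0 : 0 ≤ B := (norm_nonneg _).trans (hB t z hz)
    obtain ⟨t', z', hz', c', hc', he⟩ := hcov t z hz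
    have hz'1 : z' ∈ Metric.ball (0 : EuclideanSpace ℂ (Fin d)) 1 :=
      Metric.ball_subset_ball (by norm_num) hz'
    have h1 := norm_le_mul_pow_of_isBigO ((hmon P t').differentiableOn (by simp)) (hB t') (hPO t')
      hz'1
    have h2 : ‖z'‖ ^ s ≤ (1 / 2) ^ s :=
      pow_le_pow_left₀ (norm_nonneg _) (mem_ball_zero_iff.1 hz').le s
    rw [he, eval_smul_of_isHomogeneous hPh, norm_mul, norm_pow]
    calc ‖c'‖ ^ (M * q) * ‖MvPolynomial.eval (F t' z') P‖
        ≤ C ^ (M * q) * (B * (1 / 2) ^ s) := by gcongr; exact h1.trans (by gcongr)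
      _ = θ * B := by
        have h3 : (1 / 2 : ℝ) ^ s = 1 / (2 ^ c₀) ^ (M * q) := by
          rw [hs, div_pow, one_pow, pow_mul]
        rw [h3, hθ, div_pow]
        ring
  have hiter : ∀ n : ℕ, ∀ t, ∀ z ∈ Metric.ball (0 : EuclideanSpace ℂ (Fin d)) 1,
      ‖MvPolynomial.eval (F t z) P‖ ≤ θ ^ n * B := by
    intro n
    induction n with
    | zero => simpa using hB
    | succ n ih =>
      intro t z hz
      refine (himp _ ih t z hz).trans_eq ?_
      ring
  refine ⟨_, P, hPh, hP0, fun t z hz => ?_⟩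
  have hlim : Tendsto (fun n : ℕ => θ ^ n * B) atTop (𝓝 0) := by
    simpa using (tendsto_pow_atTop_nhds_zero_of_lt_one hθ0 hθ1).mul_const B
  exact norm_le_zero_iff.1 (ge_of_tendsto' hlim fun n => hiter n t z hz)

/-! ### Noether normalization -/

/-- A compact complex manifold of dimension `d`, mapped holomorphically to a projective space of
dimension greater than `d`, lies on a hypersurface. -/
theorem exists_homogeneous_vanishing {d M : ℕ} (hdM : d < M) {X : Type*} [TopologicalSpace X]
    [CompactSpace X] [ChartedSpace (EuclideanSpace ℂ (Fin d)) X]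
    [IsManifold 𝓘(ℂ, EuclideanSpace ℂ (Fin d)) ω X] {g : X → CP M}
    (hg : ContMDiff 𝓘(ℂ, EuclideanSpace ℂ (Fin d)) 𝓘(ℂ, EuclideanSpace ℂ (Fin M)) ω g) :
    ∃ (k : ℕ) (P : MvPolynomial (Fin (M + 1)) ℂ), P.IsHomogeneous k ∧ P ≠ 0 ∧
      ∀ x, MvPolynomial.eval (g x).rep P = 0 := by
  let φ : (x : X) → OpenPartialHomeomorph X (EuclideanSpace ℂ (Fin d)) := fun x => chartAt _ x
  let ℓ : Fin (M + 1) → (Fin (M + 1) → ℂ) →ₗ[ℂ] ℂ := fun i => LinearMap.proj i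
  choose i hi using fun x => exists_rep_ne_zero (g x)
  let G : X → EuclideanSpace ℂ (Fin d) → Fin (M + 1) → ℂ := fun x y =>
    CP.lift (ℓ (i x)) (g ((φ x).symm y))
  have hG : ∀ x y, y ∈ (φ x).target → (g ((φ x).symm y)).rep (i x) ≠ 0 →
      ContDiffAt ℂ ω (G x) y := by
    intro x y hy hiy
    have h1 : ContMDiffAt 𝓘(ℂ, EuclideanSpace ℂ (Fin d)) 𝓘(ℂ, EuclideanSpace ℂ (Fin d)) ω
        (φ x).symm y :=
      contMDiffAt_symm_of_mem_maximalAtlas (IsManifold.chart_mem_maximalAtlas x) hy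
    have h2 : ContMDiffAt 𝓘(ℂ, EuclideanSpace ℂ (Fin d)) 𝓘(ℂ, Fin (M + 1) → ℂ) ω
        (CP.lift (ℓ (i x)) ∘ g ∘ (φ x).symm) y :=
      (CP.contMDiffAt_lift (ℓ := ℓ (i x)) hiy).comp y ((hg _).comp y h1)
    exact h2.contDiffAt
  have hball : ∀ x, ∃ R > 0, ∃ C : ℝ, ∀ y ∈ Metric.ball (φ x x) R,
      y ∈ (φ x).target ∧ (g ((φ x).symm y)).rep (i x) ≠ 0 ∧ ‖G x y‖ ≤ C := by
    intro x
    have ht : φ x x ∈ (φ x).target := (φ x).map_source (mem_chart_source _ x)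
    have hx : (φ x).symm (φ x x) = x := (φ x).left_inv (mem_chart_source _ x)
    have hix : (g ((φ x).symm (φ x x))).rep (i x) ≠ 0 := by rw [hx]; exact hi x
    have h1 : ∀ᶠ y in 𝓝 (φ x x), y ∈ (φ x).target := (φ x).open_target.mem_nhds ht
    have h2 : ∀ᶠ y in 𝓝 (φ x x), (g ((φ x).symm y)).rep (i x) ≠ 0 := by
      have hc : ContinuousAt (fun y => g ((φ x).symm y)) (φ x x) :=
        hg.continuous.continuousAt.comp ((φ x).continuousAt_symm ht)
      exact hc.preimage_mem_nhds ((isOpen_chart_source (i x)).mem_nhds hix)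
    have h3 : ∀ᶠ y in 𝓝 (φ x x), ‖G x y‖ < ‖G x (φ x x)‖ + 1 :=
      (hG x _ ht hix).continuousAt.norm.eventually_lt_const (lt_add_one _)
    obtain ⟨R, hR, h⟩ := Metric.eventually_nhds_iff_ball.1 (h1.and (h2.and h3))
    exact ⟨R, hR, _, fun y hy => ⟨(h y hy).1, (h y hy).2.1, (h y hy).2.2.le⟩⟩
  choose R hR C hRC using hball
  obtain ⟨T, hT⟩ := CompactSpace.elim_nhds_subcover
    (fun x => (φ x).source ∩ φ x ⁻¹' Metric.ball (φ x x) (R x / 2)) fun x =>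
      inter_mem ((φ x).open_source.mem_nhds (mem_chart_source _ x))
        (((φ x).continuousAt (mem_chart_source _ x)).preimage_mem_nhds
          (Metric.ball_mem_nhds _ (half_pos (hR x))))
  let F : T → EuclideanSpace ℂ (Fin d) → Fin (M + 1) → ℂ := fun t z =>
    G t (φ t t + (R t : ℂ) • z)
  have hmem : ∀ (t : T) (z : EuclideanSpace ℂ (Fin d)), z ∈ Metric.ball 0 1 →
      φ t t + (R t : ℂ) • z ∈ Metric.ball (φ t t) (R t) := by
    intro t z hz
    rw [mem_ball_iff_norm, add_sub_cancel_left, norm_smul, Complex.norm_real, Real.norm_eq_abs,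
      abs_of_pos (hR t)]
    exact mul_lt_of_lt_one_right (hR t) (mem_ball_zero_iff.1 hz)
  -- Every point of `X` is parametrized by the half ball of some chart.
  have hcov : ∀ x : X, ∃ t : T, ∃ z ∈ Metric.ball (0 : EuclideanSpace ℂ (Fin d)) (1 / 2),
      (φ t).symm (φ t t + (R t : ℂ) • z) = x := by
    intro x
    have hx : x ∈ ⋃ y ∈ T, (φ y).source ∩ φ y ⁻¹' Metric.ball (φ y y) (R y / 2) := by
      rw [hT]; trivial
    obtain ⟨t, ht, hxs, hxb⟩ : ∃ t ∈ T, x ∈ (φ t).source ∧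
        φ t x ∈ Metric.ball (φ t t) (R t / 2) := by
      simpa only [mem_iUnion, exists_prop, mem_inter_iff, mem_preimage] using hx
    have hRt : (R t : ℂ) ≠ 0 := by exact_mod_cast (hR t).ne'
    refine ⟨⟨t, ht⟩, (R t : ℂ)⁻¹ • (φ t x - φ t t), ?_, ?_⟩
    · rw [mem_ball_zero_iff, norm_smul, norm_inv, Complex.norm_real, Real.norm_eq_abs,
        abs_of_pos (hR t), inv_mul_lt_iff₀ (hR t)]
      rw [mem_ball_iff_norm] at hxb
      linarith
    · simp only [smul_smul, mul_inv_cancel₀ hRt, one_smul, add_sub_cancel]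
      exact (φ t).left_inv hxs
  obtain ⟨B, hB⟩ : ∃ B, ∀ t : T, C t ≤ B := by
    obtain ⟨B, hB⟩ := (finite_range fun t : T => C t).bddAbove
    exact ⟨B, fun t => hB (mem_range_self t)⟩
  obtain ⟨k, P, hPk, hP0, hP⟩ := exists_homogeneous_of_cover hdM F (fun t z hz => by
      have h := hRC t _ (hmem t z hz)
      have h1 : ContDiff ℂ ω fun z : EuclideanSpace ℂ (Fin d) => φ t t + (R t : ℂ) • z := by fun_prop
      exact ((hG t _ h.1 h.2.1).comp z h1.contDiffAt).contDiffWithinAt)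
    (fun t z hz => ((hRC t _ (hmem t z hz)).2.2).trans (hB t)) (fun t z hz => by
      obtain ⟨t', z', hz', he⟩ := hcov ((φ t).symm (φ t t + (R t : ℂ) • z))
      have hz'1 := Metric.ball_subset_ball (by norm_num : (1 / 2 : ℝ) ≤ 1) hz'
      refine ⟨t', z', hz', F t z (i t'), ?_, ?_⟩
      · exact (norm_le_pi_norm _ _).trans (((hRC t _ (hmem t z hz)).2.2).trans (hB t))
      · have h' := (hRC t' _ (hmem t' z' hz'1)).2.1
        -- The two lifts are proportional, and the coordinate `i t'` of the second one is `1`.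
        simp only [F, G, CP.lift] at h' ⊢
        rw [he] at h' ⊢
        set v := (g ((φ t).symm (φ t t + (R t : ℂ) • z))).rep
        change (ℓ (i t) v)⁻¹ • v = ((ℓ (i t) v)⁻¹ * v (i t')) • (v (i t'))⁻¹ • v
        rw [smul_smul, mul_assoc, mul_inv_cancel₀ h', mul_one])
  refine ⟨k, P, hPk, hP0, fun x => ?_⟩
  obtain ⟨t, z, hz, he⟩ := hcov x
  have hz1 := Metric.ball_subset_ball (by norm_num : (1 / 2 : ℝ) ≤ 1) hz
  have h1 := hP t z hz1
  have h2 := (hRC t _ (hmem t z hz1)).2.1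
  simp only [F, G, CP.lift] at h1
  rw [he] at h1 h2
  rw [eval_smul_of_isHomogeneous hPk] at h1
  exact (mul_eq_zero.1 h1).resolve_left (pow_ne_zero _ (inv_ne_zero h2))

/-- A surjective linear map with a given kernel of dimension one. -/
theorem exists_linearMap_ker_eq_span {m : ℕ} {w : Fin (m + 1) → ℂ} (hw : w ≠ 0) :
    ∃ π : (Fin (m + 1) → ℂ) →ₗ[ℂ] (Fin m → ℂ), Function.Surjective π ∧ π w = 0 ∧
      ∀ v, π v = 0 → ∃ a : ℂ, v = a • w := by
  obtain ⟨i, hi⟩ := Function.ne_iff.1 hw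
  have hi' : w i ≠ 0 := hi
  let π : (Fin (m + 1) → ℂ) →ₗ[ℂ] (Fin m → ℂ) := LinearMap.pi fun j =>
    LinearMap.proj (i.succAbove j) - (w (i.succAbove j) / w i) • LinearMap.proj i
  have hπ : ∀ v j, π v j = v (i.succAbove j) - w (i.succAbove j) / w i * v i := fun v j => rfl
  refine ⟨π, fun u => ⟨i.insertNth 0 u, funext fun j => ?_⟩, funext fun j => ?_, fun v hv => ?_⟩
  · simp [hπ]
  · rw [hπ, div_mul_cancel₀ _ hi', sub_self]; rfl
  · refine ⟨v i / w i, funext fun k => ?_⟩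
    rcases Fin.eq_self_or_eq_succAbove i k with rfl | ⟨j, rfl⟩
    · simp [hi']
    · have := congrFun hv j
      rw [hπ] at this
      simp only [Pi.smul_apply, smul_eq_mul]
      have h2 : v (i.succAbove j) = w (i.succAbove j) / w i * v i := by
        simpa [sub_eq_zero] using this
      rw [h2]
      ring

/-- On a line with point at infinity off the hypersurface `P = 0`, the polynomial `P` has finitely
many zeros. -/
theorem finite_setOf_eval_add_smul_eq_zero {σ : Type*} {P : MvPolynomial σ ℂ} {k : ℕ}
    (hP : P.IsHomogeneous k) {w : σ → ℂ} (hw : MvPolynomial.eval w P ≠ 0) (v : σ → ℂ) :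
    {a : ℂ | MvPolynomial.eval (v + a • w) P = 0}.Finite := by
  let lin : (σ → ℂ) → (σ → ℂ) → Polynomial ℂ := fun v w =>
    MvPolynomial.aeval (fun j => Polynomial.C (v j) + Polynomial.C (w j) * Polynomial.X) P
  have hlin : ∀ v w a, (lin v w).eval a = MvPolynomial.eval (v + a • w) P := by
    intro v w a
    have h1 : (Polynomial.evalRingHom a).comp (MvPolynomial.aeval fun j =>
        Polynomial.C (v j) + Polynomial.C (w j) * Polynomial.X :
          MvPolynomial σ ℂ →ₐ[ℂ] Polynomial ℂ).toRingHom = MvPolynomial.eval (v + a • w) := by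
      refine MvPolynomial.ringHom_ext (fun r => ?_) fun j => ?_
      · change Polynomial.eval a (MvPolynomial.aeval _ (MvPolynomial.C r)) = _
        rw [MvPolynomial.aeval_C, MvPolynomial.eval_C, Polynomial.algebraMap_eq,
          Polynomial.eval_C]
      · change Polynomial.eval a (MvPolynomial.aeval _ (MvPolynomial.X j)) = _
        rw [MvPolynomial.aeval_X, MvPolynomial.eval_X]
        simp only [Polynomial.eval_add, Polynomial.eval_mul, Polynomial.eval_C, Polynomial.eval_X,
          Pi.add_apply, Pi.smul_apply, smul_eq_mul]
        ring
    exact RingHom.congr_fun h1 P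
  have hne : lin v w ≠ 0 := by
    intro h0
    -- Otherwise the polynomial `a ↦ P(w + a v)` would vanish for `a ≠ 0`.
    have h1 : lin w v = 0 := by
      refine Polynomial.eq_zero_of_infinite_isRoot _ (Set.Infinite.mono (s := {0}ᶜ) ?_
        (Set.finite_singleton (0 : ℂ)).infinite_compl)
      intro a ha
      have ha' : a ≠ 0 := ha
      have h2 := hlin v w a⁻¹
      rw [h0, Polynomial.eval_zero] at h2
      change (lin w v).eval a = 0
      rw [hlin, show w + a • v = a • (v + a⁻¹ • w) by
        rw [smul_add, smul_smul, mul_inv_cancel₀ ha', one_smul, add_comm],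
        eval_smul_of_isHomogeneous hP, ← h2, mul_zero]
    have h3 := hlin w v 0
    rw [h1, Polynomial.eval_zero, zero_smul, add_zero] at h3
    exact hw h3.symm
  refine (Polynomial.finite_setOfPred_isRoot hne).subset fun a ha => ?_
  exact (hlin v w a).trans ha

/-- Noether normalization: repeated projection from points off a hypersurface containing the image
leads to a linear projection to `ℂPᴹ` with finite fibres. -/
theorem exists_linearProjection_finite_fibres {d N : ℕ} {X : Type*} [TopologicalSpace X]
    [CompactSpace X] [Nonempty X] [ChartedSpace (EuclideanSpace ℂ (Fin d)) X]
    [IsManifold 𝓘(ℂ, EuclideanSpace ℂ (Fin d)) ω X] {f : X → CP N}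
    (hf : ContMDiff 𝓘(ℂ, EuclideanSpace ℂ (Fin d)) 𝓘(ℂ, EuclideanSpace ℂ (Fin N)) ω f)
    (hinj : Function.Injective f) {M : ℕ} (hdM : d ≤ M) (hMN : M ≤ N) :
    ∃ (L : (Fin (N + 1) → ℂ) →ₗ[ℂ] (Fin (M + 1) → ℂ)) (hL : ∀ x, L (f x).rep ≠ 0),
      ∀ p : CP M, {x | Projectivization.mk ℂ (L (f x).rep) (hL x) = p}.Finite := by
  induction hMN using Nat.decreasingInduction with
  | self =>
    refine ⟨LinearMap.id, fun x => (f x).rep_nonzero, fun p => ?_⟩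
    refine (Set.finite_singleton p).preimage hinj.injOn |>.subset fun x hx => ?_
    exact ((f x).mk_rep).symm.trans hx
  | of_succ M hM ih =>
    obtain ⟨L, hL, hfin⟩ := ih (by omega)
    have hg := CP.contMDiff_linearProjection hf L hL
    obtain ⟨k, P, hPk, hP0, hP⟩ := exists_homogeneous_vanishing (by omega : d < M + 1) hg
    have hPL : ∀ x, MvPolynomial.eval (L (f x).rep) P = 0 := fun x => by
      obtain ⟨a, ha, h⟩ := CP.exists_rep_eq_smul (L (f x).rep) (hL x)
      have h1 := hP x
      rw [h, eval_smul_of_isHomogeneous hPk] at h1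
      exact (mul_eq_zero.1 h1).resolve_left (pow_ne_zero _ ha)
    obtain ⟨w, hw⟩ : ∃ w, MvPolynomial.eval w P ≠ 0 := by
      by_contra! h
      exact hP0 (MvPolynomial.funext fun w => by rw [h w, map_zero])
    have hw0 : w ≠ 0 := by
      rintro rfl
      obtain ⟨x⟩ := ‹Nonempty X›
      have h1 := eval_smul_of_isHomogeneous hPk 0 (L (f x).rep)
      rw [hPL x, mul_zero, zero_smul] at h1
      exact hw h1
    obtain ⟨π, hπs, hπw, hπk⟩ := exists_linearMap_ker_eq_span hw0
    have hPne : ∀ v : Fin (M + 1 + 1) → ℂ, v ≠ 0 → MvPolynomial.eval v P = 0 → π v ≠ 0 := by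
      intro v hv hPv h
      obtain ⟨a, rfl⟩ := hπk v h
      rw [eval_smul_of_isHomogeneous hPk] at hPv
      refine hw ((mul_eq_zero.1 hPv).resolve_left (pow_ne_zero _ fun ha => hv ?_))
      rw [ha, zero_smul]
    refine ⟨π.comp L, fun x => hPne _ (hL x) (hPL x), fun p => ?_⟩
    obtain ⟨v, hv⟩ := hπs p.rep
    have hne : ∀ a : ℂ, v + a • w ≠ 0 := fun a h => by
      have := congrArg π h
      rw [map_add, map_smul, hπw, smul_zero, add_zero, map_zero, hv] at this
      exact p.rep_nonzero this
    refine ((finite_setOf_eval_add_smul_eq_zero hPk hw v).biUnion fun a _ =>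
      hfin (Projectivization.mk ℂ (v + a • w) (hne a))).subset fun x hx => ?_
    have hx' : Projectivization.mk ℂ (π (L (f x).rep)) (hPne _ (hL x) (hPL x)) = p := hx
    rw [← p.mk_rep, eq_comm, Projectivization.mk_eq_mk_iff'] at hx'
    obtain ⟨c, hc⟩ := hx'
    have hc0 : c ≠ 0 := by
      rintro rfl
      rw [zero_smul] at hc
      exact p.rep_nonzero hc.symm
    obtain ⟨a, ha⟩ := hπk (c • L (f x).rep - v) (by rw [map_sub, map_smul, hc, hv, sub_self])
    have ha' : v + a • w = c • L (f x).rep := by rw [← ha]; abel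
    refine mem_biUnion (x := a) ?_ ?_
    · change MvPolynomial.eval (v + a • w) P = 0
      rw [ha', eval_smul_of_isHomogeneous hPk, hPL, mul_zero]
    · exact CP.mk_eq_mk_of_smul _ _ c ha'

/-! ### A point where the linear projection is immersive -/

/-- A holomorphic curve whose distance to the origin is maximal at `t = 0`, up to an error of fourth
order, has zero velocity there: compare the means over the points `r, ir, -r, -ir`. -/
theorem deriv_eq_zero_of_norm_sq_le {W : Type*} [NormedAddCommGroup W] [InnerProductSpace ℂ W]
    [CompleteSpace W] {Φ : ℂ → W} (hΦ : AnalyticAt ℂ Φ 0) {C : ℝ}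
    (hC : ∀ᶠ t in 𝓝 (0 : ℂ), ‖Φ t‖ ^ 2 ≤ ‖Φ 0‖ ^ 2 + C * ‖t‖ ^ 4) : deriv Φ 0 = 0 := by
  obtain ⟨p, hp⟩ := hΦ
  set a := p.coeff 0
  set b := p.coeff 1
  set c := p.coeff 2
  have hb : deriv Φ 0 = b := hp.deriv
  have ha : Φ 0 = a := (hp.coeff_zero _).symm
  -- For the quadratic Taylor polynomial `S`, the terms mixing `a`, `b` and `c` cancel in the mean of
  -- `‖S‖²` over the four points, which leaves `r² ‖b‖² ≤ O(r³)`.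
  let S : ℂ → W := fun t => a + t • b + t ^ 2 • c
  have hS : ∀ t, p.partialSum 3 t = S t := fun t => by
    simp [FormalMultilinearSeries.partialSum, Finset.sum_range_succ, S, a, b, c]
  have hO : (fun t => Φ t - S t) =O[𝓝 0] fun t => ‖t‖ ^ 3 := by
    simpa [hS] using hp.isBigO_sub_partialSum_pow 3
  obtain ⟨K, hK0, hK⟩ := hO.exists_pos
  have hSc : ∀ᶠ t in 𝓝 (0 : ℂ), ‖S t‖ < ‖S 0‖ + 1 := by
    have : Continuous S := by fun_prop
    exact this.norm.continuousAt.eventually_lt_const (lt_add_one _)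
  set B := ‖S 0‖ + 1
  have hB0 : 0 ≤ B := by positivity
  have hev : ∀ᶠ t in 𝓝 (0 : ℂ), ‖S t‖ ^ 2 ≤ ‖a‖ ^ 2 + (|C| + 2 * B * K) * ‖t‖ ^ 3 := by
    have h1 : ∀ᶠ t in 𝓝 (0 : ℂ), ‖t‖ < 1 := by
      filter_upwards [Metric.ball_mem_nhds (0 : ℂ) one_pos] with t ht using mem_ball_zero_iff.1 ht
    filter_upwards [hC, hSc, hK.bound, h1] with t h2 h3 h4 h5
    rw [norm_pow, norm_norm] at h4
    have h6 : ‖S t‖ ≤ ‖Φ t‖ + K * ‖t‖ ^ 3 := by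
      have := norm_sub_le (Φ t) (Φ t - S t)
      rw [sub_sub_cancel] at this
      linarith
    have h7 : ‖S t‖ ^ 2 ≤ ‖Φ t‖ ^ 2 + 2 * B * (K * ‖t‖ ^ 3) := by
      have h8 : 0 ≤ K * ‖t‖ ^ 3 := by positivity
      rcases le_or_gt (‖S t‖) (K * ‖t‖ ^ 3) with h9 | h9
      · nlinarith [norm_nonneg (S t), sq_nonneg (‖Φ t‖)]
      · have h10 : (‖S t‖ - K * ‖t‖ ^ 3) ^ 2 ≤ ‖Φ t‖ ^ 2 :=
          pow_le_pow_left₀ (by linarith) (by linarith) 2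
        nlinarith [norm_nonneg (S t), mul_le_mul_of_nonneg_right h3.le h8]
    have h11 : C * ‖t‖ ^ 4 ≤ |C| * ‖t‖ ^ 3 := by
      have h12 : ‖t‖ ^ 4 ≤ ‖t‖ ^ 3 := pow_le_pow_of_le_one (norm_nonneg t) h5.le (by norm_num)
      have h13 : 0 ≤ ‖t‖ ^ 4 := by positivity
      nlinarith [le_abs_self C, abs_nonneg C]
    rw [ha] at h2
    nlinarith
  set K' := |C| + 2 * B * K
  obtain ⟨ε, hε, hball⟩ := Metric.eventually_nhds_iff_ball.1 hev
  have hmain : ∀ r : ℝ, 0 < r → r < ε → ‖b‖ ^ 2 ≤ K' * r := by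
    intro r hr hrε
    have hn : ‖(r : ℂ)‖ = r := by rw [Complex.norm_real, Real.norm_eq_abs, abs_of_pos hr]
    have hmem : ∀ u : ℂ, ‖u‖ = 1 → ‖S (u * r)‖ ^ 2 ≤ ‖a‖ ^ 2 + K' * r ^ 3 := fun u hu => by
      have h1 : ‖u * (r : ℂ)‖ = r := by rw [norm_mul, hu, hn, one_mul]
      have := hball (u * r) (by rw [mem_ball_zero_iff, h1]; exact hrε)
      rwa [h1] at this
    have e1 := hmem 1 (by simp)
    have e2 := hmem (-1) (by simp)
    have e3 := hmem Complex.I (by simp)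
    have e4 := hmem (-Complex.I) (by simp)
    have s1 : S (1 * r) = (a + (r : ℂ) ^ 2 • c) + (r : ℂ) • b := by
      simp only [S, one_mul]; abel
    have s2 : S (-1 * r) = (a + (r : ℂ) ^ 2 • c) - (r : ℂ) • b := by
      simp only [S]
      rw [neg_one_mul, neg_sq, neg_smul]; abel
    have s3 : S (Complex.I * r) = (a - (r : ℂ) ^ 2 • c) + (Complex.I * r) • b := by
      simp only [S]
      rw [mul_pow, Complex.I_sq, neg_one_mul, neg_smul]; abel
    have s4 : S (-Complex.I * r) = (a - (r : ℂ) ^ 2 • c) - (Complex.I * r) • b := by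
      simp only [S]
      rw [mul_pow, neg_sq, Complex.I_sq, neg_one_mul, neg_smul, neg_mul, neg_smul]; abel
    rw [s1] at e1
    rw [s2] at e2
    rw [s3] at e3
    rw [s4] at e4
    have p1 := parallelogram_law_with_norm ℂ (a + (r : ℂ) ^ 2 • c) ((r : ℂ) • b)
    have p2 := parallelogram_law_with_norm ℂ (a - (r : ℂ) ^ 2 • c) ((Complex.I * r) • b)
    have p3 := parallelogram_law_with_norm ℂ a ((r : ℂ) ^ 2 • c)
    have n1 : ‖(r : ℂ) • b‖ = r * ‖b‖ := by rw [norm_smul, hn]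
    have n2 : ‖(Complex.I * r) • b‖ = r * ‖b‖ := by rw [norm_smul, norm_mul, hn, Complex.norm_I, one_mul]
    rw [n1] at p1
    rw [n2] at p2
    have h1 : r ^ 2 * ‖b‖ ^ 2 ≤ r ^ 2 * (K' * r) := by
      nlinarith [mul_self_nonneg ‖(r : ℂ) ^ 2 • c‖]
    exact le_of_mul_le_mul_left h1 (by positivity)
  have h0 : ‖b‖ ^ 2 ≤ 0 := by
    have hlim : Tendsto (fun r : ℝ => K' * r) (𝓝[>] 0) (𝓝 0) := by
      have : Continuous fun r : ℝ => K' * r := by fun_prop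
      simpa using (this.tendsto 0).mono_left nhdsWithin_le_nhds
    refine ge_of_tendsto hlim ?_
    filter_upwards [Ioo_mem_nhdsGT hε] with r hr using hmain r hr.1 hr.2
  rw [hb]
  exact norm_eq_zero.1 (pow_eq_zero_iff (two_ne_zero) |>.1 (le_antisymm h0 (by positivity)))

theorem mfderiv_eq_fderiv_comp_extChartAt_symm {E H F M : Type*} [NormedAddCommGroup E]
    [NormedSpace ℂ E] [TopologicalSpace H] {I : ModelWithCorners ℂ E H} [I.Boundaryless]
    [TopologicalSpace M] [ChartedSpace H M] [NormedAddCommGroup F] [NormedSpace ℂ F] {g : M → F}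
    {x : M} (hg : MDifferentiableAt I 𝓘(ℂ, F) g x) :
    mfderiv I 𝓘(ℂ, F) g x = fderiv ℂ (g ∘ (extChartAt I x).symm) (extChartAt I x x) := by
  simp only [mfderiv, hg, I.range_eq_univ, fderivWithin_univ, writtenInExtChartAt,
    extChartAt_model_space_eq_id]
  rfl

/-- The point of projective space given by a nonzero vector. (The base point for the zero
vector.) -/
def CP.ofVec {n : ℕ} (v : Fin (n + 1) → ℂ) : CP n :=
  open Classical in if h : v ≠ 0 then Projectivization.mk ℂ v h else basePoint n

theorem CP.ofVec_eq {n : ℕ} {v : Fin (n + 1) → ℂ} (hv : v ≠ 0) :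
    CP.ofVec v = Projectivization.mk ℂ v hv := dif_pos hv

theorem CP.contMDiffAt_ofVec {n : ℕ} {v : Fin (n + 1) → ℂ} (hv : v ≠ 0) :
    ContMDiffAt 𝓘(ℂ, Fin (n + 1) → ℂ) 𝓘(ℂ, EuclideanSpace ℂ (Fin n)) ω CP.ofVec v := by
  refine CP.contMDiffAt_mk (F := id) contMDiffAt_id hv ?_
  filter_upwards [isOpen_ne.mem_nhds hv] with w hw using ⟨hw, CP.ofVec_eq hw⟩

section

variable {d N : ℕ} {X : Type*} [TopologicalSpace X] [ChartedSpace (EuclideanSpace ℂ (Fin d)) X]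

/-- Normalized homogeneous coordinates of an immersion form an immersion. -/
theorem injective_mfderiv_lift {f : X → CP N} {x : X}
    (hf : ContMDiffAt 𝓘(ℂ, EuclideanSpace ℂ (Fin d)) 𝓘(ℂ, EuclideanSpace ℂ (Fin N)) ω f x)
    (hinj : Function.Injective
      (mfderiv 𝓘(ℂ, EuclideanSpace ℂ (Fin d)) 𝓘(ℂ, EuclideanSpace ℂ (Fin N)) f x))
    {ℓ : (Fin (N + 1) → ℂ) →ₗ[ℂ] ℂ} (hℓ : ℓ (f x).rep ≠ 0) :
    Function.Injective
      (mfderiv 𝓘(ℂ, EuclideanSpace ℂ (Fin d)) 𝓘(ℂ, Fin (N + 1) → ℂ) (CP.lift ℓ ∘ f) x) := by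
  have hw : (ω : WithTop ℕ∞) ≠ 0 := by simp
  have h1 : ContMDiffAt 𝓘(ℂ, EuclideanSpace ℂ (Fin d)) 𝓘(ℂ, Fin (N + 1) → ℂ) ω
      (CP.lift ℓ ∘ f) x := (CP.contMDiffAt_lift hℓ).comp x hf
  have h2 : CP.ofVec ∘ (CP.lift ℓ ∘ f) =ᶠ[𝓝 x] f := by
    filter_upwards [hf.continuousAt.preimage_mem_nhds
      ((CP.isOpen_setOf_apply_rep_ne_zero ℓ).mem_nhds hℓ)] with y hy
    exact (CP.ofVec_eq (CP.lift_ne_zero hy)).trans (CP.mk_lift hy)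
  have h3 := mfderiv_comp x
    ((CP.contMDiffAt_ofVec (CP.lift_ne_zero hℓ)).mdifferentiableAt hw) (h1.mdifferentiableAt hw)
  rw [h2.mfderiv_eq] at h3
  rw [h3] at hinj
  exact Function.Injective.of_comp hinj

/-- The maximum principle for linear projections. At a point where `‖f‖² / ‖L f‖²` is maximal, the
linear projection of the immersion `f` is an immersion. Here `f` and `L f` are normalized by the
linear form `ℓ = ⟪L (f x), L ·⟫`, so that `L f` moves orthogonally to its value at `x`. If `L f` is
stationary in a direction, then `‖L f‖²` is constant up to order four in this direction, so that
`‖f‖²` is maximal up to order four, and `f` is stationary by `deriv_eq_zero_of_norm_sq_le`. -/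
theorem exists_injective_mfderiv_linearProjection
    [IsManifold 𝓘(ℂ, EuclideanSpace ℂ (Fin d)) ω X] [CompactSpace X] [Nonempty X] {f : X → CP N}
    (hf : ContMDiff 𝓘(ℂ, EuclideanSpace ℂ (Fin d)) 𝓘(ℂ, EuclideanSpace ℂ (Fin N)) ω f)
    (hinj : ∀ x, Function.Injective
      (mfderiv 𝓘(ℂ, EuclideanSpace ℂ (Fin d)) 𝓘(ℂ, EuclideanSpace ℂ (Fin N)) f x))
    {W : Type*} [NormedAddCommGroup W] [InnerProductSpace ℂ W]
    (L : (Fin (N + 1) → ℂ) →ₗ[ℂ] W) (hL : ∀ x, L (f x).rep ≠ 0) :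
    ∃ x, Function.Injective (mfderiv 𝓘(ℂ, EuclideanSpace ℂ (Fin d)) 𝓘(ℂ, W)
      (fun y => L (CP.lift ((innerSL ℂ (L (f x).rep)).toLinearMap.comp L) (f y))) x) := by
  have hw : (ω : WithTop ℕ∞) ≠ 0 := by simp
  let j : (Fin (N + 1) → ℂ) →L[ℂ] EuclideanSpace ℂ (Fin (N + 1)) :=
    (EuclideanSpace.equiv (Fin (N + 1)) ℂ).symm
  let Lc : (Fin (N + 1) → ℂ) →L[ℂ] W := LinearMap.toContinuousLinearMap L
  have hj : Function.Injective j := (EuclideanSpace.equiv (Fin (N + 1)) ℂ).symm.injective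
  let u : X → ℝ := fun x => ‖j (f x).rep‖ ^ 2 / ‖L (f x).rep‖ ^ 2
  have hu : ∀ (ℓ : (Fin (N + 1) → ℂ) →ₗ[ℂ] ℂ) x, ℓ (f x).rep ≠ 0 →
      u x = ‖j (CP.lift ℓ (f x))‖ ^ 2 / ‖Lc (CP.lift ℓ (f x))‖ ^ 2 := by
    intro ℓ x hx
    change _ = _ / ‖L (CP.lift ℓ (f x))‖ ^ 2
    rw [CP.lift, map_smul, map_smul, norm_smul, norm_smul, mul_pow, mul_pow, mul_div_mul_left]
    exact pow_ne_zero _ (norm_ne_zero_iff.2 (inv_ne_zero hx))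
  have hLl : ∀ (ℓ : (Fin (N + 1) → ℂ) →ₗ[ℂ] ℂ) x, ℓ (f x).rep ≠ 0 →
      Lc (CP.lift ℓ (f x)) ≠ 0 := by
    intro ℓ x hx
    change L (CP.lift ℓ (f x)) ≠ 0
    rw [CP.lift, map_smul]
    exact smul_ne_zero (inv_ne_zero hx) (hL x)
  have hcont : Continuous u := by
    rw [continuous_iff_continuousAt]
    intro x
    obtain ⟨i, hi⟩ := exists_rep_ne_zero (f x)
    let ℓ : (Fin (N + 1) → ℂ) →ₗ[ℂ] ℂ := LinearMap.proj i
    have h1 : ContinuousAt (fun y => CP.lift ℓ (f y)) x :=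
      ((CP.contMDiffAt_lift (ℓ := ℓ) hi).comp x (hf x)).continuousAt
    have h2 : ContinuousAt (fun y => ‖j (CP.lift ℓ (f y))‖ ^ 2 / ‖Lc (CP.lift ℓ (f y))‖ ^ 2) x :=
      ((j.continuous.continuousAt.comp h1).norm.pow 2).div
        ((Lc.continuous.continuousAt.comp h1).norm.pow 2)
        (pow_ne_zero _ (norm_ne_zero_iff.2 (hLl ℓ x hi)))
    refine h2.congr ?_
    filter_upwards [hf.continuous.continuousAt.preimage_mem_nhds
      ((isOpen_chart_source i).mem_nhds hi)] with y hy using (hu ℓ y hy).symm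
  obtain ⟨x, -, hx⟩ := isCompact_univ.exists_isMaxOn univ_nonempty hcont.continuousOn
  refine ⟨x, ?_⟩
  set w := L (f x).rep with hwdef
  set ℓ : (Fin (N + 1) → ℂ) →ₗ[ℂ] ℂ := (innerSL ℂ w).toLinearMap.comp L with hℓdef
  have hℓ : ∀ v, ℓ v = inner ℂ w (L v) := fun v => rfl
  have hℓx : ℓ (f x).rep ≠ 0 := by
    rw [hℓ]
    exact inner_self_ne_zero.2 (hL x)
  let F : X → Fin (N + 1) → ℂ := CP.lift ℓ ∘ f
  have hF : ContMDiffAt 𝓘(ℂ, EuclideanSpace ℂ (Fin d)) 𝓘(ℂ, Fin (N + 1) → ℂ) ω F x :=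
    (CP.contMDiffAt_lift hℓx).comp x (hf x)
  change Function.Injective (mfderiv 𝓘(ℂ, EuclideanSpace ℂ (Fin d)) 𝓘(ℂ, W) (Lc ∘ F) x)
  refine (injective_iff_map_eq_zero _).2 fun v hv => ?_
  let v' : EuclideanSpace ℂ (Fin d) := v
  -- The holomorphic curve `c` through `x` in the direction `v`, which `F` lifts to homogeneous
  -- coordinates.
  let φ := extChartAt 𝓘(ℂ, EuclideanSpace ℂ (Fin d)) x
  let line : ℂ → EuclideanSpace ℂ (Fin d) := fun t => φ x + t • v'
  let c : ℂ → X := fun t => φ.symm (line t)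
  have hline : ContDiff ℂ ω line := by fun_prop
  have hline0 : line 0 = φ x := by simp [line]
  have hc0 : c 0 = x := by
    simp only [c, hline0]
    exact extChartAt_to_inv x
  have hFφ : ContDiffAt ℂ ω (F ∘ φ.symm) (φ x) := by
    have h1 : ContMDiffAt 𝓘(ℂ, EuclideanSpace ℂ (Fin d)) 𝓘(ℂ, EuclideanSpace ℂ (Fin d)) ω
        φ.symm (φ x) := (contMDiffOn_extChartAt_symm x).contMDiffAt (extChartAt_target_mem_nhds x)
    refine ContMDiffAt.contDiffAt (ContMDiffAt.comp (φ x) ?_ h1)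
    rw [extChartAt_to_inv x]
    exact hF
  let Φ : ℂ → Fin (N + 1) → ℂ := F ∘ c
  have hΦ : ContDiffAt ℂ ω Φ 0 := by
    have h1 : ContDiffAt ℂ ω (F ∘ φ.symm) (line 0) := by rw [hline0]; exact hFφ
    exact h1.comp (0 : ℂ) hline.contDiffAt
  have hcc : ContinuousAt c 0 := by
    have h1 : ContinuousAt φ.symm (line 0) := by
      rw [hline0]; exact continuousAt_extChartAt_symm x
    exact h1.comp hline.continuous.continuousAt
  have hderiv : deriv Φ 0 =
      mfderiv 𝓘(ℂ, EuclideanSpace ℂ (Fin d)) 𝓘(ℂ, Fin (N + 1) → ℂ) F x v := by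
    rw [mfderiv_eq_fderiv_comp_extChartAt_symm (hF.mdifferentiableAt hw)]
    have h2 : DifferentiableAt ℂ (F ∘ φ.symm) (line 0) := by
      rw [hline0]
      exact hFφ.differentiableAt hw
    have h3 : HasDerivAt line v' 0 := by
      simpa [line] using ((hasDerivAt_id (0 : ℂ)).smul_const v').const_add (φ x)
    have h4 := (h2.hasFDerivAt.comp_hasDerivAt (0 : ℂ) h3).deriv
    rw [hline0] at h4
    exact h4
  have hΦd : DifferentiableAt ℂ Φ 0 := hΦ.differentiableAt hw
  have hL0 : deriv (Lc ∘ Φ) 0 = 0 := by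
    rw [mfderiv_comp x Lc.mdifferentiableAt
      (hF.mdifferentiableAt hw), ContinuousLinearMap.mfderiv_eq] at hv
    refine ((Lc.hasFDerivAt.comp_hasDerivAt (0 : ℂ) hΦd.hasDerivAt).deriv).trans ?_
    rw [hderiv]
    exact hv
  have hev : ∀ᶠ t in 𝓝 (0 : ℂ), ℓ (f (c t)).rep ≠ 0 := by
    have h1 : ContinuousAt (f ∘ c) 0 := hf.continuous.continuousAt.comp hcc
    refine h1.preimage_mem_nhds ((CP.isOpen_setOf_apply_rep_ne_zero ℓ).mem_nhds ?_)
    change ℓ (f (c 0)).rep ≠ 0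
    rw [hc0]
    exact hℓx
  -- `L Φ` moves orthogonally to `w`, hence to its initial value.
  have hpyth : ∀ᶠ t in 𝓝 (0 : ℂ), ‖Lc (Φ t)‖ ^ 2 = ‖Lc (Φ 0)‖ ^ 2 + ‖Lc (Φ t) - Lc (Φ 0)‖ ^ 2 := by
    filter_upwards [hev] with t ht
    have h1 : inner ℂ w (Lc (Φ t)) = 1 := CP.apply_lift (ℓ := ℓ) ht
    have h2 : inner ℂ w (Lc (Φ 0)) = 1 := CP.apply_lift (ℓ := ℓ) hev.self_of_nhds
    have h3 : Lc (Φ 0) = (ℓ (f x).rep)⁻¹ • w := by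
      change L (CP.lift ℓ (f (c 0))) = _
      rw [hc0, CP.lift, map_smul]
    have h4 : inner ℂ (Lc (Φ 0)) (Lc (Φ t) - Lc (Φ 0)) = 0 := by
      rw [inner_sub_right]
      conv_lhs => rw [h3]
      rw [inner_smul_left, h1, ← h3, h3, inner_smul_left, ← h3, h2, sub_self]
    have h5 := norm_add_sq_eq_norm_sq_add_norm_sq_of_inner_eq_zero _ _ h4
    rw [add_sub_cancel] at h5
    nlinarith [h5]
  have hquad : (fun t => Lc (Φ t) - Lc (Φ 0)) =O[𝓝 0] fun t : ℂ => ‖t‖ ^ 2 := by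
    have hA : AnalyticAt ℂ (Lc ∘ Φ) 0 := (Lc.contDiff.contDiffAt.comp _ hΦ).analyticAt
    obtain ⟨p, hp⟩ := hA
    have h1 := hp.isBigO_sub_partialSum_pow 2
    have h2 : ∀ t, p.partialSum 2 t = Lc (Φ 0) := fun t => by
      have h3 : p.coeff 1 = 0 := hp.deriv.symm.trans hL0
      have h4 : p.coeff 0 = Lc (Φ 0) := hp.coeff_zero _
      simp [FormalMultilinearSeries.partialSum, Finset.sum_range_succ, h3, h4]
    simpa [h2] using h1
  obtain ⟨K, hK⟩ := hquad.bound
  have hmax : ∀ᶠ t in 𝓝 (0 : ℂ), ‖j (Φ t)‖ ^ 2 ≤ ‖j (Φ 0)‖ ^ 2 + (u x * K ^ 2) * ‖t‖ ^ 4 := by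
    filter_upwards [hev, hpyth, hK] with t ht hpt hKt
    have hu0 : 0 ≤ u x := by positivity
    have h1 : u (c t) ≤ u x := hx (mem_univ _)
    have h2 := hu ℓ (c t) ht
    have h3 := hu ℓ (c 0) hev.self_of_nhds
    have hpos : ∀ t, ℓ (f (c t)).rep ≠ 0 → 0 < ‖Lc (CP.lift ℓ (f (c t)))‖ ^ 2 := fun t ht =>
      pow_pos (norm_pos_iff.2 (hLl ℓ _ ht)) 2
    rw [eq_div_iff (hpos t ht).ne'] at h2
    rw [eq_div_iff (hpos 0 hev.self_of_nhds).ne', hc0] at h3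
    have h4 : ‖j (Φ t)‖ ^ 2 ≤ u x * ‖Lc (Φ t)‖ ^ 2 := by
      change ‖j (CP.lift ℓ (f (c t)))‖ ^ 2 ≤ u x * ‖Lc (CP.lift ℓ (f (c t)))‖ ^ 2
      rw [← h2]
      exact mul_le_mul_of_nonneg_right h1 (hpos t ht).le
    have h5 : u x * ‖Lc (Φ 0)‖ ^ 2 = ‖j (Φ 0)‖ ^ 2 := by
      change u x * ‖Lc (CP.lift ℓ (f (c 0)))‖ ^ 2 = ‖j (CP.lift ℓ (f (c 0)))‖ ^ 2
      rw [hc0, h3]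
    have h6 : ‖Lc (Φ t) - Lc (Φ 0)‖ ^ 2 ≤ K ^ 2 * ‖t‖ ^ 4 := by
      rw [norm_pow, norm_norm] at hKt
      calc ‖Lc (Φ t) - Lc (Φ 0)‖ ^ 2 ≤ (K * ‖t‖ ^ 2) ^ 2 :=
            pow_le_pow_left₀ (norm_nonneg _) hKt 2
        _ = K ^ 2 * ‖t‖ ^ 4 := by ring
    rw [hpt, mul_add, h5] at h4
    calc ‖j (Φ t)‖ ^ 2 ≤ ‖j (Φ 0)‖ ^ 2 + u x * ‖Lc (Φ t) - Lc (Φ 0)‖ ^ 2 := h4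
      _ ≤ ‖j (Φ 0)‖ ^ 2 + u x * (K ^ 2 * ‖t‖ ^ 4) := by gcongr
      _ = _ := by ring
  have hz : deriv (j ∘ Φ) 0 = 0 :=
    deriv_eq_zero_of_norm_sq_le (j.contDiff.contDiffAt.comp _ hΦ).analyticAt hmax
  have hΦ0 : deriv Φ 0 = 0 := by
    rw [(j.hasFDerivAt.comp_hasDerivAt (0 : ℂ) hΦd.hasDerivAt).deriv] at hz
    exact hj (hz.trans (map_zero j).symm)
  rw [hderiv] at hΦ0
  exact injective_mfderiv_lift (hf x) (hinj x) hℓx (hΦ0.trans (map_zero _).symm)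

/-- A linear projection to a projective space of the same dimension is surjective: if it missed a
point, projection from that point would give an immersion at some point of `X` into a space of
smaller dimension. -/
theorem surjective_linearProjection [IsManifold 𝓘(ℂ, EuclideanSpace ℂ (Fin d)) ω X]
    [CompactSpace X] [Nonempty X] {f : X → CP N}
    (hf : ContMDiff 𝓘(ℂ, EuclideanSpace ℂ (Fin d)) 𝓘(ℂ, EuclideanSpace ℂ (Fin N)) ω f)
    (hinj : ∀ x, Function.Injective
      (mfderiv 𝓘(ℂ, EuclideanSpace ℂ (Fin d)) 𝓘(ℂ, EuclideanSpace ℂ (Fin N)) f x))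
    (L : (Fin (N + 1) → ℂ) →ₗ[ℂ] (Fin (d + 1) → ℂ)) (hL : ∀ x, L (f x).rep ≠ 0) :
    Function.Surjective fun x => Projectivization.mk ℂ (L (f x).rep) (hL x) := by
  have hw : (ω : WithTop ℕ∞) ≠ 0 := by simp
  intro p
  by_contra! hp
  obtain ⟨π, -, -, hπk⟩ := exists_linearMap_ker_eq_span p.rep_nonzero
  let e : (Fin d → ℂ) ≃L[ℂ] EuclideanSpace ℂ (Fin d) := (EuclideanSpace.equiv (Fin d) ℂ).symm
  let L' : (Fin (N + 1) → ℂ) →ₗ[ℂ] EuclideanSpace ℂ (Fin d) :=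
    e.toLinearMap.comp (π.comp L)
  have hL' : ∀ x, L' (f x).rep ≠ 0 := by
    intro x hx
    have h1 : π (L (f x).rep) = 0 := e.injective (hx.trans (map_zero e).symm)
    obtain ⟨a, ha⟩ := hπk _ h1
    refine hp x ?_
    conv_rhs => rw [← p.mk_rep]
    exact (CP.mk_eq_mk_of_smul _ _ a ha).symm
  obtain ⟨x, hx⟩ := exists_injective_mfderiv_linearProjection hf hinj L' hL'
  set w := L' (f x).rep
  set ℓ : (Fin (N + 1) → ℂ) →ₗ[ℂ] ℂ := (innerSL ℂ w).toLinearMap.comp L'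
  set G : X → EuclideanSpace ℂ (Fin d) := fun y => L' (CP.lift ℓ (f y)) with hG
  have hℓx : ℓ (f x).rep ≠ 0 := by
    change inner ℂ w w ≠ 0
    exact inner_self_ne_zero.2 (hL' x)
  have hGx : MDifferentiableAt 𝓘(ℂ, EuclideanSpace ℂ (Fin d)) 𝓘(ℂ, EuclideanSpace ℂ (Fin d)) G x :=
    ContMDiffAt.mdifferentiableAt ((LinearMap.toContinuousLinearMap L').contMDiff.contMDiffAt.comp x
      ((CP.contMDiffAt_lift hℓx).comp x (hf x))) hw
  let D : EuclideanSpace ℂ (Fin d) →L[ℂ] EuclideanSpace ℂ (Fin d) :=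
    mfderiv 𝓘(ℂ, EuclideanSpace ℂ (Fin d)) 𝓘(ℂ, EuclideanSpace ℂ (Fin d)) G x
  have hD : Function.Surjective D := (LinearMap.injective_iff_surjective (f := D.toLinearMap)).1 hx
  -- The image of the differential is orthogonal to `w`.
  have h1 : (innerSL ℂ w) ∘ G =ᶠ[𝓝 x] fun _ => (1 : ℂ) := by
    filter_upwards [hf.continuous.continuousAt.preimage_mem_nhds
      ((CP.isOpen_setOf_apply_rep_ne_zero ℓ).mem_nhds hℓx)] with y hy using CP.apply_lift hy
  have h2 := mfderiv_comp x (innerSL ℂ w).mdifferentiableAt hGx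
  rw [h1.mfderiv_eq, mfderiv_const, ContinuousLinearMap.mfderiv_eq] at h2
  obtain ⟨v, hv⟩ := hD w
  have h3 : inner ℂ w (D v) = 0 := (congrArg (fun T => T v) h2).symm
  rw [hv] at h3
  exact hL' x (inner_self_eq_zero.1 h3)

/-- A linear projection of an immersed compact manifold is an immersion at some point. -/
theorem exists_injective_mfderiv_mk [IsManifold 𝓘(ℂ, EuclideanSpace ℂ (Fin d)) ω X]
    [CompactSpace X] [Nonempty X] {f : X → CP N}
    (hf : ContMDiff 𝓘(ℂ, EuclideanSpace ℂ (Fin d)) 𝓘(ℂ, EuclideanSpace ℂ (Fin N)) ω f)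
    (hinj : ∀ x, Function.Injective
      (mfderiv 𝓘(ℂ, EuclideanSpace ℂ (Fin d)) 𝓘(ℂ, EuclideanSpace ℂ (Fin N)) f x))
    {m : ℕ} (L : (Fin (N + 1) → ℂ) →ₗ[ℂ] (Fin (m + 1) → ℂ)) (hL : ∀ x, L (f x).rep ≠ 0) :
    ∃ x, Function.Injective
      (mfderiv 𝓘(ℂ, EuclideanSpace ℂ (Fin d)) 𝓘(ℂ, EuclideanSpace ℂ (Fin m))
        (fun x => Projectivization.mk ℂ (L (f x).rep) (hL x)) x) := by
  have hw : (ω : WithTop ℕ∞) ≠ 0 := by simp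
  let e : (Fin (m + 1) → ℂ) ≃L[ℂ] EuclideanSpace ℂ (Fin (m + 1)) :=
    (EuclideanSpace.equiv (Fin (m + 1)) ℂ).symm
  let L' : (Fin (N + 1) → ℂ) →ₗ[ℂ] EuclideanSpace ℂ (Fin (m + 1)) := e.toLinearMap.comp L
  have hL' : ∀ x, L' (f x).rep ≠ 0 := fun x hx =>
    hL x (e.injective (hx.trans (map_zero e).symm))
  obtain ⟨x, hx⟩ := exists_injective_mfderiv_linearProjection hf hinj L' hL'
  refine ⟨x, ?_⟩
  set γ : X → CP m := fun x => Projectivization.mk ℂ (L (f x).rep) (hL x)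
  have hγ : ContMDiff 𝓘(ℂ, EuclideanSpace ℂ (Fin d)) 𝓘(ℂ, EuclideanSpace ℂ (Fin m)) ω γ :=
    CP.contMDiff_linearProjection hf L hL
  let ℓ : (Fin (m + 1) → ℂ) →ₗ[ℂ] ℂ := (innerSL ℂ (L' (f x).rep)).toLinearMap.comp e.toLinearMap
  have hG : (fun y => L' (CP.lift ((innerSL ℂ (L' (f x).rep)).toLinearMap.comp L') (f y))) =
      (fun v => e (CP.lift ℓ v)) ∘ γ := by
    funext y
    simp only [Function.comp, γ, CP.lift_mk]
    rw [CP.lift, map_smul, map_smul]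
    rfl
  have hℓ : ℓ (γ x).rep ≠ 0 := by
    obtain ⟨a, ha, h⟩ := CP.exists_rep_eq_smul (L (f x).rep) (hL x)
    change ℓ (Projectivization.mk ℂ (L (f x).rep) (hL x)).rep ≠ 0
    rw [h, map_smul]
    refine smul_ne_zero ha ?_
    exact (inner_self_ne_zero (𝕜 := ℂ)).2 (hL' x)
  have h1 : ContMDiffAt 𝓘(ℂ, EuclideanSpace ℂ (Fin m)) 𝓘(ℂ, EuclideanSpace ℂ (Fin (m + 1))) ω
      (fun v => e (CP.lift ℓ v)) (γ x) :=
    (e : (Fin (m + 1) → ℂ) →L[ℂ] EuclideanSpace ℂ (Fin (m + 1))).contMDiff.contMDiffAt.comp _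
      (CP.contMDiffAt_lift hℓ)
  rw [hG, mfderiv_comp x (h1.mdifferentiableAt hw) ((hγ x).mdifferentiableAt hw)] at hx
  exact Function.Injective.of_comp hx

/-- An embedded compact complex manifold has a finite surjective linear projection to the projective
space of its dimension, and this projection is an immersion somewhere. -/
theorem exists_finite_surjective_linearProjection
    [IsManifold 𝓘(ℂ, EuclideanSpace ℂ (Fin d)) ω X]
    [CompactSpace X] [Nonempty X] {f : X → CP N}
    (hf : Manifold.IsSmoothEmbedding 𝓘(ℂ, EuclideanSpace ℂ (Fin d))
      𝓘(ℂ, EuclideanSpace ℂ (Fin N)) ω f) :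
    ∃ γ : X → CP d,
      ContMDiff 𝓘(ℂ, EuclideanSpace ℂ (Fin d)) 𝓘(ℂ, EuclideanSpace ℂ (Fin d)) ω γ ∧
      IsLinearProjectionOf γ f ∧ IsFiniteMap γ ∧ Function.Surjective γ ∧
      ∃ x, Function.Injective
        (mfderiv 𝓘(ℂ, EuclideanSpace ℂ (Fin d)) 𝓘(ℂ, EuclideanSpace ℂ (Fin d)) γ x) := by
  have hinj := injective_mfderiv_of_isImmersion hf.isImmersion
  have hdN : d ≤ N := by
    obtain ⟨x⟩ := ‹Nonempty X›
    let D : EuclideanSpace ℂ (Fin d) →L[ℂ] EuclideanSpace ℂ (Fin N) :=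
      mfderiv 𝓘(ℂ, EuclideanSpace ℂ (Fin d)) 𝓘(ℂ, EuclideanSpace ℂ (Fin N)) f x
    have := LinearMap.finrank_le_finrank_of_injective (f := D.toLinearMap) (hinj x)
    simpa using this
  obtain ⟨L, hL, hfin⟩ := exists_linearProjection_finite_fibres hf.contMDiff hf.isEmbedding.injective
    le_rfl hdN
  have hγ := CP.contMDiff_linearProjection hf.contMDiff L hL
  exact ⟨_, hγ, ⟨L, fun x => ⟨hL x, rfl⟩⟩, ⟨hγ.continuous.isProperMap, hfin⟩,
    surjective_linearProjection hf.contMDiff hinj L hL,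
    exists_injective_mfderiv_mk hf.contMDiff hinj L hL⟩

end

/-! ### The Maurer-Cartan form of `PGL(d + 1, ℂ)` -/

section

variable {E H M E' H' M' E'' H'' M'' : Type*} [NormedAddCommGroup E] [NormedSpace ℂ E]
  [TopologicalSpace H] {I : ModelWithCorners ℂ E H} [TopologicalSpace M] [ChartedSpace H M]
  [NormedAddCommGroup E'] [NormedSpace ℂ E'] [TopologicalSpace H'] {J : ModelWithCorners ℂ E' H'}
  [TopologicalSpace M'] [ChartedSpace H' M'] [NormedAddCommGroup E''] [NormedSpace ℂ E'']
  [TopologicalSpace H''] {K : ModelWithCorners ℂ E'' H''} [TopologicalSpace M'']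
  [ChartedSpace H'' M'']

variable (I J) in
/-- The differential of a map between manifolds as a linear map between the model vector spaces,
the tangent spaces being identified with these through the preferred charts. -/
def modelDeriv (g : M → M') (x : M) : E →L[ℂ] E' := mfderiv I J g x

theorem modelDeriv_eq_fderiv_writtenInExtChartAt [I.Boundaryless] {g : M → M'} {x : M}
    (hg : MDifferentiableAt I J g x) :
    modelDeriv I J g x = fderiv ℂ (writtenInExtChartAt I J x g) (extChartAt I x x) := by
  simp only [modelDeriv, mfderiv, hg, I.range_eq_univ, fderivWithin_univ]
  rfl

theorem modelDeriv_eq_fderiv {g : E → E'} {x : E} :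
    modelDeriv 𝓘(ℂ, E) 𝓘(ℂ, E') g x = fderiv ℂ g x := mfderiv_eq_fderiv

theorem modelDeriv_comp {g : M' → M''} {f : M → M'} {x : M} (hg : MDifferentiableAt J K g (f x))
    (hf : MDifferentiableAt I J f x) :
    modelDeriv I K (g ∘ f) x = (modelDeriv J K g (f x)).comp (modelDeriv I J f x) :=
  mfderiv_comp x hg hf

theorem modelDeriv_congr {g g' : M → M'} {x : M} (h : g =ᶠ[𝓝 x] g') :
    modelDeriv I J g x = modelDeriv I J g' x := h.mfderiv_eq

end

theorem traceFree_incl {d : ℕ} (Y : Sl d) : traceFree d (Sl.incl d Y) = Y := by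
  refine Sl.incl_injective d ?_
  rw [traceFree_coe, Y.ntrace_incl, zero_smul, sub_zero]

theorem traceFree_one (d : ℕ) : traceFree d 1 = 0 := by
  refine Sl.incl_injective d ?_
  rw [traceFree_coe, ntrace_one, one_smul, sub_self, map_zero]

theorem hasFDerivAt_slCoord_one (d : ℕ) :
    HasFDerivAt (slCoord : Mat d → Sl d) (traceFree d) 1 := by
  have h0 : ntrace d (1 : Mat d) ≠ 0 := by rw [ntrace_one]; exact one_ne_zero
  have h1 : HasFDerivAt (fun M : Mat d => (ntrace d M)⁻¹)
      (-(ntrace d)) 1 := by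
    have h2 := (hasFDerivAt_inv h0).comp (1 : Mat d) (ntrace d).hasFDerivAt
    refine h2.congr_fderiv ?_
    ext M
    simp [ntrace_one]
  refine ((traceFree d).hasFDerivAt.comp (1 : Mat d) (h1.smul (hasFDerivAt_id (1 : Mat d)))).congr_fderiv ?_
  ext M
  simp [ntrace_one, traceFree_one]

/-- In the preferred charts, which are left translates of each other, left translations are the
identity. -/
theorem modelDeriv_mul_left {d : ℕ} (h g : PG d) :
    modelDeriv 𝓘(ℂ, Sl d) 𝓘(ℂ, Sl d) (fun x : PG d => h * x) g = ContinuousLinearMap.id ℂ (Sl d) := by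
  have hd : MDifferentiableAt 𝓘(ℂ, Sl d) 𝓘(ℂ, Sl d) (fun x : PG d => h * x) g :=
    (contMDiff_mul_left (I := 𝓘(ℂ, Sl d)) (n := ω) (a := h)).contMDiffAt.mdifferentiableAt (by simp)
  have h1 : writtenInExtChartAt 𝓘(ℂ, Sl d) 𝓘(ℂ, Sl d) g (fun x : PG d => h * x) =ᶠ[
      𝓝 (extChartAt 𝓘(ℂ, Sl d) g g)] id := by
    have ht : (PG.chart g).target ∈ 𝓝 (extChartAt 𝓘(ℂ, Sl d) g g) :=
      (PG.chart g).open_target.mem_nhds ((PG.chart g).map_source (PG.mem_chart_self g))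
    filter_upwards [ht] with z hz
    change PG.chart (h * g) (h * (PG.chart g).symm z) = z
    have hr : PG.chart g ((PG.chart g).symm z) = z := (PG.chart g).right_inv hz
    rw [PG.chart_apply] at hr ⊢
    rwa [mul_inv_rev, mul_assoc, inv_mul_cancel_left]
  rw [modelDeriv_eq_fderiv_writtenInExtChartAt hd, h1.fderiv_eq, fderiv_id]

/-- In the preferred charts, the Maurer-Cartan form is the identity. -/
theorem maurerCartan_apply {d : ℕ} (g : PG d) (v : Sl d) :
    (maurerCartan (Sl d) g v : Sl d) = v :=
  congrArg (fun T => T v) (modelDeriv_mul_left g⁻¹ g)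

theorem mulInvariantVectorField_apply {d : ℕ} (v : Sl d) (g : PG d) :
    (mulInvariantVectorField (I := 𝓘(ℂ, Sl d)) (v : GroupLieAlgebra 𝓘(ℂ, Sl d) (PG d)) g : Sl d) =
      v :=
  congrArg (fun T => T v) (modelDeriv_mul_left g 1)

/-- In the preferred charts, the differential of `GL → PGL` is the trace-free part of `A⁻¹ dA`. -/
theorem modelDeriv_ofMat {d : ℕ} {A : Mat d} (hA : IsUnit A) (B : Mat d) :
    modelDeriv 𝓘(ℂ, Mat d) 𝓘(ℂ, Sl d) PG.ofMat A B = traceFree d (Ring.inverse A * B) := by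
  have hd : MDifferentiableAt 𝓘(ℂ, Mat d) 𝓘(ℂ, Sl d) PG.ofMat A :=
    (PG.contMDiffAt_ofMat hA).mdifferentiableAt (by simp)
  have h1 : writtenInExtChartAt 𝓘(ℂ, Mat d) 𝓘(ℂ, Sl d) A PG.ofMat =ᶠ[𝓝 A]
      fun B => slCoord (Ring.inverse A * B) := by
    have hu : IsOpen {M : Mat d | IsUnit M} := Units.isOpen
    filter_upwards [hu.mem_nhds hA] with B hB
    change PG.chart (PG.ofMat A) (PG.ofMat B) = _
    obtain ⟨u, rfl⟩ := hA
    rw [PG.chart_apply, Ring.inverse_unit, PG.ofMat_coe, ← map_inv, ← PG.ofMat_coe,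
      ← PG.ofMat_mul (Units.isUnit _) hB, slCoord_rep_ofMat ((Units.isUnit _).mul hB)]
  have h2 : HasFDerivAt (fun B => slCoord (Ring.inverse A * B))
      ((traceFree d).comp (ContinuousLinearMap.mul ℂ (Mat d) (Ring.inverse A))) A := by
    have h3 : HasFDerivAt (slCoord : Mat d → Sl d) (traceFree d) (Ring.inverse A * A) := by
      rw [Ring.inverse_mul_cancel _ hA]
      exact hasFDerivAt_slCoord_one d
    exact h3.comp A (ContinuousLinearMap.mul ℂ (Mat d) (Ring.inverse A)).hasFDerivAt
  rw [modelDeriv_eq_fderiv_writtenInExtChartAt hd, extChartAt_model_space_eq_id,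
    PartialEquiv.refl_coe, id, h1.fderiv_eq, h2.fderiv]
  rfl

section

variable {E H M : Type*} [NormedAddCommGroup E] [NormedSpace ℂ E] [TopologicalSpace H]
  {I : ModelWithCorners ℂ E H} [TopologicalSpace M] [ChartedSpace H M]

/-- The pullback of the Maurer-Cartan form by a map with a local matrix representative `A` is the
trace-free part of `A⁻¹ dA`. -/
theorem modelDeriv_apply_of_eventuallyEq_ofMat {d : ℕ} {η : M → PG d} {A : M → Mat d} {x : M}
    (hA : MDifferentiableAt I 𝓘(ℂ, Mat d) A x) (hu : IsUnit (A x))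
    (h : η =ᶠ[𝓝 x] PG.ofMat ∘ A) (v : E) :
    modelDeriv I 𝓘(ℂ, Sl d) η x v =
      traceFree d (Ring.inverse (A x) * modelDeriv I 𝓘(ℂ, Mat d) A x v) := by
  rw [modelDeriv_congr h,
    modelDeriv_comp ((PG.contMDiffAt_ofMat hu).mdifferentiableAt (by simp)) hA]
  exact modelDeriv_ofMat hu _

/-- The differential of a holomorphic map to a vector space is holomorphic on the tangent bundle. -/
theorem contMDiffAt_modelDeriv_apply [IsManifold I ω M] {F : Type*} [NormedAddCommGroup F]
    [NormedSpace ℂ F] {g : M → F} {s : Set M} (hs : IsOpen s) (hg : ContMDiffOn I 𝓘(ℂ, F) ω g s)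
    {v₀ : TangentBundle I M} (hv₀ : v₀.proj ∈ s) :
    ContMDiffAt I.tangent 𝓘(ℂ, F) ω
      (fun v : TangentBundle I M => modelDeriv I 𝓘(ℂ, F) g v.proj v.2) v₀ := by
  have h1 : ContMDiffOn I.tangent 𝓘(ℂ, F).tangent ω (tangentMapWithin I 𝓘(ℂ, F) g s)
      (Bundle.TotalSpace.proj ⁻¹' s) :=
    hg.contMDiffOn_tangentMapWithin (by simp) hs.uniqueMDiffOn
  have hs' : IsOpen (Bundle.TotalSpace.proj ⁻¹' s : Set (TangentBundle I M)) :=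
    hs.preimage (FiberBundle.continuous_proj E (TangentSpace I))
  have h2 := (contMDiff_snd_tangentBundle_modelSpace (n := ω) F 𝓘(ℂ, F)).contMDiffAt.comp v₀
    (h1.contMDiffAt (hs'.mem_nhds hv₀))
  refine h2.congr_of_eventuallyEq ?_
  filter_upwards [hs'.mem_nhds hv₀] with v hv
  simp only [Function.comp, tangentMapWithin]
  rw [mfderivWithin_of_isOpen hs hv]
  rfl

/-- The pullback of the Maurer-Cartan form by a holomorphic map is holomorphic. -/
theorem contMDiff_modelDeriv_apply [IsManifold I ω M] {d : ℕ} {η : M → PG d}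
    (hη : ContMDiff I 𝓘(ℂ, Sl d) ω η) :
    ContMDiff I.tangent 𝓘(ℂ, Sl d) ω
      (fun v : TangentBundle I M => modelDeriv I 𝓘(ℂ, Sl d) η v.proj v.2) := by
  intro v₀
  set a := η v₀.proj
  let s : Set M := η ⁻¹' (PG.chart a).source
  have hs : IsOpen s := (PG.chart a).open_source.preimage hη.continuous
  have hv₀ : v₀.proj ∈ s := PG.mem_chart_self a
  let A : M → Mat d := fun x => PG.localRep a (η x)
  have hA : ContMDiffOn I 𝓘(ℂ, Mat d) ω A s := by
    have h1 : ContMDiffOn 𝓘(ℂ, Sl d) 𝓘(ℂ, Sl d) ω (PG.chart a) (PG.chart a).source :=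
      contMDiffOn_of_mem_maximalAtlas (IsManifold.chart_mem_maximalAtlas a)
    have h2 : ContDiff ℂ ω fun Y : Sl d => ((PG.rep a) : Mat d) * (1 + Sl.incl d Y) :=
      contDiff_const.mul (contDiff_one_add d)
    exact h2.contMDiff.comp_contMDiffOn (h1.comp hη.contMDiffOn fun x hx => hx)
  have hAu : ∀ x ∈ s, IsUnit (A x) := fun x hx => PG.isUnit_localRep hx
  have hs' : IsOpen (Bundle.TotalSpace.proj ⁻¹' s : Set (TangentBundle I M)) :=
    hs.preimage (FiberBundle.continuous_proj E (TangentSpace I))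
  have h1 : ContMDiffAt I.tangent 𝓘(ℂ, Mat d) ω
      (fun v : TangentBundle I M => A v.proj) v₀ :=
    (hA.contMDiffAt (hs.mem_nhds hv₀)).comp v₀ (Bundle.contMDiff_proj (TangentSpace I) v₀)
  have h2 : ContMDiffAt I.tangent 𝓘(ℂ, Mat d) ω
      (fun v : TangentBundle I M => Ring.inverse (A v.proj)) v₀ := by
    obtain ⟨u, hu⟩ := hAu _ hv₀
    have h3 : ContDiffAt ℂ ω Ring.inverse (A v₀.proj) := by
      rw [← hu]; exact contDiffAt_ringInverse ℂ u
    exact h3.contMDiffAt.comp v₀ h1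
  have hm : ContDiff ℂ ω fun z : Mat d × Mat d => traceFree d (z.1 * z.2) :=
    (traceFree d).contDiff.comp contDiff_mul
  have h3 := hm.contMDiff.contMDiffAt.comp v₀
    (h2.prodMk_space (contMDiffAt_modelDeriv_apply hs hA hv₀))
  refine h3.congr_of_eventuallyEq ?_
  filter_upwards [hs'.mem_nhds hv₀] with v hv
  refine modelDeriv_apply_of_eventuallyEq_ofMat
    ((hA.contMDiffAt (hs.mem_nhds hv)).mdifferentiableAt (by simp)) (hAu _ hv) ?_ v.2
  filter_upwards [hs.mem_nhds hv] with x hx using (PG.ofMat_localRep hx).symm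

end

/-- The left-invariant vector field with value `a` at the identity, in the chart around the
identity. -/
def leftInvariantFieldInChart {d : ℕ} (a z : Sl d) : Sl d :=
  VectorField.mpullbackWithin 𝓘(ℂ, Sl d) 𝓘(ℂ, Sl d) (extChartAt 𝓘(ℂ, Sl d) (1 : PG d)).symm
    (mulInvariantVectorField (I := 𝓘(ℂ, Sl d)) (a : GroupLieAlgebra 𝓘(ℂ, Sl d) (PG d)))
    (range 𝓘(ℂ, Sl d)) z

/-- In the chart `z ↦ [1 + z]`, the left-invariant field with value `a` at the identity is obtained
from `(1 + z) a` by rescaling the representative `1 + z` so as to keep its trace constant. -/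
theorem leftInvariantFieldInChart_eq {d : ℕ} (a : Sl d) {z : Sl d}
    (hz : IsUnit (1 + Sl.incl d z)) :
    leftInvariantFieldInChart a z =
      a + traceFree d (Sl.incl d z * Sl.incl d a) - ntrace d (Sl.incl d z * Sl.incl d a) • z := by
  have hzt : z ∈ (extChartAt 𝓘(ℂ, Sl d) (1 : PG d)).target := by
    rw [extChartAt_target]
    simpa using! (PG.mem_chart_target (1 : PG d) z).2 hz
  have hinv := isInvertible_mfderivWithin_extChartAt_symm (I := 𝓘(ℂ, Sl d)) hzt
  rw [leftInvariantFieldInChart, VectorField.mpullbackWithin_apply]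
  obtain ⟨e, he⟩ := hinv
  rw [← he, ContinuousLinearMap.inverse_equiv]
  refine (ContinuousLinearEquiv.symm_apply_eq e).2 ?_
  refine (mulInvariantVectorField_apply a _).trans ?_
  set b : Sl d := a + traceFree d (Sl.incl d z * Sl.incl d a) -
    ntrace d (Sl.incl d z * Sl.incl d a) • z with hb
  have h1 : (e b : Sl d) = mfderivWithin 𝓘(ℂ, Sl d) 𝓘(ℂ, Sl d)
      (extChartAt 𝓘(ℂ, Sl d) (1 : PG d)).symm (range 𝓘(ℂ, Sl d)) z b :=
    congrArg (fun T => T b) he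
  refine Eq.trans ?_ h1.symm
  have hA : HasFDerivAt (fun Y : Sl d => 1 + Sl.incl d Y) (Sl.incl d) z :=
    (Sl.incl d).hasFDerivAt.const_add 1
  have h2 : (extChartAt 𝓘(ℂ, Sl d) (1 : PG d)).symm =ᶠ[𝓝 z]
      PG.ofMat ∘ fun Y : Sl d => 1 + Sl.incl d Y := by
    refine Eventually.of_forall fun Y => ?_
    change (PG.chart (1 : PG d)).symm Y = _
    rw [PG.chart_symm_apply, one_mul]
    rfl
  have h3 := modelDeriv_apply_of_eventuallyEq_ofMat (I := 𝓘(ℂ, Sl d)) (x := z)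
    hA.differentiableAt.mdifferentiableAt hz h2 b
  rw [modelDeriv_eq_fderiv, hA.fderiv] at h3
  rw [modelWithCornersSelf_coe, range_id, mfderivWithin_univ]
  refine Eq.trans ?_ h3.symm
  have h4 : (Sl.incl d b : Mat d) = (1 + Sl.incl d z) *
      (Sl.incl d a - ntrace d (Sl.incl d z * Sl.incl d a) • (1 : Mat d)) := by
    rw [hb, map_sub, map_add, map_smul, traceFree_coe, mul_sub, add_mul, one_mul, mul_smul_comm,
      mul_one, smul_add]
    abel
  refine Eq.trans ?_ (congrArg (fun T => traceFree d (Ring.inverse (1 + Sl.incl d z) * T)) h4.symm)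
  rw [Ring.inverse_mul_cancel_left _ _ hz, map_sub, map_smul, traceFree_incl, traceFree_one,
    smul_zero, sub_zero]

/-- The Lie bracket of `PGL(d + 1, ℂ)` is the commutator of trace-free matrices. -/
theorem groupLieAlgebra_bracket {d : ℕ} (a b : Sl d) :
    (Bracket.bracket (L := GroupLieAlgebra 𝓘(ℂ, Sl d) (PG d))
      (M := GroupLieAlgebra 𝓘(ℂ, Sl d) (PG d)) a b : Sl d) =
      traceFree d (Sl.incl d a * Sl.incl d b - Sl.incl d b * Sl.incl d a) := by
  have hc : extChartAt 𝓘(ℂ, Sl d) (1 : PG d) 1 = 0 := by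
    change PG.chart (1 : PG d) 1 = 0
    rw [PG.chart_apply, inv_one, one_mul, ← PG.ofMat_one, slCoord_rep_ofMat isUnit_one]
    have := slCoord_one_add (0 : Sl d)
    rwa [map_zero, add_zero] at this
  have hX : ∀ a : Sl d, HasFDerivAt (leftInvariantFieldInChart a)
      ((traceFree d).comp (((ContinuousLinearMap.mul ℂ (Mat d)).flip (Sl.incl d a)).comp
        (Sl.incl d))) 0 := by
    intro a
    let T : Sl d →L[ℂ] Mat d := ((ContinuousLinearMap.mul ℂ (Mat d)).flip (Sl.incl d a)).comp
      (Sl.incl d)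
    have h1 : HasFDerivAt (fun z : Sl d => a + traceFree d (T z) - ntrace d (T z) • z)
        ((traceFree d).comp T) 0 := by
      refine ((((traceFree d).comp T).hasFDerivAt.const_add a).sub
        (((ntrace d).comp T).hasFDerivAt.smul (hasFDerivAt_id (0 : Sl d)))).congr_fderiv ?_
      ext z
      simp
    refine h1.congr_of_eventuallyEq ?_
    have h0 : (0 : Sl d) ∈ {Y : Sl d | IsUnit (1 + Sl.incl d Y)} := by simp
    filter_upwards [(isOpen_unit_one_add d).mem_nhds h0] with z hz
    exact leftInvariantFieldInChart_eq a hz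
  have hX0 : ∀ a : Sl d, leftInvariantFieldInChart a 0 = a := by
    intro a
    rw [leftInvariantFieldInChart_eq a (by simp)]
    simp
  have hid : modelDeriv 𝓘(ℂ, Sl d) 𝓘(ℂ, Sl d) (extChartAt 𝓘(ℂ, Sl d) (1 : PG d)) 1 =
      ContinuousLinearMap.id ℂ (Sl d) := by
    rw [modelDeriv_eq_fderiv_writtenInExtChartAt
      (mdifferentiableAt_extChartAt (mem_chart_source _ _))]
    have h1 : writtenInExtChartAt 𝓘(ℂ, Sl d) 𝓘(ℂ, Sl d) (1 : PG d)
        (extChartAt 𝓘(ℂ, Sl d) (1 : PG d)) =ᶠ[𝓝 (extChartAt 𝓘(ℂ, Sl d) (1 : PG d) 1)] id := by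
      filter_upwards [extChartAt_target_mem_nhds (I := 𝓘(ℂ, Sl d)) (1 : PG d)] with z hz
      exact (extChartAt 𝓘(ℂ, Sl d) (1 : PG d)).right_inv hz
    rw [h1.fderiv_eq, fderiv_id]
  change (modelDeriv 𝓘(ℂ, Sl d) 𝓘(ℂ, Sl d) (extChartAt 𝓘(ℂ, Sl d) (1 : PG d)) 1).inverse
    (VectorField.lieBracketWithin ℂ (leftInvariantFieldInChart a) (leftInvariantFieldInChart b)
      ((extChartAt 𝓘(ℂ, Sl d) (1 : PG d)).symm ⁻¹' univ ∩ range 𝓘(ℂ, Sl d))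
      (extChartAt 𝓘(ℂ, Sl d) (1 : PG d) 1)) = _
  rw [hid, ContinuousLinearMap.inverse_id, hc, modelWithCornersSelf_coe, range_id, preimage_univ,
    univ_inter, VectorField.lieBracketWithin_univ, VectorField.lieBracket, (hX a).fderiv,
    (hX b).fderiv, hX0, hX0]
  exact (map_sub (traceFree d) _ _).symm

/-- The Maurer-Cartan equation for the form `A⁻¹ dA`, up to scalar matrices. -/
theorem fderiv_inverse_mul_fderiv {d : ℕ} {E : Type*} [NormedAddCommGroup E] [NormedSpace ℂ E]
    {A : E → Mat d} {y : E} (hA : ContDiffAt ℂ ω A y) (hu : IsUnit (A y))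
    {θ : E → E →L[ℂ] Sl d}
    (hθ : ∀ᶠ z in 𝓝 y, ∀ v, θ z v = traceFree d (Ring.inverse (A z) * fderiv ℂ A z v)) (u v : E) :
    (fderiv ℂ θ y u v - fderiv ℂ θ y v u : Sl d) +
      traceFree d (Sl.incl d (θ y u) * Sl.incl d (θ y v) - Sl.incl d (θ y v) * Sl.incl d (θ y u)) =
      0 := by
  have hw : (ω : WithTop ℕ∞) ≠ 0 := by simp
  have hA1 : HasFDerivAt A (fderiv ℂ A y) y := (hA.differentiableAt hw).hasFDerivAt
  have hA2 : DifferentiableAt ℂ (fderiv ℂ A) y :=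
    (hA.fderiv_right (m := ω) (by simp)).differentiableAt hw
  have hsymm : IsSymmSndFDerivAt ℂ A y := hA.isSymmSndFDerivAt (by simp)
  have hinv : HasFDerivAt (fun z => Ring.inverse (A z)) (-(ContinuousLinearMap.mulLeftRight ℂ (Mat d)
      (Ring.inverse (A y)) (Ring.inverse (A y))).comp (fderiv ℂ A y)) y := by
    obtain ⟨w, hw⟩ := hu
    have h1 := hasFDerivAt_ringInverse (𝕜 := ℂ) w
    rw [hw] at h1
    have h2 := h1.comp y hA1
    have h3 : Ring.inverse (A y) = ((w⁻¹ : (Mat d)ˣ) : Mat d) := by rw [← hw, Ring.inverse_unit]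
    rw [h3]
    exact h2
  have hθd : DifferentiableAt ℂ θ y := by
    have h1 : DifferentiableAt ℂ (fun z => (traceFree d).comp
        ((ContinuousLinearMap.mul ℂ (Mat d) (Ring.inverse (A z))).comp (fderiv ℂ A z))) y :=
      (differentiableAt_const _).clm_comp
        (((ContinuousLinearMap.mul ℂ (Mat d)).differentiableAt.comp y
          hinv.differentiableAt).clm_comp hA2)
    refine h1.congr_of_eventuallyEq ?_
    filter_upwards [hθ] with z hz
    ext v
    exact hz v
  have key : ∀ u v, fderiv ℂ θ y u v = traceFree d (-(Ring.inverse (A y) * fderiv ℂ A y u *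
      (Ring.inverse (A y) * fderiv ℂ A y v)) +
        Ring.inverse (A y) * fderiv ℂ (fderiv ℂ A) y u v) := by
    intro u v
    have h1 : HasFDerivAt (fun z => θ z v) ((ContinuousLinearMap.apply ℂ (Sl d) v).comp
        (fderiv ℂ θ y)) y :=
      (ContinuousLinearMap.apply ℂ (Sl d) v).hasFDerivAt.comp y hθd.hasFDerivAt
    have h2 : HasFDerivAt (fun z => fderiv ℂ A z v) ((ContinuousLinearMap.apply ℂ (Mat d) v).comp
        (fderiv ℂ (fderiv ℂ A) y)) y :=
      (ContinuousLinearMap.apply ℂ (Mat d) v).hasFDerivAt.comp y hA2.hasFDerivAt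
    have h3 := (traceFree d).hasFDerivAt.comp y (hinv.mul' h2)
    have h4 : (fun z => θ z v) =ᶠ[𝓝 y]
        fun z => traceFree d (Ring.inverse (A z) * fderiv ℂ A z v) := by
      filter_upwards [hθ] with z hz using hz v
    have h5 := (h1.unique (h3.congr_of_eventuallyEq h4))
    have h6 := congrArg (fun T => T u) h5
    refine h6.trans ?_
    simp [ContinuousLinearMap.mulLeftRight_apply, mul_assoc, add_comm]
  rw [key, key, hsymm.eq v u, hθ.self_of_nhds, hθ.self_of_nhds]
  set P := Ring.inverse (A y) * fderiv ℂ A y u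
  set R := Ring.inverse (A y) * fderiv ℂ A y v
  rw [← map_sub, ← map_add, traceFree_coe, traceFree_coe]
  have : -(P * R) + Ring.inverse (A y) * fderiv ℂ (fderiv ℂ A) y u v -
      (-(R * P) + Ring.inverse (A y) * fderiv ℂ (fderiv ℂ A) y u v) +
      ((P - ntrace d P • 1) * (R - ntrace d R • 1) - (R - ntrace d R • 1) * (P - ntrace d P • 1)) =
      0 := by
    simp only [sub_mul, mul_sub, smul_mul_assoc, mul_smul_comm, one_mul, mul_one, smul_sub,
      smul_smul, mul_comm (ntrace d R)]
    abel
  rw [this, map_zero]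

/-! ### The orbit map of `PGL(d + 1, ℂ)` and its local sections -/

/-- A matrix acting on homogeneous coordinates. -/
def Mat.mulVecLin {d : ℕ} (M : Mat d) : (Fin (d + 1) → ℂ) →ₗ[ℂ] (Fin (d + 1) → ℂ) :=
  Matrix.mulVecLin ((Mat.of d).symm M)

theorem Mat.mulVecLin_mul {d : ℕ} (M N : Mat d) (v : Fin (d + 1) → ℂ) :
    (M * N).mulVecLin v = M.mulVecLin (N.mulVecLin v) := by
  simp [Mat.mulVecLin]

theorem Mat.mulVecLin_ne_zero {d : ℕ} {M : Mat d} (hM : IsUnit M) {v : Fin (d + 1) → ℂ}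
    (hv : v ≠ 0) : M.mulVecLin v ≠ 0 := by
  obtain ⟨u, rfl⟩ := hM
  intro h
  have h1 : ((u⁻¹ : (Mat d)ˣ) * (u : Mat d)).mulVecLin v = 0 := by
    rw [Mat.mulVecLin_mul, h, map_zero]
  rw [Units.inv_mul] at h1
  exact hv (by simpa [Mat.mulVecLin] using h1)

theorem PG.ofMat_smul_mk {d : ℕ} {M : Mat d} (hM : IsUnit M) (v : Fin (d + 1) → ℂ) (hv : v ≠ 0) :
    PG.ofMat M • (Projectivization.mk ℂ v hv : CP d) =
      Projectivization.mk ℂ (M.mulVecLin v) (Mat.mulVecLin_ne_zero hM hv) := by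
  obtain ⟨u, rfl⟩ := hM
  rw [PG.ofMat_coe]
  rfl

theorem PG.contMDiff_smul {d : ℕ} (g : PG d) :
    ContMDiff 𝓘(ℂ, EuclideanSpace ℂ (Fin d)) 𝓘(ℂ, EuclideanSpace ℂ (Fin d)) ω
      fun y : CP d => g • y := by
  have h := CP.contMDiff_linearProjection
    (contMDiff_id (I := 𝓘(ℂ, EuclideanSpace ℂ (Fin d))) (M := CP d) (n := ω))
    (PG.rep g : Mat d).mulVecLin
    (fun y => Mat.mulVecLin_ne_zero (PG.rep g).isUnit y.rep_nonzero)
  have he : (fun y : CP d => g • y) = fun y => Projectivization.mk ℂ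
      ((PG.rep g : Mat d).mulVecLin (id y : CP d).rep)
      (Mat.mulVecLin_ne_zero (PG.rep g).isUnit y.rep_nonzero) := by
    funext y
    rw [← PG.ofMat_smul_mk (PG.rep g).isUnit, PG.ofMat_rep]
    congr 1
    exact y.mk_rep.symm
  rw [he]
  exact h

/-- The orbit map `PGL(d + 1, ℂ) → ℂPᵈ` of the base point. -/
def orbitMap (d : ℕ) (g : PG d) : CP d := g • basePoint d

theorem contMDiff_orbitMap (d : ℕ) :
    ContMDiff 𝓘(ℂ, Sl d) 𝓘(ℂ, EuclideanSpace ℂ (Fin d)) ω (orbitMap d) := by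
  intro a
  let T : Mat d →ₗ[ℂ] (Fin (d + 1) → ℂ) :=
    ((LinearMap.applyₗ (Pi.single 0 1 : Fin (d + 1) → ℂ)).comp
      (Matrix.mulVecBilin ℂ ℂ)).comp (Mat.of d).symm.toLinearMap
  have h0 : (Pi.single 0 1 : Fin (d + 1) → ℂ) ≠ 0 := Pi.single_ne_zero_iff.2 one_ne_zero
  have h1 : ContMDiffAt 𝓘(ℂ, Sl d) 𝓘(ℂ, Fin (d + 1) → ℂ) ω
      (fun g => T (PG.localRep a g)) a :=
    (LinearMap.toContinuousLinearMap T).contMDiff.contMDiffAt.comp a (PG.contMDiffAt_localRep a)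
  have ha : ∀ᶠ g in 𝓝 a, g ∈ (PG.chart a).source :=
    (PG.chart a).open_source.mem_nhds (PG.mem_chart_self a)
  refine CP.contMDiffAt_mk h1
    (Mat.mulVecLin_ne_zero (PG.isUnit_localRep ha.self_of_nhds) h0) ?_
  filter_upwards [ha] with g hg
  refine ⟨Mat.mulVecLin_ne_zero (PG.isUnit_localRep hg) h0, ?_⟩
  conv_lhs => rw [← PG.ofMat_localRep hg]
  exact PG.ofMat_smul_mk (PG.isUnit_localRep hg) _ h0

/-- The matrix whose first column is `(0, w)` and whose other columns vanish. -/
def columnMat (d : ℕ) : EuclideanSpace ℂ (Fin d) →ₗ[ℂ] Mat d where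
  toFun w := Mat.of d (Matrix.vecMulVec (Fin.cons 0 w : Fin (d + 1) → ℂ) (Pi.single 0 1))
  map_add' w w' := by
    rw [← map_add, ← Matrix.add_vecMulVec]
    congr 2
    ext i
    refine Fin.cases ?_ (fun j => ?_) i <;> simp
  map_smul' c w := by
    rw [RingHom.id_apply, ← map_smul, ← Matrix.smul_vecMulVec]
    congr 2
    ext i
    refine Fin.cases ?_ (fun j => ?_) i <;> simp

theorem columnMat_mul_self {d : ℕ} (w : EuclideanSpace ℂ (Fin d)) :
    columnMat d w * columnMat d w = 0 := by
  change Mat.of d _ * Mat.of d _ = 0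
  rw [← map_mul, Matrix.vecMulVec_mul_vecMulVec]
  simp

theorem isUnit_one_add_columnMat {d : ℕ} (w : EuclideanSpace ℂ (Fin d)) :
    IsUnit (1 + columnMat d w) := by
  have h := columnMat_mul_self w
  refine ⟨⟨1 + columnMat d w, 1 - columnMat d w, ?_, ?_⟩, rfl⟩
  · rw [mul_sub, mul_one, add_mul, one_mul, h]; abel
  · rw [mul_add, mul_one, sub_mul, one_mul, h]; abel

theorem one_add_columnMat_mulVecLin {d : ℕ} (w : EuclideanSpace ℂ (Fin d)) :
    (1 + columnMat d w).mulVecLin (Pi.single 0 1) = homCoord 0 w := by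
  have h : (Mat.of d).symm (1 + columnMat d w) =
      1 + Matrix.vecMulVec (Fin.cons 0 w : Fin (d + 1) → ℂ) (Pi.single 0 1) := by
    rw [map_add, map_one]
    rfl
  rw [Mat.mulVecLin, h]
  ext i
  refine Fin.cases ?_ (fun j => ?_) i
  · simp [Matrix.vecMulVec_apply, homCoord]
  · simp [Matrix.vecMulVec_apply, homCoord]

/-- The domain of the translate by `a` of the standard local section of the orbit map. -/
def sectionDomain {d : ℕ} (a : PG d) : Set (CP d) := {y | (a⁻¹ • y : CP d).rep 0 ≠ 0}

/-- The translate by `a` of the standard local section of the orbit map, which sends a point with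
affine coordinates `w` to the class of the unipotent matrix with first column `(1, w)`. -/
def orbitSection {d : ℕ} (a : PG d) (y : CP d) : PG d :=
  a * PG.ofMat (1 + columnMat d (affineChart 0 (a⁻¹ • y : CP d)))

theorem isOpen_sectionDomain {d : ℕ} (a : PG d) : IsOpen (sectionDomain a) :=
  (isOpen_chart_source 0).preimage (PG.contMDiff_smul a⁻¹).continuous

theorem contMDiffAt_orbitSection {d : ℕ} {a : PG d} {y : CP d} (hy : y ∈ sectionDomain a) :
    ContMDiffAt 𝓘(ℂ, EuclideanSpace ℂ (Fin d)) 𝓘(ℂ, Sl d) ω (orbitSection a) y := by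
  have h1 : ContMDiffAt 𝓘(ℂ, EuclideanSpace ℂ (Fin d)) 𝓘(ℂ, EuclideanSpace ℂ (Fin d)) ω
      (fun y : CP d => affineChart 0 (a⁻¹ • y : CP d)) y :=
    (CP.contMDiffAt_affineChart hy).comp y (PG.contMDiff_smul a⁻¹ y)
  have h2 : ContDiff ℂ ω fun w => 1 + columnMat d w :=
    contDiff_const.add (LinearMap.toContinuousLinearMap (columnMat d)).contDiff
  have h3 : ∀ w, ContMDiffAt 𝓘(ℂ, EuclideanSpace ℂ (Fin d)) 𝓘(ℂ, Sl d) ω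
      (fun w => PG.ofMat (1 + columnMat d w)) w := fun w =>
    ContMDiffAt.comp (g := PG.ofMat) (f := fun w => 1 + columnMat d w) w
      (PG.contMDiffAt_ofMat (isUnit_one_add_columnMat w)) h2.contMDiff.contMDiffAt
  have h4 : ContMDiffAt 𝓘(ℂ, EuclideanSpace ℂ (Fin d)) 𝓘(ℂ, Sl d) ω
      (fun y : CP d => PG.ofMat (1 + columnMat d (affineChart 0 (a⁻¹ • y : CP d)))) y :=
    ContMDiffAt.comp (g := fun w => PG.ofMat (1 + columnMat d w))
      (f := fun y : CP d => affineChart 0 (a⁻¹ • y : CP d)) y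
      (h3 _) h1
  exact contMDiffAt_const.mul h4

theorem orbitSection_smul {d : ℕ} {a : PG d} {y : CP d} (hy : y ∈ sectionDomain a) :
    orbitSection a y • basePoint d = y := by
  rw [orbitSection, mul_smul, basePoint, PG.ofMat_smul_mk (isUnit_one_add_columnMat _)]
  simp only [one_add_columnMat_mulVecLin]
  have h : Projectivization.mk ℂ (homCoord 0 (affineChart 0 (a⁻¹ • y : CP d)))
      (homCoord_ne_zero 0 _) = (a⁻¹ • y : CP d) := (affineChart 0).left_inv hy
  rw [h, smul_inv_smul]

theorem affineChart_basePoint (d : ℕ) : affineChart 0 (basePoint d) = 0 := by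
  change affineCoord 0 (basePoint d).rep = 0
  rw [basePoint, affineCoord_rep]
  ext j
  simp [affineCoord]

theorem mem_sectionDomain_orbit {d : ℕ} (a : PG d) : a • basePoint d ∈ sectionDomain a := by
  rw [sectionDomain, mem_ofPred_eq, inv_smul_smul, basePoint, rep_apply_ne_zero_iff]
  simp

theorem orbitSection_orbit {d : ℕ} (a : PG d) : orbitSection a (a • basePoint d) = a := by
  rw [orbitSection, inv_smul_smul, affineChart_basePoint, map_zero, add_zero, PG.ofMat_one, mul_one]

/-- `PGL(d + 1, ℂ)` acts transitively on `ℂPᵈ`: a transvection makes the first coordinate of a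
vector nonzero. -/
theorem exists_smul_basePoint_eq {d : ℕ} (y : CP d) : ∃ a : PG d, a • basePoint d = y := by
  suffices h : ∃ a : PG d, y ∈ sectionDomain a by
    obtain ⟨a, ha⟩ := h
    exact ⟨_, orbitSection_smul ha⟩
  by_cases h0 : y.rep 0 = 0
  · obtain ⟨i, hi⟩ := exists_rep_ne_zero y
    have hi0 : (0 : Fin (d + 1)) ≠ i := fun h => hi (by rw [← h]; exact h0)
    let M : Mat d := Mat.of d (Matrix.transvection 0 i 1)
    have hM : IsUnit M := by
      have h1 : IsUnit (Matrix.transvection (0 : Fin (d + 1)) i (1 : ℂ)) := by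
        rw [Matrix.isUnit_iff_isUnit_det, Matrix.det_transvection_of_ne _ _ hi0]
        exact isUnit_one
      exact h1.map (Mat.of d)
    refine ⟨(PG.ofMat M)⁻¹, ?_⟩
    rw [sectionDomain, mem_ofPred_eq, inv_inv, ← y.mk_rep, PG.ofMat_smul_mk hM,
      rep_apply_ne_zero_iff]
    have h2 : M.mulVecLin y.rep 0 = y.rep 0 + y.rep i := by
      change (Matrix.transvection (0 : Fin (d + 1)) i (1 : ℂ)).mulVec y.rep 0 = _
      simp [Matrix.transvection, Matrix.add_mulVec, Matrix.single_mulVec]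
    rw [h2, h0, zero_add]
    exact hi
  · refine ⟨1, ?_⟩
    rwa [sectionDomain, mem_ofPred_eq, inv_one, one_smul]

open Classical in
/-- An extension of `orbitSection a` to a section of the orbit map over all of `ℂPᵈ`, which is
arbitrary off `sectionDomain a`. -/
def globalSection {d : ℕ} (a : PG d) (y : CP d) : PG d :=
  if y ∈ sectionDomain a then orbitSection a y else (exists_smul_basePoint_eq y).choose

theorem globalSection_smul {d : ℕ} (a : PG d) (y : CP d) :
    globalSection a y • basePoint d = y := by
  by_cases h : y ∈ sectionDomain a
  · rw [globalSection, if_pos h, orbitSection_smul h]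
  · rw [globalSection, if_neg h, (exists_smul_basePoint_eq y).choose_spec]

theorem contMDiffAt_globalSection {d : ℕ} {a : PG d} {y : CP d} (hy : y ∈ sectionDomain a) :
    ContMDiffAt 𝓘(ℂ, EuclideanSpace ℂ (Fin d)) 𝓘(ℂ, Sl d) ω (globalSection a) y := by
  refine (contMDiffAt_orbitSection hy).congr_of_eventuallyEq ?_
  filter_upwards [(isOpen_sectionDomain a).mem_nhds hy] with z hz using if_pos hz

theorem globalSection_orbit {d : ℕ} (a : PG d) : globalSection a (a • basePoint d) = a := by
  rw [globalSection, if_pos (mem_sectionDomain_orbit a), orbitSection_orbit]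

/-- The trace-free matrices modulo `Par d` are parametrized by the first column below the diagonal. -/
theorem finrank_par_add (d : ℕ) : Module.finrank ℂ (EuclideanSpace ℂ (Fin d) × Par d) =
    Module.finrank ℂ (Sl d) := by
  let T : Sl d →ₗ[ℂ] (Fin d → ℂ) :=
    { toFun := fun Y j => (Sl.incl d Y).entry j.succ 0
      map_add' := fun Y Z => by ext j; simp [Mat.entry]
      map_smul' := fun c Y => by ext j; simp [Mat.entry] }
  have hker : LinearMap.ker T = parSubmodule d := by
    ext Y
    rw [LinearMap.mem_ker]
    constructor
    · intro h i hi
      obtain ⟨j, rfl⟩ := Fin.exists_succ_eq.2 hi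
      exact congrFun h j
    · intro h
      ext j
      exact h _ (Fin.succ_ne_zero j)
  have hsurj : Function.Surjective T := by
    intro w
    refine ⟨traceFree d (columnMat d (WithLp.toLp 2 w)), funext fun j => ?_⟩
    change (Sl.incl d (traceFree d (columnMat d (WithLp.toLp 2 w)))).entry j.succ 0 = w j
    rw [traceFree_coe]
    have h : (Mat.of d).symm (columnMat d (WithLp.toLp 2 w)) =
      Matrix.vecMulVec (Fin.cons 0 w : Fin (d + 1) → ℂ) (Pi.single 0 1) := rfl
    simp [Mat.entry, h, Matrix.vecMulVec_apply]
  have h1 := LinearMap.finrank_range_add_finrank_ker T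
  rw [LinearMap.range_eq_top.2 hsurj, finrank_top, hker] at h1
  rw [Module.finrank_prod, ← h1]
  simp only [finrank_euclideanSpace, Fintype.card_fin, Module.finrank_fin_fun]
  rfl

/-! ### The pullback bundle -/

/-- The model of the total space of a principal `Q`-bundle on a manifold of dimension `d`. -/
abbrev bundleModel (d : ℕ) := 𝓘(ℂ, EuclideanSpace ℂ (Fin d)).prod 𝓘(ℂ, Par d)

section

variable {d : ℕ} {X : Type*} [TopologicalSpace X] [ChartedSpace (EuclideanSpace ℂ (Fin d)) X]

/-- The total space of the pullback along `γ : X → ℂPᵈ` of the bundle `PGL(d + 1, ℂ) → ℂPᵈ`. -/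
def PullbackTotal (γ : C^ω⟮𝓘(ℂ, EuclideanSpace ℂ (Fin d)), X;
    𝓘(ℂ, EuclideanSpace ℂ (Fin d)), CP d⟯) :=
  {z : X × PG d // z.2 • basePoint d = γ z.1}

namespace PullbackTotal

variable {γ : C^ω⟮𝓘(ℂ, EuclideanSpace ℂ (Fin d)), X; 𝓘(ℂ, EuclideanSpace ℂ (Fin d)), CP d⟯}

instance : TopologicalSpace (PullbackTotal γ) :=
  inferInstanceAs (TopologicalSpace {z : X × PG d // z.2 • basePoint d = γ z.1})

/-- The projection to the base. -/
def proj (p : PullbackTotal γ) : X := p.1.1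

/-- The canonical map to the total space of the bundle `PGL(d + 1, ℂ) → ℂPᵈ`. -/
def toPG (p : PullbackTotal γ) : PG d := p.1.2

@[ext]
theorem ext {p q : PullbackTotal γ} (h1 : p.proj = q.proj) (h2 : p.toPG = q.toPG) : p = q :=
  Subtype.ext (Prod.ext h1 h2)

theorem toPG_smul (p : PullbackTotal γ) : p.toPG • basePoint d = γ p.proj := p.2

theorem continuous_proj : Continuous (proj : PullbackTotal γ → X) :=
  continuous_fst.comp continuous_subtype_val

theorem continuous_toPG : Continuous (toPG : PullbackTotal γ → PG d) :=
  continuous_snd.comp continuous_subtype_val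

theorem continuousAt_of_proj_of_toPG {M : Type*} [TopologicalSpace M] {F : M → PullbackTotal γ} {x : M}
    (h1 : ContinuousAt (fun y => (F y).proj) x) (h2 : ContinuousAt (fun y => (F y).toPG) x) :
    ContinuousAt F x :=
  Topology.IsInducing.subtypeVal.continuousAt_iff.2 (h1.prodMk h2)

/-- The right action of `Q`. -/
def act (p : PullbackTotal γ) (h : Q d) : PullbackTotal γ :=
  ⟨(p.proj, p.toPG * h), by
    have h1 : (h : PG d) • basePoint d = basePoint d := h.2
    rw [mul_smul, h1, p.toPG_smul]⟩

/-- The bijection with the product `X × Q` which is given by a section of the orbit map. -/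
def trivEquiv (γ : C^ω⟮𝓘(ℂ, EuclideanSpace ℂ (Fin d)), X; 𝓘(ℂ, EuclideanSpace ℂ (Fin d)), CP d⟯)
    (a : PG d) : PullbackTotal γ ≃ X × Q d where
  toFun p := (p.proj, ⟨(globalSection a (γ p.proj))⁻¹ * p.toPG, by
    rw [Q, MulAction.mem_stabilizer_iff, mul_smul, inv_smul_eq_iff, globalSection_smul,
      p.toPG_smul]⟩)
  invFun z := ⟨(z.1, globalSection a (γ z.1) * z.2), by
    have h1 : (z.2 : PG d) • basePoint d = basePoint d := z.2.2
    rw [mul_smul, h1, globalSection_smul]⟩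
  left_inv p := ext rfl (mul_inv_cancel_left _ _)
  right_inv z := Prod.ext rfl (Subtype.ext (inv_mul_cancel_left _ _))

/-- The local trivialization defined by the translate by `a` of the standard section of the orbit
map. -/
def triv (γ : C^ω⟮𝓘(ℂ, EuclideanSpace ℂ (Fin d)), X; 𝓘(ℂ, EuclideanSpace ℂ (Fin d)), CP d⟯)
    (a : PG d) : Bundle.Trivialization (Q d) (proj : PullbackTotal γ → X) where
  toFun := trivEquiv γ a
  invFun := (trivEquiv γ a).symm
  source := proj ⁻¹' (γ ⁻¹' sectionDomain a)
  target := (γ ⁻¹' sectionDomain a) ×ˢ univ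
  map_source' p hp := ⟨hp, mem_univ _⟩
  map_target' z hz := hz.1
  left_inv' p _ := (trivEquiv γ a).left_inv p
  right_inv' z _ := (trivEquiv γ a).right_inv z
  open_source := ((isOpen_sectionDomain a).preimage γ.contMDiff.continuous).preimage continuous_proj
  open_target := ((isOpen_sectionDomain a).preimage γ.contMDiff.continuous).prod isOpen_univ
  continuousOn_toFun p hp := by
    refine ContinuousAt.continuousWithinAt ?_
    refine continuous_proj.continuousAt.prodMk
      (Topology.IsInducing.subtypeVal.continuousAt_iff.2 ?_)
    refine ContinuousAt.mul (ContinuousAt.inv ?_) continuous_toPG.continuousAt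
    exact ContinuousAt.comp (g := globalSection a) (f := fun p : PullbackTotal γ => γ p.proj)
      (contMDiffAt_globalSection hp).continuousAt
      (γ.contMDiff.continuous.comp continuous_proj).continuousAt
  continuousOn_invFun z hz := by
    refine ContinuousAt.continuousWithinAt ?_
    refine continuousAt_of_proj_of_toPG continuousAt_fst
      (ContinuousAt.mul ?_ (continuous_subtype_val.comp continuous_snd).continuousAt)
    exact ContinuousAt.comp (g := globalSection a) (f := fun z : X × Q d => γ z.1)
      (contMDiffAt_globalSection hz.1).continuousAt
      (γ.contMDiff.continuous.comp continuous_fst).continuousAt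
  baseSet := γ ⁻¹' sectionDomain a
  open_baseSet := (isOpen_sectionDomain a).preimage γ.contMDiff.continuous
  source_eq := rfl
  target_eq := rfl
  proj_toFun p _ := rfl

theorem mem_triv_source_toPG (p : PullbackTotal γ) : p ∈ (triv γ p.toPG).source := by
  change γ p.proj ∈ sectionDomain p.toPG
  rw [← p.toPG_smul]
  exact mem_sectionDomain_orbit _

/-- The atlas of the charts that arise from local trivializations and charts of the product. -/
instance : ChartedSpace (ModelProd (EuclideanSpace ℂ (Fin d)) (Par d)) (PullbackTotal γ) where
  atlas := {e | ∃ (a : PG d) (z : X × Q d), e = (triv γ a).toOpenPartialHomeomorph.trans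
    (chartAt (ModelProd (EuclideanSpace ℂ (Fin d)) (Par d)) z)}
  chartAt p := (triv γ p.toPG).toOpenPartialHomeomorph.trans
    (chartAt (ModelProd (EuclideanSpace ℂ (Fin d)) (Par d)) (triv γ p.toPG p))
  mem_chart_source p := by
    rw [OpenPartialHomeomorph.trans_source]
    exact ⟨p.mem_triv_source_toPG,
      mem_chart_source (ModelProd (EuclideanSpace ℂ (Fin d)) (Par d)) (triv γ p.toPG p)⟩
  chart_mem_atlas p := ⟨_, _, rfl⟩

theorem contMDiffAt_transition {a b : PG d} {z : X × Q d} (ha : γ z.1 ∈ sectionDomain a)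
    (hb : γ z.1 ∈ sectionDomain b) :
    ContMDiffAt (bundleModel d) (bundleModel d) ω
      (fun z => trivEquiv γ b ((trivEquiv γ a).symm z)) z := by
  refine contMDiffAt_fst.prodMk (Q.contMDiffAt_of_val ?_)
  have h1 : ContMDiffAt (bundleModel d) 𝓘(ℂ, EuclideanSpace ℂ (Fin d)) ω
      (fun z : X × Q d => γ z.1) z := γ.contMDiff.contMDiffAt.comp z contMDiffAt_fst
  have h2 : ∀ c : PG d, γ z.1 ∈ sectionDomain c → ContMDiffAt (bundleModel d) 𝓘(ℂ, Sl d) ω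
      (fun z : X × Q d => globalSection c (γ z.1)) z := fun c hc =>
    ContMDiffAt.comp (g := globalSection c) z (contMDiffAt_globalSection hc) h1
  exact (h2 b hb).inv.mul ((h2 a ha).mul ((Q.contMDiff_val d).contMDiffAt.comp z contMDiffAt_snd))

variable [IsManifold 𝓘(ℂ, EuclideanSpace ℂ (Fin d)) ω X]

instance : IsManifold (bundleModel d) ω (PullbackTotal γ) := by
  refine isManifold_of_contDiffOn _ _ _ ?_
  rintro _ _ ⟨a, z, rfl⟩ ⟨b, w, rfl⟩
  let c := chartAt (ModelProd (EuclideanSpace ℂ (Fin d)) (Par d)) z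
  let c' := chartAt (ModelProd (EuclideanSpace ℂ (Fin d)) (Par d)) w
  let s : Set (X × Q d) := {z | z ∈ c.source ∧ γ z.1 ∈ sectionDomain a ∧ γ z.1 ∈ sectionDomain b ∧
    trivEquiv γ b ((trivEquiv γ a).symm z) ∈ c'.source}
  have h : ContMDiffOn (bundleModel d) (bundleModel d) ω
      (fun z => trivEquiv γ b ((trivEquiv γ a).symm z)) s := fun z hz =>
    (contMDiffAt_transition hz.2.1 hz.2.2.1).contMDiffWithinAt
  rw [contMDiffOn_iff_of_mem_maximalAtlas' (IsManifold.chart_mem_maximalAtlas z)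
    (IsManifold.chart_mem_maximalAtlas w) (fun z hz => hz.1) (fun z hz => hz.2.2.2)] at h
  refine h.mono fun y hy => ?_
  obtain ⟨hy, -⟩ := hy
  simp only [mem_preimage, OpenPartialHomeomorph.trans_source, OpenPartialHomeomorph.symm_source,
    OpenPartialHomeomorph.trans_target, OpenPartialHomeomorph.coe_trans_symm, mem_inter_iff,
    Function.comp] at hy
  obtain ⟨⟨hy1, hy2⟩, hy3, hy4⟩ := hy
  refine ⟨c.symm ((bundleModel d).symm y), ⟨c.map_target hy1, hy2.1, hy3, hy4⟩, ?_⟩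
  rw [OpenPartialHomeomorph.extend_coe, Function.comp, c.right_inv hy1]
  exact (bundleModel d).right_inv (by simp [bundleModel])

theorem trans_mem_maximalAtlas (a : PG d) (z : X × Q d) :
    (triv γ a).toOpenPartialHomeomorph.trans
      (chartAt (ModelProd (EuclideanSpace ℂ (Fin d)) (Par d)) z) ∈
      IsManifold.maximalAtlas (bundleModel d) ω (PullbackTotal γ) :=
  IsManifold.subset_maximalAtlas ⟨a, z, rfl⟩

theorem contMDiffAt_trivEquiv {a : PG d} {p : PullbackTotal γ} (hp : γ p.proj ∈ sectionDomain a) :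
    ContMDiffAt (bundleModel d) (bundleModel d) ω (trivEquiv γ a) p := by
  set z := trivEquiv γ a p
  let c := chartAt (ModelProd (EuclideanSpace ℂ (Fin d)) (Par d)) z
  let e := (triv γ a).toOpenPartialHomeomorph.trans c
  have hpe : p ∈ e.source := by
    rw [OpenPartialHomeomorph.trans_source]
    exact ⟨hp, mem_chart_source (ModelProd (EuclideanSpace ℂ (Fin d)) (Par d)) z⟩
  have h1 : ContMDiffAt (bundleModel d) (bundleModel d) ω e p :=
    contMDiffAt_of_mem_maximalAtlas (trans_mem_maximalAtlas a z) hpe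
  have h2 : ContMDiffAt (bundleModel d) (bundleModel d) ω c.symm (e p) :=
    contMDiffAt_symm_of_mem_maximalAtlas (IsManifold.chart_mem_maximalAtlas z)
      (mem_chart_target _ z)
  refine (h2.comp p h1).congr_of_eventuallyEq ?_
  filter_upwards [e.open_source.mem_nhds hpe] with q hq
  rw [OpenPartialHomeomorph.trans_source] at hq
  exact (c.left_inv hq.2).symm

theorem contMDiffAt_trivEquiv_symm {a : PG d} {z : X × Q d} (hz : γ z.1 ∈ sectionDomain a) :
    ContMDiffAt (bundleModel d) (bundleModel d) ω (trivEquiv γ a).symm z := by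
  let c := chartAt (ModelProd (EuclideanSpace ℂ (Fin d)) (Par d)) z
  let e := (triv γ a).toOpenPartialHomeomorph.trans c
  have h1 : ContMDiffAt (bundleModel d) (bundleModel d) ω c z :=
    contMDiffAt_of_mem_maximalAtlas (IsManifold.chart_mem_maximalAtlas z) (mem_chart_source _ z)
  have hze : c z ∈ e.target := by
    rw [OpenPartialHomeomorph.trans_target]
    refine ⟨mem_chart_target _ z, ?_⟩
    rw [mem_preimage, c.left_inv (mem_chart_source _ z)]
    exact ⟨hz, mem_univ _⟩
  have h2 : ContMDiffAt (bundleModel d) (bundleModel d) ω e.symm (c z) :=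
    contMDiffAt_symm_of_mem_maximalAtlas (trans_mem_maximalAtlas a z) hze
  refine (h2.comp z h1).congr_of_eventuallyEq ?_
  filter_upwards [c.open_source.mem_nhds (mem_chart_source _ z)] with w hw
  exact congrArg (trivEquiv γ a).symm (c.left_inv hw).symm

theorem contMDiff_proj :
    ContMDiff (bundleModel d) 𝓘(ℂ, EuclideanSpace ℂ (Fin d)) ω (proj : PullbackTotal γ → X) :=
  fun p => ContMDiffAt.comp (g := Prod.fst) (f := trivEquiv γ p.toPG) p contMDiffAt_fst
    (contMDiffAt_trivEquiv p.mem_triv_source_toPG)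

theorem contMDiff_toPG : ContMDiff (bundleModel d) 𝓘(ℂ, Sl d) ω (toPG : PullbackTotal γ → PG d) := by
  intro p
  have hp : γ p.proj ∈ sectionDomain p.toPG := p.mem_triv_source_toPG
  have h1 : ContMDiffAt (bundleModel d) 𝓘(ℂ, Sl d) ω
      (fun q : PullbackTotal γ => globalSection p.toPG (γ q.proj)) p :=
    ContMDiffAt.comp (g := globalSection p.toPG) p (contMDiffAt_globalSection hp)
      (γ.contMDiff.contMDiffAt.comp p contMDiff_proj.contMDiffAt)
  have h2 : ContMDiffAt (bundleModel d) 𝓘(ℂ, Sl d) ω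
      (fun q : PullbackTotal γ => ((trivEquiv γ p.toPG q).2 : PG d)) p :=
    (Q.contMDiff_val d).contMDiffAt.comp p (contMDiffAt_snd.comp p (contMDiffAt_trivEquiv hp))
  refine (h1.mul h2).congr_of_eventuallyEq (Eventually.of_forall fun q => ?_)
  exact (mul_inv_cancel_left _ _).symm

/-- A map to the total space is holomorphic if its components in `X` and in `PGL(d + 1, ℂ)` are. -/
theorem contMDiffAt_of_proj_of_toPG {E H M : Type*} [NormedAddCommGroup E] [NormedSpace ℂ E]
    [TopologicalSpace H] {I : ModelWithCorners ℂ E H} [TopologicalSpace M] [ChartedSpace H M]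
    {F : M → PullbackTotal γ} {x : M}
    (h1 : ContMDiffAt I 𝓘(ℂ, EuclideanSpace ℂ (Fin d)) ω (fun y => (F y).proj) x)
    (h2 : ContMDiffAt I 𝓘(ℂ, Sl d) ω (fun y => (F y).toPG) x) :
    ContMDiffAt I (bundleModel d) ω F x := by
  set a := (F x).toPG
  have ha : γ (F x).proj ∈ sectionDomain a := (F x).mem_triv_source_toPG
  have h3 : ContMDiffAt I 𝓘(ℂ, Sl d) ω (fun y => globalSection a (γ (F y).proj)) x :=
    ContMDiffAt.comp (g := globalSection a) x (contMDiffAt_globalSection ha)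
      (γ.contMDiff.contMDiffAt.comp x h1)
  have h4 : ContMDiffAt I (bundleModel d) ω (fun y => trivEquiv γ a (F y)) x :=
    h1.prodMk (Q.contMDiffAt_of_val (h3.inv.mul h2))
  refine (ContMDiffAt.comp (g := (trivEquiv γ a).symm) x
    (contMDiffAt_trivEquiv_symm ha) h4).congr_of_eventuallyEq (Eventually.of_forall fun y => ?_)
  exact ((trivEquiv γ a).symm_apply_apply _).symm

theorem contMDiff_act : ContMDiff ((bundleModel d).prod 𝓘(ℂ, Par d)) (bundleModel d) ω
    fun z : PullbackTotal γ × Q d => act z.1 z.2 := fun z =>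
  contMDiffAt_of_proj_of_toPG
    (ContMDiffAt.comp (g := proj) (f := Prod.fst) z contMDiff_proj.contMDiffAt contMDiffAt_fst)
    ((ContMDiffAt.comp (g := toPG) (f := Prod.fst) z contMDiff_toPG.contMDiffAt
      contMDiffAt_fst).mul ((Q.contMDiff_val d).contMDiffAt.comp z contMDiffAt_snd))

end PullbackTotal

end

/-! ### The pullback of the standard projective structure -/

section

variable {E H M E' H' M' E'' H'' M'' : Type*} [NormedAddCommGroup E] [NormedSpace ℂ E]
  [TopologicalSpace H] {I : ModelWithCorners ℂ E H} [TopologicalSpace M] [ChartedSpace H M]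
  [NormedAddCommGroup E'] [NormedSpace ℂ E'] [TopologicalSpace H'] {J : ModelWithCorners ℂ E' H'}
  [TopologicalSpace M'] [ChartedSpace H' M'] [NormedAddCommGroup E''] [NormedSpace ℂ E'']
  [TopologicalSpace H''] {K : ModelWithCorners ℂ E'' H''} [TopologicalSpace M'']
  [ChartedSpace H'' M'']

theorem modelDeriv_prodMk_apply {f : M → M'} {g : M → M''} {x : M} (hf : MDifferentiableAt I J f x)
    (hg : MDifferentiableAt I K g x) (v : E) :
    modelDeriv I (J.prod K) (fun y => (f y, g y)) x v =
      (modelDeriv I J f x v, modelDeriv I K g x v) :=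
  congrArg (fun T => T v) (mfderiv_prodMk hf hg)

/-- The points at which the differential is injective form an open set. -/
theorem isOpen_setOf_injective_modelDeriv [IsManifold I ω M] [IsManifold J ω M']
    [FiniteDimensional ℂ E] {g : M → M'} (hg : ContMDiff I J ω g) :
    IsOpen {x | Function.Injective (modelDeriv I J g x)} := by
  rw [isOpen_iff_mem_nhds]
  intro x₀ hx₀
  have : IsManifold I 1 M := IsManifold.of_le (n := ω) le_top
  have : IsManifold J 1 M' := IsManifold.of_le (n := ω) le_top
  let T : M → E →L[ℂ] E' := inTangentCoordinates I J id g (mfderiv I J g) x₀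
  have hT : ContinuousAt T x₀ :=
    (ContMDiffAt.mfderiv_const (hg x₀) (m := 0) (by simp)).continuousAt
  have key : ∀ᶠ x in 𝓝 x₀, Function.Injective (T x) ↔ Function.Injective (modelDeriv I J g x) := by
    filter_upwards [(chartAt H x₀).open_source.mem_nhds (mem_chart_source H x₀),
      hg.continuous.continuousAt ((chartAt H' (g x₀)).open_source.mem_nhds
        (mem_chart_source H' (g x₀)))] with x hx hy
    obtain ⟨A, hA⟩ := isInvertible_mfderiv_extChartAt (I := J) (x := g x₀) (y := g x)
      (by rwa [extChartAt_source])
    obtain ⟨B, hB⟩ := isInvertible_mfderivWithin_extChartAt_symm (I := I)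
      ((extChartAt I x₀).map_source (by rwa [extChartAt_source] : x ∈ (extChartAt I x₀).source))
    have h : ∀ v, T x v = A (modelDeriv I J g x (B v)) := by
      intro v
      have h1 : T x = _ := inTangentCoordinates_eq_mfderiv_comp (f := id) hx hy
      rw [h1]
      simp only [id]
      rw [← hA, ← hB]
      rfl
    have h2 : ⇑(T x) = A ∘ modelDeriv I J g x ∘ B := funext h
    rw [h2]
    exact (A.injective.of_comp_iff _).trans (Function.Injective.of_comp_iff' _ B.bijective)
  have h0 := key.self_of_nhds.2 hx₀
  filter_upwards [key, hT.eventually (ContinuousLinearMap.isOpen_injective.mem_nhds h0)] with x h1 h2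
    using h1.1 h2

end

/-- In the preferred charts, the differential of a right translation by `h` is the adjoint action of
`h⁻¹`. -/
theorem modelDeriv_mul_right {d : ℕ} (h g : PG d) (v : Sl d) :
    modelDeriv 𝓘(ℂ, Sl d) 𝓘(ℂ, Sl d) (fun x : PG d => x * h) g v =
      (adjointAction (Sl d) h⁻¹ v : Sl d) := by
  have hR : ∀ g : PG d, MDifferentiableAt 𝓘(ℂ, Sl d) 𝓘(ℂ, Sl d) (fun x : PG d => x * h) g :=
    fun g => (contMDiff_mul_right (I := 𝓘(ℂ, Sl d)) (n := ω) (a := h)).contMDiffAt.mdifferentiableAt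
      (by simp)
  have hL : ∀ a g : PG d, MDifferentiableAt 𝓘(ℂ, Sl d) 𝓘(ℂ, Sl d) (fun x : PG d => a * x) g :=
    fun a g => (contMDiff_mul_left (I := 𝓘(ℂ, Sl d)) (n := ω) (a := a)).contMDiffAt.mdifferentiableAt
      (by simp)
  have h1 : (fun x : PG d => x * h) =
      (fun x => g * x) ∘ (fun x => x * h) ∘ fun x => g⁻¹ * x := by
    funext x
    simp [mul_assoc]
  have h2 : (fun x : PG d => h⁻¹ * x * (h⁻¹)⁻¹) = (fun x => h⁻¹ * x) ∘ fun x => x * h := by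
    funext x
    simp [mul_assoc]
  have h3 : modelDeriv 𝓘(ℂ, Sl d) 𝓘(ℂ, Sl d) (fun x : PG d => x * h) g =
      modelDeriv 𝓘(ℂ, Sl d) 𝓘(ℂ, Sl d) (fun x : PG d => x * h) 1 := by
    conv_lhs => rw [h1]
    rw [modelDeriv_comp (hL _ _) ((hR _).comp g (hL _ _)), modelDeriv_comp (hR _) (hL _ _),
      modelDeriv_mul_left, modelDeriv_mul_left, inv_mul_cancel, ContinuousLinearMap.comp_id,
      ContinuousLinearMap.id_comp]
  have h4 : modelDeriv 𝓘(ℂ, Sl d) 𝓘(ℂ, Sl d) (fun x : PG d => h⁻¹ * x * (h⁻¹)⁻¹) 1 =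
      modelDeriv 𝓘(ℂ, Sl d) 𝓘(ℂ, Sl d) (fun x : PG d => x * h) 1 := by
    rw [h2, modelDeriv_comp (hL _ _) (hR _), modelDeriv_mul_left, ContinuousLinearMap.id_comp]
  exact congrArg (fun T => T v) (h3.trans h4.symm)

namespace PullbackTotal

variable {d : ℕ} {X : Type*} [TopologicalSpace X] [ChartedSpace (EuclideanSpace ℂ (Fin d)) X]
  {γ : C^ω⟮𝓘(ℂ, EuclideanSpace ℂ (Fin d)), X; 𝓘(ℂ, EuclideanSpace ℂ (Fin d)), CP d⟯}

/-- The pullback of the Maurer-Cartan form. -/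
def form (p : PullbackTotal γ) : EuclideanSpace ℂ (Fin d) × Par d →L[ℂ] Sl d :=
  ContinuousLinearMap.comp (maurerCartan (Sl d) p.toPG : Sl d →L[ℂ] Sl d)
    (modelDeriv (bundleModel d) 𝓘(ℂ, Sl d) toPG p)

theorem form_eq (p : PullbackTotal γ) :
    form p = modelDeriv (bundleModel d) 𝓘(ℂ, Sl d) toPG p := by
  refine ContinuousLinearMap.ext fun v => ?_
  exact maurerCartan_apply _ _

variable [IsManifold 𝓘(ℂ, EuclideanSpace ℂ (Fin d)) ω X]

theorem mdifferentiable_toPG :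
    MDifferentiable (bundleModel d) 𝓘(ℂ, Sl d) (toPG : PullbackTotal γ → PG d) :=
  contMDiff_toPG.mdifferentiable (by simp)

theorem mdifferentiable_proj :
    MDifferentiable (bundleModel d) 𝓘(ℂ, EuclideanSpace ℂ (Fin d))
      (proj : PullbackTotal γ → X) :=
  contMDiff_proj.mdifferentiable (by simp)

/-- Equivariance of the form. -/
theorem form_act_modelDeriv (p : PullbackTotal γ) (h : Q d)
    (v : EuclideanSpace ℂ (Fin d) × Par d) :
    form (act p h) (modelDeriv (bundleModel d) (bundleModel d) (fun q => act q h) p v) =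
      (adjointAction (Sl d) (h⁻¹ : PG d) (form p v) : Sl d) := by
  have h1 : MDifferentiableAt (bundleModel d) (bundleModel d)
      (fun q : PullbackTotal γ => act q h) p :=
    (ContMDiffAt.comp (g := fun z : PullbackTotal γ × Q d => act z.1 z.2) (f := fun q => (q, h)) p
      contMDiff_act.contMDiffAt (contMDiffAt_id.prodMk contMDiffAt_const)).mdifferentiableAt
      (by simp)
  have h2 := modelDeriv_comp (f := fun q => act q h) (mdifferentiable_toPG (act p h)) h1
  have h3 : MDifferentiableAt 𝓘(ℂ, Sl d) 𝓘(ℂ, Sl d) (fun x : PG d => x * h) p.toPG :=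
    (contMDiff_mul_right (I := 𝓘(ℂ, Sl d)) (n := ω) (a := (h : PG d))).contMDiffAt.mdifferentiableAt
      (by simp)
  have h4 := modelDeriv_comp h3 (mdifferentiable_toPG p)
  have h5 : toPG ∘ (fun q : PullbackTotal γ => act q h) = (fun x : PG d => x * h) ∘ toPG := rfl
  rw [h5, h4] at h2
  rw [form_eq, form_eq, ← modelDeriv_mul_right]
  exact (congrArg (fun T => T v) h2).symm

/-- On the fibres, the form is the Maurer-Cartan form of `Q`. -/
theorem form_act_one_modelDeriv (p : PullbackTotal γ) (a : Par d) :
    form (act p 1) (modelDeriv 𝓘(ℂ, Par d) (bundleModel d) (fun h : Q d => act p h) 1 a) =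
      modelDeriv 𝓘(ℂ, Par d) 𝓘(ℂ, Sl d) (Subtype.val : Q d → PG d) 1 a := by
  have h1 : MDifferentiableAt 𝓘(ℂ, Par d) (bundleModel d) (fun h : Q d => act p h) 1 :=
    (ContMDiffAt.comp (g := fun z : PullbackTotal γ × Q d => act z.1 z.2) (f := fun h => (p, h)) 1
      contMDiff_act.contMDiffAt (contMDiffAt_const.prodMk contMDiffAt_id)).mdifferentiableAt
      (by simp)
  have h2 := modelDeriv_comp (mdifferentiable_toPG (act p 1)) h1
  have h3 : MDifferentiableAt 𝓘(ℂ, Sl d) 𝓘(ℂ, Sl d) (fun x : PG d => p.toPG * x)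
      ((1 : Q d) : PG d) :=
    (contMDiff_mul_left (I := 𝓘(ℂ, Sl d)) (n := ω)).contMDiffAt.mdifferentiableAt (by simp)
  have h4 := modelDeriv_comp h3 (((Q.contMDiff_val d) 1).mdifferentiableAt (by simp))
  have h5 : toPG ∘ (fun h : Q d => act p h) = (fun x : PG d => p.toPG * x) ∘ Subtype.val := rfl
  rw [h5, h4, modelDeriv_mul_left, ContinuousLinearMap.id_comp] at h2
  rw [form_eq]
  exact (congrArg (fun T => T a) h2).symm

/-- A tangent vector to the total space vanishes if its images in `X` and in `PGL(d + 1, ℂ)` do. -/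
theorem eq_zero_of_modelDeriv_eq_zero (p : PullbackTotal γ) {v : EuclideanSpace ℂ (Fin d) × Par d}
    (h1 : modelDeriv (bundleModel d) 𝓘(ℂ, EuclideanSpace ℂ (Fin d)) proj p v = 0)
    (h2 : modelDeriv (bundleModel d) 𝓘(ℂ, Sl d) toPG p v = 0) : v = 0 := by
  set a := p.toPG
  have ha : γ p.proj ∈ sectionDomain a := p.mem_triv_source_toPG
  have hw : (ω : WithTop ℕ∞) ≠ 0 := by simp
  have he := (contMDiffAt_trivEquiv ha).mdifferentiableAt hw
  have hes : MDifferentiableAt (bundleModel d) (bundleModel d) (trivEquiv γ a).symm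
      (trivEquiv γ a p) :=
    (contMDiffAt_trivEquiv_symm (z := trivEquiv γ a p) ha).mdifferentiableAt hw
  let s : PullbackTotal γ → Q d := fun q => (trivEquiv γ a q).2
  have hs : MDifferentiableAt (bundleModel d) 𝓘(ℂ, Par d) s p :=
    MDifferentiableAt.comp (g := Prod.snd) p mdifferentiableAt_snd he
  have hs1 : s p = 1 := by
    refine Subtype.ext ?_
    change (globalSection a (γ p.proj))⁻¹ * a = 1
    rw [← p.toPG_smul, globalSection_orbit, inv_mul_cancel]
  -- The fibre coordinate, as a map to `PGL(d + 1, ℂ)`, is a function of the two projections.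
  have hval : modelDeriv 𝓘(ℂ, Par d) 𝓘(ℂ, Sl d) (Subtype.val : Q d → PG d) (s p)
      (modelDeriv (bundleModel d) 𝓘(ℂ, Par d) s p v) = 0 := by
    let τ : X → PG d := fun x => (globalSection a (γ x))⁻¹
    have hτ : MDifferentiableAt 𝓘(ℂ, EuclideanSpace ℂ (Fin d)) 𝓘(ℂ, Sl d) τ p.proj :=
      (ContMDiffAt.comp (g := globalSection a) p.proj (contMDiffAt_globalSection ha)
        γ.contMDiff.contMDiffAt).inv.mdifferentiableAt hw
    have hm : MDifferentiableAt (𝓘(ℂ, Sl d).prod 𝓘(ℂ, Sl d)) 𝓘(ℂ, Sl d)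
        (fun z : PG d × PG d => z.1 * z.2) ((τ ∘ proj) p, toPG p) :=
      (contMDiff_mul 𝓘(ℂ, Sl d) ω).contMDiffAt.mdifferentiableAt hw
    have hτp := hτ.comp p (mdifferentiable_proj p)
    have h3 := modelDeriv_comp (f := fun q => ((τ ∘ proj) q, toPG q)) hm
      (hτp.prodMk (mdifferentiable_toPG p))
    have h4 := modelDeriv_comp (((Q.contMDiff_val d) (s p)).mdifferentiableAt hw) hs
    have h5 : (Subtype.val ∘ s : PullbackTotal γ → PG d) =
        (fun z : PG d × PG d => z.1 * z.2) ∘ fun q => ((τ ∘ proj) q, toPG q) := rfl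
    rw [h5, h3] at h4
    refine (congrArg (fun T => T v) h4).symm.trans ?_
    simp only [ContinuousLinearMap.comp_apply]
    rw [modelDeriv_prodMk_apply hτp (mdifferentiable_toPG p), h2,
      modelDeriv_comp hτ (mdifferentiable_proj p), ContinuousLinearMap.comp_apply, h1, map_zero]
    exact map_zero _
  have hs0 : modelDeriv (bundleModel d) 𝓘(ℂ, Par d) s p v = 0 := by
    have hinj : Function.Injective
        (modelDeriv 𝓘(ℂ, Par d) 𝓘(ℂ, Sl d) (Subtype.val : Q d → PG d) 1) :=
      IsComplexLieSubgroup.injective_mfderiv_val (𝔤 := Sl d) (𝔥 := Par d) (H := Q d)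
    rw [hs1] at hval
    exact hinj (hval.trans (map_zero _).symm)
  have he0 : modelDeriv (bundleModel d) (bundleModel d) (trivEquiv γ a) p v = 0 := by
    have h3 := modelDeriv_prodMk_apply (mdifferentiable_proj p) hs v
    rw [h1, hs0] at h3
    exact h3
  have h3 := modelDeriv_comp hes he
  rw [Equiv.symm_comp_self] at h3
  have h4 : modelDeriv (bundleModel d) (bundleModel d) (id : PullbackTotal γ → _) p v = v :=
    congrArg (fun T => T v) (mfderiv_id (I := bundleModel d) (x := p))
  rw [← h4, h3, ContinuousLinearMap.comp_apply, he0, map_zero]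

/-- The form is bijective over the points at which `γ` is a local biholomorphism: a tangent vector
which is killed by the differential of `toPG` is killed by that of `γ ∘ proj`, which factors through
`toPG`. -/
theorem bijective_form_of_injective (p : PullbackTotal γ)
    (hp : Function.Injective (modelDeriv 𝓘(ℂ, EuclideanSpace ℂ (Fin d))
      𝓘(ℂ, EuclideanSpace ℂ (Fin d)) γ p.proj)) : Function.Bijective (form p) := by
  have hinj : Function.Injective (form p) := by
    rw [injective_iff_map_eq_zero]
    intro v hv
    rw [form_eq] at hv
    refine eq_zero_of_modelDeriv_eq_zero p (hp ?_) hv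
    have hγ : MDifferentiableAt 𝓘(ℂ, EuclideanSpace ℂ (Fin d)) 𝓘(ℂ, EuclideanSpace ℂ (Fin d)) γ
        p.proj := γ.contMDiff.contMDiffAt.mdifferentiableAt (by simp)
    have h1 := modelDeriv_comp hγ (mdifferentiable_proj p)
    have h2 : γ ∘ (proj : PullbackTotal γ → X) = orbitMap d ∘ toPG :=
      funext fun q => q.toPG_smul.symm
    rw [h2, modelDeriv_comp ((contMDiff_orbitMap d _).mdifferentiableAt (by simp))
      (mdifferentiable_toPG p)] at h1
    have h3 := congrArg (fun T => T v) h1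
    simp only [ContinuousLinearMap.comp_apply, hv, map_zero] at h3
    rw [map_zero]
    exact h3.symm
  exact ⟨hinj, (LinearMap.injective_iff_surjective_of_finrank_eq_finrank
    (f := (form p).toLinearMap) (finrank_par_add d)).1 hinj⟩

end PullbackTotal

namespace PullbackTotal

variable {d : ℕ} {X : Type*} [TopologicalSpace X] [ChartedSpace (EuclideanSpace ℂ (Fin d)) X]
  [IsManifold 𝓘(ℂ, EuclideanSpace ℂ (Fin d)) ω X]

/-- The pullback along `γ` of the principal `Q`-bundle `PGL(d + 1, ℂ) → ℂPᵈ`. -/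
def principalBundle (γ : C^ω⟮𝓘(ℂ, EuclideanSpace ℂ (Fin d)), X;
    𝓘(ℂ, EuclideanSpace ℂ (Fin d)), CP d⟯) :
    HolomorphicPrincipalBundle (𝔥 := Par d) (Q d) (V := EuclideanSpace ℂ (Fin d)) X where
  Total := PullbackTotal γ
  proj := proj
  act := act
  act_one p := ext rfl (mul_one _)
  act_mul p h k := ext rfl (mul_assoc _ _ _).symm
  proj_act _ _ := rfl
  contMDiff_proj := contMDiff_proj
  contMDiff_act := contMDiff_act
  locally_trivial x := by
    obtain ⟨a, ha⟩ := exists_smul_basePoint_eq (γ x)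
    refine ⟨triv γ a, ?_, fun p hp => (contMDiffAt_trivEquiv hp).contMDiffWithinAt,
      fun z hz => (contMDiffAt_trivEquiv_symm hz.1).contMDiffWithinAt, fun p _ h => ?_⟩
    · change γ x ∈ sectionDomain a
      rw [← ha]
      exact mem_sectionDomain_orbit a
    · exact Subtype.ext (mul_assoc _ _ _).symm

variable {γ : C^ω⟮𝓘(ℂ, EuclideanSpace ℂ (Fin d)), X; 𝓘(ℂ, EuclideanSpace ℂ (Fin d)), CP d⟯}

/-- The pullback along `γ` of the standard projective structure, if `γ` is somewhere a local
biholomorphism. -/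
def branchedProjectiveStructure (hγ : ∃ x, Function.Injective
    (modelDeriv 𝓘(ℂ, EuclideanSpace ℂ (Fin d)) 𝓘(ℂ, EuclideanSpace ℂ (Fin d)) γ x)) :
    BranchedProjectiveStructure d X where
  toHolomorphicPrincipalBundle := principalBundle γ
  form p := form (γ := γ) p
  contMDiff_form := by
    have h := contMDiff_modelDeriv_apply (contMDiff_toPG (γ := γ))
    have h1 : (fun v : TangentBundle (bundleModel d) (PullbackTotal γ) => form v.proj v.2) =
        fun v => modelDeriv (bundleModel d) 𝓘(ℂ, Sl d) toPG v.proj v.2 :=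
      funext fun v => by rw [form_eq]
    rw [← h1] at h
    exact h
  bijective_form := ⟨_, isOpen_setOf_injective_modelDeriv γ.contMDiff, hγ,
    fun p hp => bijective_form_of_injective p hp⟩
  form_act p h v := form_act_modelDeriv p h v
  form_fiber p a := form_act_one_modelDeriv p a

/-- Near `p`, the form is the trace-free part of `A⁻¹ dA`, where `A` is a local matrix representative
of `toPG`, so that the Maurer-Cartan equation holds. -/
theorem isFlat_branchedProjectiveStructure (hγ : ∃ x, Function.Injective
    (modelDeriv 𝓘(ℂ, EuclideanSpace ℂ (Fin d)) 𝓘(ℂ, EuclideanSpace ℂ (Fin d)) γ x)) :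
    (branchedProjectiveStructure hγ).IsFlat := by
  intro p u v
  change PullbackTotal γ at p
  change EuclideanSpace ℂ (Fin d) × Par d at u v
  let ψ : EuclideanSpace ℂ (Fin d) × Par d → PullbackTotal γ := (extChartAt (bundleModel d) p).symm
  let c : EuclideanSpace ℂ (Fin d) × Par d := extChartAt (bundleModel d) p p
  let θ : EuclideanSpace ℂ (Fin d) × Par d → EuclideanSpace ℂ (Fin d) × Par d →L[ℂ] Sl d :=
    fun y => (form (ψ y)).comp
      (modelDeriv 𝓘(ℂ, EuclideanSpace ℂ (Fin d) × Par d) (bundleModel d) ψ y)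
  let B : PullbackTotal γ → Mat d := fun q => PG.localRep p.toPG q.toPG
  let A : EuclideanSpace ℂ (Fin d) × Par d → Mat d := fun y => B (ψ y)
  have hψc : ψ c = p := extChartAt_to_inv p
  have hψs : ContMDiffOn 𝓘(ℂ, EuclideanSpace ℂ (Fin d) × Par d) (bundleModel d) ω ψ
      (extChartAt (bundleModel d) p).target := contMDiffOn_extChartAt_symm p
  have hψ : ∀ᶠ y in 𝓝 c, ContMDiffAt 𝓘(ℂ, EuclideanSpace ℂ (Fin d) × Par d) (bundleModel d) ω
      ψ y := by
    have ho : IsOpen (extChartAt (bundleModel d) p).target := isOpen_extChartAt_target p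
    filter_upwards [ho.mem_nhds (mem_extChartAt_target p)] with y hy
    exact hψs.contMDiffAt (ho.mem_nhds hy)
  have hB : ContMDiffAt (bundleModel d) 𝓘(ℂ, Mat d) ω B p :=
    ContMDiffAt.comp (g := PG.localRep p.toPG) p (PG.contMDiffAt_localRep _)
      contMDiff_toPG.contMDiffAt
  have hA : ContDiffAt ℂ ω A c := by
    rw [← contMDiffAt_iff_contDiffAt]
    refine ContMDiffAt.comp (g := B) c ?_ hψ.self_of_nhds
    rwa [hψc]
  have hBs : ∀ᶠ q in 𝓝 p, q.toPG ∈ (PG.chart p.toPG).source :=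
    continuous_toPG.continuousAt ((PG.chart p.toPG).open_source.mem_nhds (PG.mem_chart_self _))
  have hAs : ∀ᶠ y in 𝓝 c, (ψ y).toPG ∈ (PG.chart p.toPG).source := by
    have h1 : Tendsto ψ (𝓝 c) (𝓝 p) := by
      have := hψ.self_of_nhds.continuousAt
      rwa [ContinuousAt, hψc] at this
    exact h1.eventually hBs
  have hu : IsUnit (A c) := PG.isUnit_localRep hAs.self_of_nhds
  have hθ : ∀ᶠ y in 𝓝 c, ∀ w, θ y w = traceFree d (Ring.inverse (A y) * fderiv ℂ A y w) := by
    filter_upwards [hψ, hAs.eventually_nhds, hA.eventually (by simp)] with y hy hy' hyA w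
    have h1 : toPG ∘ ψ =ᶠ[𝓝 y] PG.ofMat ∘ A := by
      filter_upwards [hy'] with z hz using (PG.ofMat_localRep hz).symm
    have h2 := modelDeriv_apply_of_eventuallyEq_ofMat
      (hyA.differentiableAt (by simp)).mdifferentiableAt
      (PG.isUnit_localRep hy'.self_of_nhds) h1 w
    rw [modelDeriv_eq_fderiv, modelDeriv_comp (mdifferentiable_toPG _)
      (hy.mdifferentiableAt (by simp)), ← form_eq] at h2
    exact h2
  -- In the preferred chart around `p`, the form at `p` is its own local expression.
  have hθc : ∀ w, θ c w = form p w := by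
    intro w
    have h1 : toPG =ᶠ[𝓝 p] PG.ofMat ∘ B := by
      filter_upwards [hBs] with z hz using (PG.ofMat_localRep hz).symm
    have hB' := hB.mdifferentiableAt (by simp)
    have h2 := modelDeriv_apply_of_eventuallyEq_ofMat hB'
      (PG.isUnit_localRep (PG.mem_chart_self p.toPG)) h1 w
    have h3 : modelDeriv (bundleModel d) 𝓘(ℂ, Mat d) B p = fderiv ℂ A c :=
      mfderiv_eq_fderiv_comp_extChartAt_symm hB'
    have h4 : B p = A c := congrArg B hψc.symm
    rw [hθ.self_of_nhds, form_eq, h2, h3, h4]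
  have key := fderiv_inverse_mul_fderiv hA hu hθ u v
  rw [hθc, hθc, ← groupLieAlgebra_bracket] at key
  exact key

theorem isPullbackOfStandard_branchedProjectiveStructure (hγ : ∃ x, Function.Injective
    (modelDeriv 𝓘(ℂ, EuclideanSpace ℂ (Fin d)) 𝓘(ℂ, EuclideanSpace ℂ (Fin d)) γ x)) :
    (branchedProjectiveStructure hγ).IsPullbackOfStandard γ :=
  ⟨toPG (γ := γ), contMDiff_toPG, fun _ _ => rfl, fun p => toPG_smul (γ := γ) p, fun _ _ => rfl⟩

end PullbackTotal

end CartanGeometry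

end

theorem proposition3p1 {d N : ℕ} {X : Type*} [TopologicalSpace X] [T2Space X] [CompactSpace X]
    [ConnectedSpace X] [ChartedSpace (EuclideanSpace ℂ (Fin d)) X]
    [IsManifold 𝓘(ℂ, EuclideanSpace ℂ (Fin d)) ω X]
    (f : X → CP N)
    (hf : Manifold.IsSmoothEmbedding 𝓘(ℂ, EuclideanSpace ℂ (Fin d))
      𝓘(ℂ, EuclideanSpace ℂ (Fin N)) ω f) :
    ∃ γ : X → CP d,
      ContMDiff 𝓘(ℂ, EuclideanSpace ℂ (Fin d)) 𝓘(ℂ, EuclideanSpace ℂ (Fin d)) ω γ ∧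
      IsLinearProjectionOf γ f ∧ IsFiniteMap γ ∧ Function.Surjective γ ∧
      ∃ P : BranchedProjectiveStructure d X, P.IsFlat ∧ P.IsPullbackOfStandard γ := by
  obtain ⟨γ, hγ, hL, hfin, hsurj, hx⟩ := exists_finite_surjective_linearProjection hf
  let Γ : C^ω⟮𝓘(ℂ, EuclideanSpace ℂ (Fin d)), X; 𝓘(ℂ, EuclideanSpace ℂ (Fin d)), CP d⟯ := ⟨γ, hγ⟩
  exact ⟨γ, hγ, hL, hfin, hsurj, PullbackTotal.branchedProjectiveStructure (γ := Γ) hx,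
    PullbackTotal.isFlat_branchedProjectiveStructure hx,
    PullbackTotal.isPullbackOfStandard_branchedProjectiveStructure hx⟩
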